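/- Let $F$ be a number field with ring of adeles $\mathbb{A}$, let $n\ge 1$ and $G=GL(n)$ over $F$. A parabolic subgroup of $G$ is called standard if it contains the Borel subgroup of upper triangular matrices; $P=M_PN_P$ denotes its standard Levi decomposition. Let $K\subset G(\mathbb{A})$ be the standard maximal compact subgroup ($O(n)$, $U(n)$, $GL_n(\mathcal{O}_v)$ at the real, complex and finite places respectively). For $P$ standard let $a_P=\mathrm{Hom}_{\mathbb{Z}}(X^*(P),\mathbb{R})$, viewed in $a_0=\mathbb{R}^n$ as the space of vectors that are constant on the blocks of $P$, and let $H_P:G(\mathbb{A})\to a_P$ be the Harish-Chandra map: $\langle\chi,H_P(pk)\rangle=\log|\chi(p)|_{\mathbb{A}}$ for $p\in P(\mathbb{A})$, $k\in K$, $\chi\in X^*(P)$. For standard parabolic subgroups $P\subset Q$, let $\Delta_P^Q$ be the set of simple roots in $M_Q$ not in $M_P$ (restricted to $a_P$), let $\hat\Delta_P^Q$ be the set of the corresponding fundamental weights of $M_Q$ (dual to the simple coroots and trivial on $a_Q$), let $\tau_P^Q$ (resp. $\hat\tau_P^Q$) be the characteristic function of the set of $H\in a_P$ with $\langle\alpha,H\rangle>0$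 for all $\alpha\in\Delta_P^Q$ (resp. $\langle\varpi,H\rangle>0$ for all $\varpi\in\hat\Delta_P^Q$), let $\rho_P^Q$ be half the sum of the roots of the diagonal torus in $N_P\cap M_Q$, and let $\varepsilon_P^Q=(-1)^{\dim a_P-\dim a_Q}$. For $g\in G(\mathbb{A})$ put $$\deg_i^Q(g)=\max_{(P,\delta)}\langle\rho_P^Q,H_P(\delta g)\rangle,$$ where $P\subset Q$ runs over the standard parabolic subgroups contained in $Q$ and $\delta$ over $P(F)\backslash Q(F)$, and let $F^Q$ be the characteristic function of the set of $g\in G(\mathbb{A})$ with $\deg_i^Q(g)\le 0$. Then the maximum defining $\deg_i^Q(g)$ is finite and attained for every standard parabolic subgroup $Q$ and every $g\in G(\mathbb{A})$, and for every such $Q$ and $g$: 1. $$1=\sum_{P\subset Q}\ \sum_{\delta\in P(F)\backslash Q(F)}F^P(\delta g)\,\tau_P^Q(H_P(\delta g));$$ 2. $$F^Q(g)=\sum_{P\subset Q}\varepsilon_P^Q\sum_{\delta\in P(F)\backslash Q(F)}\hat\tau_P^Q(H_P(\delta g)),$$ where $P$ runs over the standard parabolic subgroups contained in $Q$, and in each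 sum over $\delta$ only finitely many terms are non-zero. -/

import Mathlib

open NumberField IsDedekindDomain Matrix

noncomputable section

namespace Arthur

/-- The standard parabolic subgroup of `GL n` of type `P`, where `P` is an ordered partition
`n = n₁ + ⋯ + n_k`: its points over a commutative ring `R` are the invertible matrices that are
block upper triangular with diagonal blocks of sizes `n₁, …, n_k`. The standard parabolic
subgroups (those containing the upper triangular matrices) are in bijection with their types. -/
def parabolic {n : ℕ} (R : Type*) [CommRing R] (P : Composition n) :
    Subgroup (GL (Fin n) R) where
  carrier := {g | (g : Matrix (Fin n) (Fin n) R).BlockTriangular P.index}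
  one_mem' := by
    simpa using blockTriangular_one
  mul_mem' := by
    intro a b ha hb
    simpa using BlockTriangular.mul ha hb
  inv_mem' := by
    intro a ha
    have : Invertible (a : Matrix (Fin n) (Fin n) R) := a.invertible
    have h := blockTriangular_inv_of_blockTriangular
      (M := (a : Matrix (Fin n) (Fin n) R)) (b := P.index) ha
    simpa using h

/-- The set `P(F) \ Q(F)`: the quotient of `Q(F)` by left translations by `P(F)`. -/
abbrev LeftQuot {n : ℕ} (F : Type*) [Field F] (P Q : Composition n) : Type _ :=
  Quotient (QuotientGroup.rightRel ((parabolic F P).subgroupOf (parabolic F Q)))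

/-- The space `a_P`, inside `a_0 = ℝⁿ`: the vectors that are constant on the blocks of `P`. -/
def aSpace {n : ℕ} (P : Composition n) : Submodule ℝ (Fin n → ℝ) where
  carrier := {H | ∀ i j, P.index i = P.index j → H i = H j}
  zero_mem' := by
    intro i j _
    rfl
  add_mem' := by
    intro a b ha hb i j h
    simp [ha i j h, hb i j h]
  smul_mem' := by
    intro c a ha i j h
    simp [ha i j h]

/-- The sign `ε_P^Q = (-1) ^ (dim a_P - dim a_Q)`. -/
def eps {n : ℕ} (P Q : Composition n) : ℤ :=
  ((Module.finrank ℝ (aSpace P) : ℤ) - (Module.finrank ℝ (aSpace Q) : ℤ)).negOnePow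

/-- The character `t ↦ t_i / t_j` of the diagonal torus, in the dual of `a_0 = ℝⁿ` (identified
with `ℝⁿ` through the dot product). -/
def root {n : ℕ} (i j : Fin n) : Fin n → ℝ :=
  Pi.single i 1 - Pi.single j 1

/-- `ρ_P^Q`: half the sum of the roots of the diagonal torus in `N_P ∩ M_Q`. -/
def rho {n : ℕ} (P Q : Composition n) : Fin n → ℝ :=
  (1 / 2 : ℝ) • ∑ x : Fin n × Fin n with
    P.index x.1 < P.index x.2 ∧ Q.index x.1 = Q.index x.2, root x.1 x.2

/-- `i` is the last index of a block of `P` and is not the last index of a block of `Q`: the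
simple root `t_i / t_{i+1}` belongs to `M_Q` and not to `M_P`. -/
def IsCut {n : ℕ} (P Q : Composition n) (i j : Fin n) : Prop :=
  (i : ℕ) + 1 = j ∧ P.index i ≠ P.index j ∧ Q.index i = Q.index j

/-- The simple roots `Δ_P^Q`, as linear forms on `a_0` that are to be restricted to `a_P`. -/
def simpleRoots {n : ℕ} (P Q : Composition n) : Set (Fin n → ℝ) :=
  {α | ∃ i j, IsCut P Q i j ∧ α = root i j}

/-- The fundamental weight of `M_Q` attached to the simple root `t_i / t_{i+1}` of `M_Q`. It
vanishes on `a_Q`, its pairing with the simple coroot `e_i - e_{i+1}` is `1`, and its pairing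
with the other simple coroots of `M_Q` is `0`. -/
def fundWeight {n : ℕ} (Q : Composition n) (i : Fin n) : Fin n → ℝ := fun l =>
  if Q.index l = Q.index i then
    (if l ≤ i then 1 else 0) -
      (Finset.card {m : Fin n | Q.index m = Q.index i ∧ m ≤ i} : ℝ) /
        (Finset.card {m : Fin n | Q.index m = Q.index i} : ℝ)
  else 0

/-- The simple weights `Δ̂_P^Q`. -/
def simpleWeights {n : ℕ} (P Q : Composition n) : Set (Fin n → ℝ) :=
  {w | ∃ i j, IsCut P Q i j ∧ w = fundWeight Q i}

open Classical in
/-- `τ_P^Q`: characteristic function of the open cone defined by the simple roots. -/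
def tau {n : ℕ} (P Q : Composition n) (H : Fin n → ℝ) : ℤ :=
  if ∀ α ∈ simpleRoots P Q, 0 < α ⬝ᵥ H then 1 else 0

open Classical in
/-- `τ̂_P^Q`: characteristic function of the open cone defined by the simple weights. -/
def tauHat {n : ℕ} (P Q : Composition n) (H : Fin n → ℝ) : ℤ :=
  if ∀ w ∈ simpleWeights P Q, 0 < w ⬝ᵥ H then 1 else 0

section Adelic

variable {F : Type*} [Field F] [NumberField F] {n : ℕ}

/-- The adelic absolute value of an idele: the product of its normalised local absolute values. -/
def adelicAbs (x : AdeleRing (𝓞 F) F) : ℝ :=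
  (∏ v : InfinitePlace F, ‖x.1 v‖ ^ v.mult) * ∏ᶠ v : HeightOneSpectrum (𝓞 F), ‖x.2 v‖

/-- The standard maximal compact subgroup `K` of `GL n (𝔸)`: `O(n)` at the real places, `U(n)`
at the complex places, and `GL n (O_v)` at the finite places `v`. -/
def maxCompact (F : Type*) [Field F] [NumberField F] (n : ℕ) :
    Set (GL (Fin n) (AdeleRing (𝓞 F) F)) :=
  {k | (∀ v : InfinitePlace F,
      (Matrix.of fun i j => InfinitePlace.Completion.extensionEmbedding v ((k i j).1 v)) ∈
        Matrix.unitaryGroup (Fin n) ℂ) ∧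
    ∀ v : HeightOneSpectrum (𝓞 F), ∀ i j,
      (k i j).2 v ∈ v.adicCompletionIntegers F ∧ (k⁻¹ i j).2 v ∈ v.adicCompletionIntegers F}

/-- `H ∈ a_P` is the image of `g ∈ GL n (𝔸)` under the Harish-Chandra map: `g = p k` with
`p ∈ P(𝔸)`, `k ∈ K`, and `⟨χ, H⟩ = log |χ(p)|` for every rational character `χ` of `P`. It is
enough to take for `χ` the determinants of the diagonal blocks, since they form a basis of the
group of rational characters of `P`. -/
def IsHarishChandra (P : Composition n) (g : GL (Fin n) (AdeleRing (𝓞 F) F))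
    (H : Fin n → ℝ) : Prop :=
  H ∈ aSpace P ∧ ∃ p ∈ parabolic (AdeleRing (𝓞 F) F) P, ∃ k ∈ maxCompact F n, g = p * k ∧
    ∀ b : Fin P.length, ∑ i : Fin n with P.index i = b, H i =
      Real.log (adelicAbs
        ((p : Matrix (Fin n) (Fin n) (AdeleRing (𝓞 F) F)).toSquareBlock P.index b).det)

/-- The Harish-Chandra map `H_P : GL n (𝔸) → a_P ⊂ ℝⁿ`. -/
def HC (P : Composition n) (g : GL (Fin n) (AdeleRing (𝓞 F) F)) : Fin n → ℝ :=
  Classical.epsilon (IsHarishChandra P g)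

/-- The embedding of `GL n (F)` in `GL n (𝔸)`. -/
def diag (δ : GL (Fin n) F) : GL (Fin n) (AdeleRing (𝓞 F) F) :=
  Matrix.GeneralLinearGroup.map (algebraMap F (AdeleRing (𝓞 F) F)) δ

/-- The numbers `⟨ρ_P^Q, H_P(δ g)⟩`, for `P ⊂ Q` standard and `δ ∈ Q(F)`. -/
def degSet (Q : Composition n) (g : GL (Fin n) (AdeleRing (𝓞 F) F)) : Set ℝ :=
  {r | ∃ P : Composition n, parabolic F P ≤ parabolic F Q ∧
    ∃ δ ∈ parabolic F Q, r = rho P Q ⬝ᵥ HC P (diag δ * g)}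

/-- The degree of instability `deg_i^Q(g)` of `g` along `Q`. -/
def degI (Q : Composition n) (g : GL (Fin n) (AdeleRing (𝓞 F) F)) : ℝ :=
  sSup (degSet Q g)

open Classical in
/-- `F^Q`: characteristic function of the `g` with `deg_i^Q(g) ≤ 0`. -/
def truncF (Q : Composition n) (g : GL (Fin n) (AdeleRing (𝓞 F) F)) : ℤ :=
  if degI Q g ≤ 0 then 1 else 0

end Adelic

open Classical in
/-- The standard parabolic subgroups contained in `Q`. -/
def below (F : Type*) [Field F] {n : ℕ} (Q : Composition n) : Finset (Composition n) :=
  {P : Composition n | parabolic F P ≤ parabolic F Q}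

end Arthur

end

/-!
The row vectors of an element `δ` of `GL n (F)` from each boundary of `P` on span the members of a
flag of subspaces of `F ^ n`, and in this way the disjoint union of the quotients `P(F) \ Q(F)`,
for `P ⊂ Q`, is in bijection with the flags that refine the flag `U` of `Q` (`sum_leftQuot`). The
element `g` defines metrics on the completions of `F ^ n`, hence a logarithmic height `height g W`
(minus the Arakelov degree) of each subspace `W`, and the sums of the last coordinates of
`H_P(δ g)` are the heights of the members of the flag of `δ` (`tail_HC`). If a flag is drawn as a
polygon in the plane with coordinates dimension and height, then

* `τ_P^Q(H_P(δ g)) = 1` means that the polygon is strictly convex at the vertices that do not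
  belong to `U` (`tau_eq`);
* `τ̂_P^Q(H_P(δ g)) = 1` means that these vertices lie strictly below the polygon of `U`
  (`tauHat_eq`);
* `F^P(δ g) = 1` means that no subspace that can be inserted in the flag lies below the polygon,
  that is, that the successive quotients of the flag are semistable (`truncF_eq`). The reason is
  that `ρ_P^Q` is the sum of the fundamental weights of `M_Q` on `a_P` (`rho_dot`).

The first identity is thus the existence and the uniqueness of the Harder–Narasimhan filtration,
relative to `U` (`SlopeLattice.existsUnique_hnFlag`). The second one is an alternating sum over the
flags below the polygon of `U`: if `U` is not semistable, the flags cancel in pairs, by insertion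
or removal of the join of a lowest subspace `M` with the largest member of the flag that does not
contain `M` (`SlopeLattice.sum_flags_below`). Both arguments only use that the lattice of subspaces
is modular, that the height is submodular, and that there are finitely many subspaces of bounded
height, and they are carried out for such lattices (`SlopeLattice`).

Heights are well defined and submodular because of the Iwasawa decomposition (`exists_iwasawa`), the
fact that the minors of the elements of `K` are bounded by `1` at all places
(`norm_minor_le_one`), and the product formula. The finiteness (`finite_height_le`) is deduced from
Northcott's theorem for elements of `F`: a subspace is the row space of a matrix whose entries are
ratios of minors, and the heights of these ratios are controlled by the height of the subspace. The
finiteness also shows that the degree of instability is attained (`isGreatest_degI`).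
-/

open NumberField IsDedekindDomain Matrix

noncomputable section

namespace Arthur

/-! ### Lattices with a rank and a height -/

/-- A lattice with a strictly increasing modular rank and a submodular height with finite sublevel
sets: the abstract setting of the Harder–Narasimhan theory. In the application the lattice consists
of the subspaces of `F ^ n`, the rank is the dimension, and the height is minus the degree. -/
structure SlopeLattice (L : Type*) [Lattice L] [BoundedOrder L] where
  /-- the rank function -/
  rk : L → ℝ
  /-- the height function -/
  ht : L → ℝ
  rk_strictMono : StrictMono rk
  rk_modular : ∀ a b, rk (a ⊔ b) + rk (a ⊓ b) = rk a + rk b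
  ht_submodular : ∀ a b, ht (a ⊔ b) + ht (a ⊓ b) ≤ ht a + ht b
  finite_le : ∀ B : ℝ, {x | ht x ≤ B}.Finite

section Order

variable {L : Type*} [Lattice L] [BoundedOrder L]

/-- A flag: a finite chain that contains the bottom and the top element. -/
structure IsFlag (C : Finset L) : Prop where
  chain : IsChain (· ≤ ·) (C : Set L)
  bot_mem : ⊥ ∈ C
  top_mem : ⊤ ∈ C

/-- `A < B` are neighbours in `C`. -/
structure Consec (C : Finset L) (A B : L) : Prop where
  left_mem : A ∈ C
  right_mem : B ∈ C
  lt : A < B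
  not_between : ∀ X ∈ C, ¬ (A < X ∧ X < B)

variable {C U : Finset L} {A B A' B' W X Y : L}

theorem IsFlag.total (h : IsFlag C) (hX : X ∈ C) (hY : Y ∈ C) : X ≤ Y ∨ Y ≤ X :=
  h.chain.total hX hY

theorem IsFlag.lt_or_le (h : IsFlag C) (hX : X ∈ C) (hY : Y ∈ C) : X < Y ∨ Y ≤ X := by
  rcases h.total hX hY with h | h
  · rcases h.eq_or_lt with rfl | h
    · exact Or.inr le_rfl
    · exact Or.inl h
  · exact Or.inr h

theorem Consec.le_or_le (h : Consec C A B) (hC : IsFlag C) (hX : X ∈ C) : X ≤ A ∨ B ≤ X := by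
  rcases hC.lt_or_le h.left_mem hX with h1 | h1
  · rcases hC.lt_or_le hX h.right_mem with h2 | h2
    · exact absurd ⟨h1, h2⟩ (h.not_between X hX)
    · exact Or.inr h2
  · exact Or.inl h1

theorem Consec.comparable (h : Consec C A B) (hC : IsFlag C) (hAW : A < W) (hWB : W < B)
    (hX : X ∈ C) : X ≤ W ∨ W ≤ X :=
  (h.le_or_le hC hX).imp (fun h1 => h1.trans hAW.le) fun h1 => hWB.le.trans h1

omit [BoundedOrder L] in
theorem Consec.notMem (h : Consec C A B) (hAW : A < W) (hWB : W < B) : W ∉ C :=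
  fun hW => h.not_between W hW ⟨hAW, hWB⟩

/-- Two gaps of a flag that contain a common element coincide. -/
theorem Consec.unique (hC : IsFlag C) (h : Consec C A B) (h' : Consec C A' B') (hAW : A < W)
    (hWB : W < B) (hAW' : A' < W) (hWB' : W < B') : A = A' ∧ B = B' := by
  have key : ∀ {A B A' B' : L}, Consec C A B → Consec C A' B' → A < W → W < B → A' < W → W < B' →
      A' ≤ A ∧ B ≤ B' := by
    intro A B A' B' h h' h1 h2 h3 h4
    constructor
    · exact (h.le_or_le hC h'.left_mem).resolve_right fun h5 => (h3.trans (h2.trans_le h5)).false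
    · exact (h.le_or_le hC h'.right_mem).resolve_left fun h5 => (h4.trans_le (h5.trans h1.le)).false
  have h1 := key h h' hAW hWB hAW' hWB'
  have h2 := key h' h hAW' hWB' hAW hWB
  exact ⟨le_antisymm h2.1 h1.1, le_antisymm h1.2 h2.2⟩

theorem IsFlag.exists_pred (hC : IsFlag C) (hW : W ≠ ⊥) :
    ∃ P ∈ C, P < W ∧ ∀ X ∈ C, X < W → X ≤ P := by
  classical
  obtain ⟨P, hP⟩ := (C.filter (· < W)).exists_maximal
    ⟨⊥, by simpa [hC.bot_mem] using bot_lt_iff_ne_bot.2 hW⟩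
  have hP1 := Finset.mem_filter.1 hP.1
  refine ⟨P, hP1.1, hP1.2, fun X hX hXW => ?_⟩
  rcases hC.total hX hP1.1 with h | h
  · exact h
  · exact hP.2 (Finset.mem_filter.2 ⟨hX, hXW⟩) h

theorem IsFlag.exists_succ (hC : IsFlag C) (hW : W ≠ ⊤) :
    ∃ P ∈ C, W < P ∧ ∀ X ∈ C, W < X → P ≤ X := by
  classical
  obtain ⟨P, hP⟩ := (C.filter (W < ·)).exists_minimal
    ⟨⊤, by simpa [hC.top_mem] using lt_top_iff_ne_top.2 hW⟩
  have hP1 := Finset.mem_filter.1 hP.1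
  refine ⟨P, hP1.1, hP1.2, fun X hX hXW => ?_⟩
  rcases hC.total hP1.1 hX with h | h
  · exact h
  · exact hP.2 (Finset.mem_filter.2 ⟨hX, hXW⟩) h

theorem IsFlag.exists_consec_pred (hC : IsFlag C) (hWC : W ∈ C) (hW : W ≠ ⊥) :
    ∃ P, Consec C P W := by
  obtain ⟨P, hP, hPW, h⟩ := hC.exists_pred hW
  exact ⟨P, hP, hWC, hPW, fun X hX h1 => (h1.1.trans_le (h X hX h1.2)).false⟩

theorem IsFlag.exists_consec_succ (hC : IsFlag C) (hWC : W ∈ C) (hW : W ≠ ⊤) :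
    ∃ P, Consec C W P := by
  obtain ⟨P, hP, hPW, h⟩ := hC.exists_succ hW
  exact ⟨P, hWC, hP, hPW, fun X hX h1 => ((h X hX h1.1).trans_lt h1.2).false⟩

/-- An element outside a flag and comparable to all its members lies in a gap of the flag. -/
theorem IsFlag.exists_gap (hC : IsFlag C) (hW : W ∉ C) (hcomp : ∀ X ∈ C, X ≤ W ∨ W ≤ X) :
    ∃ A B, Consec C A B ∧ A < W ∧ W < B := by
  obtain ⟨A, hA, hAW, h1⟩ := hC.exists_pred (W := W) (fun h => hW (h ▸ hC.bot_mem))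
  obtain ⟨B, hB, hWB, h2⟩ := hC.exists_succ (W := W) (fun h => hW (h ▸ hC.top_mem))
  refine ⟨A, B, ⟨hA, hB, hAW.trans hWB, fun X hX h => ?_⟩, hAW, hWB⟩
  have hne : X ≠ W := fun h => hW (h ▸ hX)
  rcases hcomp X hX with h3 | h3
  · exact (h.1.trans_le (h1 X hX (lt_of_le_of_ne h3 hne))).false
  · exact ((h2 X hX (lt_of_le_of_ne h3 hne.symm)).trans_lt h.2).false

/-- A gap of a flag `C` lies in a gap of any coarser flag. -/
theorem Consec.exists_coarser (hC : IsFlag C) (hU : IsFlag U) (hUC : U ⊆ C) (h : Consec C A B) :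
    ∃ A' B', Consec U A' B' ∧ A' ≤ A ∧ B ≤ B' := by
  obtain ⟨B', hB', hAB', h2⟩ := hU.exists_succ (W := A) (h.lt.trans_le le_top).ne
  obtain ⟨A', hA', hAA', h1⟩ := hU.exists_pred (W := B) (bot_le.trans_lt h.lt).ne'
  have hA'A : A' ≤ A := (h.le_or_le hC (hUC hA')).resolve_right hAA'.not_ge
  have hBB' : B ≤ B' := (h.le_or_le hC (hUC hB')).resolve_left hAB'.not_ge
  refine ⟨A', B', ⟨hA', hB', hA'A.trans_lt hAB', fun X hX hx => ?_⟩, hA'A, hBB'⟩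
  rcases h.le_or_le hC (hUC hX) with h3 | h3
  · exact (hx.1.trans_le (h1 X hX (h3.trans_lt h.lt))).false
  · exact ((h2 X hX (h.lt.trans_le h3)).trans_lt hx.2).false

theorem isFlag_insert {L : Type*} [Lattice L] [BoundedOrder L] [DecidableEq L] {C : Finset L}
    {A B W : L} (hC : IsFlag C) (h : Consec C A B) (hAW : A < W) (hWB : W < B) :
    IsFlag (insert W C) := by
  refine ⟨?_, Finset.mem_insert_of_mem hC.bot_mem, Finset.mem_insert_of_mem hC.top_mem⟩
  rw [Finset.coe_insert]
  exact hC.chain.insert fun X hX _ => (h.comparable hC hAW hWB hX).symm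

end Order

namespace SlopeLattice

variable {L : Type*} [Lattice L] [BoundedOrder L] (D : SlopeLattice L)

/-- For `A < W < B`, the sign of `defect A W B` says on which side of the chord from `A` to `B`
the point `W` lies in the `(rk, ht)`-plane: below the chord when the defect is negative. -/
def defect (A W B : L) : ℝ :=
  (D.ht W - D.ht A) * (D.rk B - D.rk W) - (D.ht B - D.ht W) * (D.rk W - D.rk A)

/-- No element that can be inserted in a gap of the flag lies below its chord. -/
def Semistable (C : Finset L) : Prop :=
  ∀ A B, Consec C A B → ∀ W, A < W → W < B → 0 ≤ D.defect A W B

/-- The polygon of `C` is strictly convex at the vertices that do not belong to `U`. -/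
def StrictlyConvex (U C : Finset L) : Prop :=
  ∀ A W B, Consec C A W → Consec C W B → W ∉ U → D.defect A W B < 0

/-- All members of `C` lie strictly below the chords of `U`. -/
def Below (U C : Finset L) : Prop :=
  ∀ A B, Consec U A B → ∀ W ∈ C, A < W → W < B → D.defect A W B < 0

/-- `W` lies in a gap of `U` and, within that gap, every slope that ends in `W` is less than every
slope that starts from `W`. The Harder–Narasimhan flag consists of `U` and these elements. -/
def IsBreak (U : Finset L) (W : L) : Prop :=
  ∃ A B, Consec U A B ∧ A < W ∧ W < B ∧
    ∀ X Y, A ≤ X → X < W → W < Y → Y ≤ B → D.defect X W Y < 0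

/-- The height minus `μ` times the rank. -/
def twist (μ : ℝ) (x : L) : ℝ := D.ht x - μ * D.rk x

/-- The slope of the chord from `A` to `B`. -/
def slope (A B : L) : ℝ := (D.ht B - D.ht A) / (D.rk B - D.rk A)

variable {D} {C U : Finset L} {A B W X Y P Q M : L} {μ : ℝ}

theorem rk_lt (h : A < B) : 0 < D.rk B - D.rk A := sub_pos.2 (D.rk_strictMono h)

theorem rk_le (h : A ≤ B) : D.rk A ≤ D.rk B := D.rk_strictMono.monotone h

theorem twist_submodular (μ : ℝ) (a b : L) :
    D.twist μ (a ⊔ b) + D.twist μ (a ⊓ b) ≤ D.twist μ a + D.twist μ b := by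
  have h1 := D.ht_submodular a b
  have h2 := D.rk_modular a b
  unfold twist
  linear_combination h1 - μ * h2

theorem defect_eq_twist (μ : ℝ) (A W B : L) :
    D.defect A W B = (D.twist μ W - D.twist μ A) * (D.rk B - D.rk W) -
      (D.twist μ B - D.twist μ W) * (D.rk W - D.rk A) := by
  unfold defect twist; ring

theorem twist_slope (h : A < B) : D.twist (D.slope A B) A = D.twist (D.slope A B) B := by
  have := (rk_lt (D := D) h).ne'
  unfold twist slope
  field_simp
  ring

theorem defect_eq_twist_slope (h : A < B) (W : L) :
    D.defect A W B =
      (D.twist (D.slope A B) W - D.twist (D.slope A B) A) * (D.rk B - D.rk A) := by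
  rw [defect_eq_twist (D.slope A B), ← twist_slope h]
  ring

theorem defect_neg_iff (h : A < B) :
    D.defect A W B < 0 ↔ D.twist (D.slope A B) W < D.twist (D.slope A B) A := by
  rw [defect_eq_twist_slope h]
  have := rk_lt (D := D) h
  constructor
  · intro h1
    by_contra! h2
    nlinarith
  · intro h1
    nlinarith

/-- On a bounded interval a twist takes its minimum, and among the points where it does there is
one of maximal rank. -/
theorem exists_min_twist (hAB : A ≤ B) (μ : ℝ) :
    ∃ M, A ≤ M ∧ M ≤ B ∧ (∀ X, A ≤ X → X ≤ B → D.twist μ M ≤ D.twist μ X) ∧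
      ∀ X, M < X → X ≤ B → D.twist μ M < D.twist μ X := by
  set S : Set L := {X | A ≤ X ∧ X ≤ B ∧ D.twist μ X ≤ D.twist μ A} with hS
  have hfin : S.Finite := by
    refine (D.finite_le (D.twist μ A + |μ| * (|D.rk A| + |D.rk B|))).subset ?_
    rintro X ⟨h1, h2, h3⟩
    have h4 : |D.rk X| ≤ |D.rk A| + |D.rk B| := by
      rw [abs_le]
      have := rk_le (D := D) h1
      have := rk_le (D := D) h2
      constructor <;>
        linarith [neg_abs_le (D.rk A), le_abs_self (D.rk B), abs_nonneg (D.rk B),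
          abs_nonneg (D.rk A)]
    have h5 : μ * D.rk X ≤ |μ| * (|D.rk A| + |D.rk B|) :=
      (le_abs_self _).trans (by rw [abs_mul]; gcongr)
    simp only [Set.mem_ofPred_eq]
    unfold twist at *
    linarith
  have hA : A ∈ S := ⟨le_rfl, hAB, le_rfl⟩
  obtain ⟨M0, hM0, hmin⟩ := Set.exists_min_image S (D.twist μ) hfin ⟨A, hA⟩
  obtain ⟨M, hM, hmax⟩ := Set.exists_max_image {X ∈ S | D.twist μ X = D.twist μ M0} D.rk
    (hfin.subset fun x hx => hx.1) ⟨M0, hM0, rfl⟩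
  have hMmin : ∀ X, A ≤ X → X ≤ B → D.twist μ M ≤ D.twist μ X := by
    intro X h1 h2
    rw [hM.2]
    by_cases h3 : D.twist μ X ≤ D.twist μ A
    · exact hmin X ⟨h1, h2, h3⟩
    · exact (hmin A hA).trans (not_le.1 h3).le
  refine ⟨M, hM.1.1, hM.1.2.1, hMmin, fun X h1 h2 => ?_⟩
  refine lt_of_le_of_ne (hMmin X (hM.1.1.trans h1.le) h2) fun h3 => ?_
  have := hmax X ⟨⟨hM.1.1.trans h1.le, h2, h3 ▸ hM.1.2.2⟩, h3 ▸ hM.2⟩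
  exact (D.rk_strictMono h1).not_ge this

/-! ### Existence of the Harder–Narasimhan flag -/

theorem finite_below_chord (A B : L) : {W | A < W ∧ W < B ∧ D.defect A W B < 0}.Finite := by
  refine (D.finite_le (max (D.ht A) (D.ht B))).subset ?_
  rintro W ⟨h1, h2, h3⟩
  have h4 := rk_lt (D := D) h1
  have h5 := rk_lt (D := D) h2
  unfold defect at h3
  simp only [Set.mem_ofPred_eq]
  by_contra! h6
  have h7 := (le_max_left _ _).trans_lt h6
  have h8 := (le_max_right _ _).trans_lt h6
  nlinarith

theorem finite_below_chords (U : Finset L) :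
    {W | ∃ A B, Consec U A B ∧ A < W ∧ W < B ∧ D.defect A W B < 0}.Finite := by
  refine (Set.Finite.biUnion (U ×ˢ U).finite_toSet
    fun p _ => finite_below_chord (D := D) p.1 p.2).subset ?_
  rintro W ⟨A, B, h, h1⟩
  exact Set.mem_biUnion (x := (A, B)) (by simp [h.left_mem, h.right_mem]) h1

theorem IsBreak.below (h : D.IsBreak U W) :
    ∃ A B, Consec U A B ∧ A < W ∧ W < B ∧ D.defect A W B < 0 := by
  obtain ⟨A, B, h1, h2, h3, h4⟩ := h
  exact ⟨A, B, h1, h2, h3, h4 A B le_rfl h2 h3 le_rfl⟩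

theorem finite_isBreak (U : Finset L) : {W | D.IsBreak U W}.Finite :=
  (finite_below_chords (D := D) U).subset fun _ hW => hW.below

open Classical in
/-- The Harder–Narasimhan flag relative to `U`. -/
def hnFlag (D : SlopeLattice L) (U : Finset L) : Finset L :=
  U ∪ (finite_isBreak (D := D) U).toFinset

theorem mem_hnFlag : W ∈ D.hnFlag U ↔ W ∈ U ∨ D.IsBreak U W := by
  simp [hnFlag]

theorem IsBreak.prop (hU : IsFlag U) (h : D.IsBreak U W) (hAB : Consec U A B) (hA : A < W)
    (hB : W < B) : ∀ X Y, A ≤ X → X < W → W < Y → Y ≤ B → D.defect X W Y < 0 := by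
  obtain ⟨A', B', h1, h2, h3, h4⟩ := h
  obtain ⟨rfl, rfl⟩ := hAB.unique hU h1 hA hB h2 h3
  exact h4

/-- Two elements of which each has its incoming slopes below its outgoing ones are comparable:
otherwise submodularity, applied to their meet and join, gives a cycle of strict inequalities. -/
theorem comparable_of_defect_neg {W W' : L} (h : ¬ W ≤ W') (h' : ¬ W' ≤ W)
    (h1 : D.defect (W ⊓ W') W (W ⊔ W') < 0) (h2 : D.defect (W ⊓ W') W' (W ⊔ W') < 0) : False := by
  have hr := D.rk_modular W W'
  have hs := D.ht_submodular W W'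
  have a1 : 0 < D.rk W - D.rk (W ⊓ W') := rk_lt (inf_lt_left.2 h)
  have a2 : 0 < D.rk W' - D.rk (W ⊓ W') := rk_lt (inf_lt_right.2 h')
  unfold defect at h1 h2
  have e1 : D.rk (W ⊔ W') - D.rk W = D.rk W' - D.rk (W ⊓ W') := by linarith
  have e2 : D.rk (W ⊔ W') - D.rk W' = D.rk W - D.rk (W ⊓ W') := by linarith
  rw [e1] at h1
  rw [e2] at h2
  set s := D.rk W - D.rk (W ⊓ W')
  set t := D.rk W' - D.rk (W ⊓ W')
  nlinarith

theorem isFlag_hnFlag (hU : IsFlag U) : IsFlag (D.hnFlag U) := by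
  refine ⟨?_, mem_hnFlag.2 (Or.inl hU.bot_mem), mem_hnFlag.2 (Or.inl hU.top_mem)⟩
  have key : ∀ X ∈ U, ∀ W, D.IsBreak U W → X ≤ W ∨ W ≤ X := by
    rintro X hX W ⟨A, B, h, h1, h2, -⟩
    exact h.comparable hU h1 h2 hX
  intro W hW W' hW' _
  rcases mem_hnFlag.1 hW with h | h <;> rcases mem_hnFlag.1 hW' with h' | h'
  · exact hU.total h h'
  · exact key W h W' h'
  · exact (key W' h' W h).symm
  · obtain ⟨A, B, hAB, h1, h2, h3⟩ := h
    obtain ⟨A', B', hAB', h1', h2', h3'⟩ := id h'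
    rcases hAB.comparable hU h1 h2 hAB'.left_mem with h4 | h4
    swap
    · exact Or.inl (h4.trans h1'.le)
    rcases hAB.comparable hU h1 h2 hAB'.right_mem with h5 | h5
    · exact Or.inr (h2'.le.trans h5)
    by_contra! hne
    have h6 : A' < W := lt_of_le_of_ne h4 fun h => hAB.notMem h1 h2 (h ▸ hAB'.left_mem)
    have h7 : W < B' := lt_of_le_of_ne h5 fun h => hAB.notMem h1 h2 (h ▸ hAB'.right_mem)
    obtain ⟨rfl, rfl⟩ := hAB.unique hU hAB' h1 h2 h6 h7
    exact comparable_of_defect_neg hne.1 hne.2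
      (h3 _ _ (le_inf h1.le h1'.le) (inf_lt_left.2 hne.1) (left_lt_sup.2 hne.2)
        (sup_le h2.le h2'.le))
      (h3' _ _ (le_inf h1.le h1'.le) (inf_lt_right.2 hne.2) (right_lt_sup.2 hne.1)
        (sup_le h2.le h2'.le))

theorem subset_hnFlag : U ⊆ D.hnFlag U := fun _ h => mem_hnFlag.2 (Or.inl h)

theorem strictlyConvex_hnFlag (hU : IsFlag U) : D.StrictlyConvex U (D.hnFlag U) := by
  intro A W B hA hB hW
  obtain ⟨A', B', h, h1, h2, h3⟩ := (mem_hnFlag.1 hA.right_mem).resolve_left hW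
  have hF := isFlag_hnFlag (D := D) hU
  exact h3 A B ((hA.le_or_le hF (subset_hnFlag h.left_mem)).resolve_right h1.not_ge) hA.lt hB.lt
    ((hB.le_or_le hF (subset_hnFlag h.right_mem)).resolve_left h2.not_ge)

/-- If some element lay below the chord of a gap of the Harder–Narasimhan flag, then the lowest
one, taken of maximal rank, would be a further break. -/
theorem semistable_hnFlag (hU : IsFlag U) : D.Semistable (D.hnFlag U) := by
  intro P Q hPQ X0 hPX0 hX0Q
  by_contra! hneg
  have hF := isFlag_hnFlag (D := D) hU
  obtain ⟨A, B, hAB, hAP, hQB⟩ := hPQ.exists_coarser hF hU subset_hnFlag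
  set μ := D.slope P Q with hμ
  have hePQ : D.twist μ P = D.twist μ Q := twist_slope hPQ.lt
  obtain ⟨X, hPX, hXQ, hmin, hmax⟩ := exists_min_twist (D := D) hPQ.lt.le μ
  have hXP : D.twist μ X < D.twist μ P :=
    (hmin X0 hPX0.le hX0Q.le).trans_lt ((defect_neg_iff hPQ.lt).1 hneg)
  have hPX' : P < X := lt_of_le_of_ne hPX fun h => by simp [h] at hXP
  have hXQ' : X < Q := lt_of_le_of_ne hXQ fun h => by simp [h, hePQ] at hXP
  refine hPQ.notMem hPX' hXQ' (mem_hnFlag.2 (Or.inr ⟨A, B, hAB, hAP.trans_lt hPX',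
    hXQ'.trans_le hQB, fun Y Z hAY hYX hXZ hZB => ?_⟩))
  have rPQ := rk_lt (D := D) hPQ.lt
  -- below `P` and above `Q` the twist is at least its common value at `P` and `Q`
  have hlow : ∀ Z, A ≤ Z → Z ≤ P → D.twist μ P ≤ D.twist μ Z := by
    intro Z hAZ hZP
    rcases hZP.eq_or_lt with rfl | hZP
    · exact le_rfl
    have hA : A < P := hAZ.trans_lt hZP
    have hB : P < B := hPQ.lt.trans_le hQB
    have hbr := (mem_hnFlag.1 hPQ.left_mem).resolve_left (hAB.notMem hA hB)
    have h1 := hbr.prop hU hAB hA hB Z Q hAZ hZP hPQ.lt hQB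
    rw [defect_eq_twist μ, hePQ] at h1
    rw [hePQ]
    have := rk_lt (D := D) hZP
    nlinarith
  have hhigh : ∀ Z, Q ≤ Z → Z ≤ B → D.twist μ Q ≤ D.twist μ Z ∧
      (Q < Z → D.twist μ Q < D.twist μ Z) := by
    intro Z hQZ hZB
    rcases hQZ.eq_or_lt with rfl | hQZ
    · exact ⟨le_rfl, fun h => (h.false).elim⟩
    have hB : Q < B := hQZ.trans_le hZB
    have hA : A < Q := hAP.trans_lt hPQ.lt
    have hbr := (mem_hnFlag.1 hPQ.right_mem).resolve_left (hAB.notMem hA hB)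
    have h1 := hbr.prop hU hAB hA hB P Z hAP hPQ.lt hQZ hZB
    rw [defect_eq_twist μ, hePQ] at h1
    have := rk_lt (D := D) hQZ
    have h2 : D.twist μ Q < D.twist μ Z := by nlinarith
    exact ⟨h2.le, fun _ => h2⟩
  have hY : D.twist μ X ≤ D.twist μ Y := by
    have h1 := twist_submodular (D := D) μ Y P
    have h2 := hmin (Y ⊔ P) le_sup_right (sup_le (hYX.le.trans hXQ) hPQ.lt.le)
    have h3 := hlow (Y ⊓ P) (le_inf hAY hAP) inf_le_right
    linarith
  have hZ : D.twist μ X < D.twist μ Z := by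
    have h1 := twist_submodular (D := D) μ Z Q
    have h2 := hmin (Z ⊓ Q) (le_inf (hPX.trans hXZ.le) hPQ.lt.le) inf_le_right
    have h3 := hhigh (Z ⊔ Q) le_sup_right (sup_le hZB hQB)
    by_cases hZQ : Z ≤ Q
    · exact hmax Z hXZ hZQ
    · have h4 := h3.2 (right_lt_sup.2 hZQ)
      linarith
  rw [defect_eq_twist μ]
  have := rk_lt (D := D) hYX
  have := rk_lt (D := D) hXZ
  nlinarith

/-! ### Uniqueness of the Harder–Narasimhan flag -/

/-- In a gap of `U`, every slope that ends in a vertex `W` of a convex semistable flag is at most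
the slope of the edge that ends in `W`. -/
theorem slope_le_left (hC : IsFlag C) (hUC : U ⊆ C) (hconv : D.StrictlyConvex U C)
    (hss : D.Semistable C) {A B : L} (hAB : Consec U A B) :
    ∀ V W, Consec C V W → A ≤ V → W ≤ B → ∀ X, A ≤ X → X ≤ W →
      D.twist (D.slope V W) W ≤ D.twist (D.slope V W) X := by
  classical
  have key : ∀ m : ℕ, ∀ V W, (C.filter (· < V)).card = m → Consec C V W → A ≤ V → W ≤ B →
      ∀ X, A ≤ X → X ≤ W → D.twist (D.slope V W) W ≤ D.twist (D.slope V W) X := by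
    intro m
    induction m using Nat.strong_induction_on with
    | _ m ih =>
    intro V W hm hVW hAV hWB X hAX hXW
    set μ := D.slope V W with hμ
    have hslope : D.twist μ V = D.twist μ W := twist_slope hVW.lt
    have hupper : ∀ Z, V ≤ Z → Z ≤ W → D.twist μ W ≤ D.twist μ Z := by
      intro Z h1 h2
      rcases h1.eq_or_lt with rfl | h1
      · exact hslope.ge
      rcases h2.eq_or_lt with rfl | h2
      · exact le_rfl
      have := hss V W hVW Z h1 h2
      rw [← hslope]
      by_contra! h3
      exact ((defect_neg_iff hVW.lt).2 h3).not_ge this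
    have hlower : D.twist μ V ≤ D.twist μ (X ⊓ V) := by
      rcases hAV.eq_or_lt with rfl | hAV'
      · rw [inf_eq_right.2 hAX]
      obtain ⟨V', hV'⟩ := hC.exists_consec_pred hVW.left_mem (bot_le.trans_lt hAV').ne'
      have hAV'' : A ≤ V' :=
        (hV'.le_or_le hC (hUC hAB.left_mem)).resolve_right hAV'.not_ge
      have hcard : (C.filter (· < V')).card < m := by
        rw [← hm]
        refine Finset.card_lt_card ⟨?_, fun h => ?_⟩
        · exact Finset.monotone_filter_right _ fun a _ h => h.trans hV'.lt
        · have := h (Finset.mem_filter.2 ⟨hV'.left_mem, hV'.lt⟩)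
          exact (Finset.mem_filter.1 this).2.false
      have h1 := ih _ hcard V' V rfl hV' hAV'' (hVW.lt.le.trans hWB) (X ⊓ V)
        (le_inf hAX hAV) inf_le_right
      have h2 := hconv V' V W hV' hVW (hAB.notMem hAV' (hVW.lt.trans_le hWB))
      have h3 : D.twist (D.slope V' V) V' = D.twist (D.slope V' V) V := twist_slope hV'.lt
      rw [defect_eq_twist μ, hslope] at h2
      have r1 := rk_lt (D := D) hV'.lt
      have r2 := rk_lt (D := D) hVW.lt
      have r3 := rk_le (D := D) (inf_le_right : X ⊓ V ≤ V)
      set ν := D.slope V' V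
      unfold twist at h1 h2 h3 ⊢
      unfold twist at hslope
      have h4 : ν < μ := by
        have h5 : D.ht W - μ * D.rk W < D.ht V' - μ * D.rk V' := by nlinarith
        by_contra! h6
        nlinarith
      nlinarith
    have h1 := twist_submodular (D := D) μ X V
    have h2 := hupper (X ⊔ V) le_sup_right (sup_le hXW hVW.lt.le)
    linarith
  exact fun V W => key _ V W rfl

/-- In a gap of `U`, every slope that starts from a vertex `V` of a convex semistable flag is at
least the slope of the edge that starts from `V`. -/
theorem slope_le_right (hC : IsFlag C) (hUC : U ⊆ C)
    (hconv : D.StrictlyConvex U C) (hss : D.Semistable C) {A B : L} (hAB : Consec U A B) :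
    ∀ V W, Consec C V W → A ≤ V → W ≤ B → ∀ X, V ≤ X → X ≤ B →
      D.twist (D.slope V W) V ≤ D.twist (D.slope V W) X := by
  classical
  have key : ∀ m : ℕ, ∀ V W, (C.filter (W < ·)).card = m → Consec C V W → A ≤ V → W ≤ B →
      ∀ X, V ≤ X → X ≤ B → D.twist (D.slope V W) V ≤ D.twist (D.slope V W) X := by
    intro m
    induction m using Nat.strong_induction_on with
    | _ m ih =>
    intro V W hm hVW hAV hWB X hAX hXW
    set μ := D.slope V W with hμ
    have hslope : D.twist μ V = D.twist μ W := twist_slope hVW.lt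
    have hlower : ∀ Z, V ≤ Z → Z ≤ W → D.twist μ V ≤ D.twist μ Z := by
      intro Z h1 h2
      rcases h1.eq_or_lt with rfl | h1
      · exact le_rfl
      rcases h2.eq_or_lt with rfl | h2
      · exact hslope.le
      have := hss V W hVW Z h1 h2
      by_contra! h3
      exact ((defect_neg_iff hVW.lt).2 h3).not_ge this
    have hupper : D.twist μ W ≤ D.twist μ (X ⊔ W) := by
      rcases hWB.eq_or_lt with rfl | hWB'
      · rw [sup_eq_right.2 hXW]
      obtain ⟨V', hV'⟩ := hC.exists_consec_succ hVW.right_mem (hWB'.trans_le le_top).ne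
      have hAV'' : V' ≤ B :=
        (hV'.le_or_le hC (hUC hAB.right_mem)).resolve_left hWB'.not_ge
      have hcard : (C.filter (V' < ·)).card < m := by
        rw [← hm]
        refine Finset.card_lt_card ⟨?_, fun h => ?_⟩
        · exact Finset.monotone_filter_right _ fun a _ h => hV'.lt.trans h
        · have := h (Finset.mem_filter.2 ⟨hV'.right_mem, hV'.lt⟩)
          exact (Finset.mem_filter.1 this).2.false
      have h1 := ih _ hcard W V' rfl hV' (hAV.trans hVW.lt.le) hAV'' (X ⊔ W)
        le_sup_right (sup_le hXW hWB)
      have h2 := hconv V W V' hVW hV' (hAB.notMem (hAV.trans_lt hVW.lt) hWB')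
      have h3 : D.twist (D.slope W V') W = D.twist (D.slope W V') V' := twist_slope hV'.lt
      rw [defect_eq_twist μ, hslope] at h2
      have r1 := rk_lt (D := D) hV'.lt
      have r2 := rk_lt (D := D) hVW.lt
      have r3 := rk_le (D := D) (le_sup_right : W ≤ X ⊔ W)
      set ν := D.slope W V'
      unfold twist at h1 h2 h3 ⊢
      unfold twist at hslope
      have h4 : μ < ν := by
        have h5 : D.ht W - μ * D.rk W < D.ht V' - μ * D.rk V' := by nlinarith
        by_contra! h6
        nlinarith
      nlinarith
    have h1 := twist_submodular (D := D) μ X W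
    have h2 := hlower (X ⊓ W) (le_inf hAX hVW.lt.le) inf_le_right
    linarith
  exact fun V W => key _ V W rfl

theorem eq_hnFlag (hU : IsFlag U) (hC : IsFlag C) (hUC : U ⊆ C) (hconv : D.StrictlyConvex U C)
    (hss : D.Semistable C) : C = D.hnFlag U := by
  have hsub : C ⊆ D.hnFlag U := by
    intro W hW
    by_cases hWU : W ∈ U
    · exact subset_hnFlag hWU
    obtain ⟨A, B, hAB, hA, hB⟩ :=
      hU.exists_gap hWU fun X hX => hC.total (hUC hX) hW
    obtain ⟨V, hV⟩ := hC.exists_consec_pred hW (bot_le.trans_lt hA).ne'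
    obtain ⟨Z, hZ⟩ := hC.exists_consec_succ hW (hB.trans_le le_top).ne
    have hAV : A ≤ V := (hV.le_or_le hC (hUC hAB.left_mem)).resolve_right hA.not_ge
    have hZB : Z ≤ B := (hZ.le_or_le hC (hUC hAB.right_mem)).resolve_left hB.not_ge
    refine mem_hnFlag.2 (Or.inr ⟨A, B, hAB, hA, hB, fun X Y hAX hXW hWY hYB => ?_⟩)
    have h1 := slope_le_left hC hUC hconv hss hAB V W hV hAV hB.le X hAX hXW.le
    have h2 := slope_le_right hC hUC hconv hss hAB W Z hZ hA.le hZB Y hWY.le hYB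
    have h3 := hconv V W Z hV hZ hWU
    have e1 : D.twist (D.slope V W) V = D.twist (D.slope V W) W := twist_slope hV.lt
    have e2 : D.twist (D.slope W Z) W = D.twist (D.slope W Z) Z := twist_slope hZ.lt
    have r1 := rk_lt (D := D) hV.lt
    have r2 := rk_lt (D := D) hZ.lt
    have r3 := rk_lt (D := D) hXW
    have r4 := rk_lt (D := D) hWY
    set μ := D.slope V W
    set ν := D.slope W Z
    unfold twist at h1 h2 e1 e2
    have h4 : μ < ν := by
      have i1 : D.ht W - D.ht V = μ * (D.rk W - D.rk V) := by linarith
      have i2 : D.ht Z - D.ht W = ν * (D.rk Z - D.rk W) := by linarith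
      unfold defect at h3
      rw [i1, i2] at h3
      by_contra! h6
      nlinarith [mul_pos r1 r2]
    unfold defect
    have h5 : D.ht W - D.ht X ≤ μ * (D.rk W - D.rk X) := by linarith
    have h6 : ν * (D.rk Y - D.rk W) ≤ D.ht Y - D.ht W := by linarith
    nlinarith [mul_pos r3 r4]
  refine Finset.Subset.antisymm hsub fun W hW => ?_
  by_contra hWC
  have hF := isFlag_hnFlag (D := D) hU
  obtain ⟨P, Q, hPQ, hPW, hWQ⟩ := hC.exists_gap hWC fun X hX => hF.total (hsub hX) hW
  obtain ⟨A, B, hAB, hA, hB⟩ := hPQ.exists_coarser hC hU hUC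
  have hbr := (mem_hnFlag.1 hW).resolve_left fun h => hWC (hUC h)
  have := hbr.prop hU hAB (hA.trans_lt hPW) (hWQ.trans_le hB) P Q hA hPW hWQ hB
  exact this.not_ge (hss P Q hPQ W hPW hWQ)

/-- **Harder–Narasimhan**: a flag has exactly one refinement that is semistable and strictly convex
at its new vertices. -/
theorem existsUnique_hnFlag (D : SlopeLattice L) (hU : IsFlag U) :
    ∃! C, IsFlag C ∧ U ⊆ C ∧ D.Semistable C ∧ D.StrictlyConvex U C :=
  ⟨D.hnFlag U, ⟨isFlag_hnFlag hU, subset_hnFlag, semistable_hnFlag hU, strictlyConvex_hnFlag hU⟩,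
    fun _ h => eq_hnFlag hU h.1 h.2.1 h.2.2.2 h.2.2.1⟩

/-! ### The alternating sum over flags below the chords -/

section Below

variable {M : L}

theorem finite_flags_below (D : SlopeLattice L) (hU : IsFlag U) :
    {C | IsFlag C ∧ U ⊆ C ∧ D.Below U C}.Finite := by
  classical
  refine (Finset.finite_toSet (U ∪ (finite_below_chords (D := D) U).toFinset).powerset).subset ?_
  rintro C ⟨hC, hUC, hb⟩
  simp only [Finset.mem_coe, Finset.mem_powerset]
  intro W hW
  by_cases hWU : W ∈ U
  · exact Finset.mem_union_left _ hWU
  obtain ⟨A, B, h, hA, hB⟩ := hU.exists_gap hWU fun X hX => hC.total (hUC hX) hW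
  exact Finset.mem_union_right _ ((Set.Finite.mem_toFinset _).2
    ⟨A, B, h, hA, hB, hb A B h W hW hA hB⟩)

open Classical in
/-- The join with `M` of the largest member of the chain `C` that does not contain `M`. -/
def pivot (M : L) (C : Finset L) : L := (C.filter (¬ M ≤ ·)).sup id ⊔ M

open Classical in
/-- Insert the pivot in the chain, or remove it if it is already there. -/
def toggle (M : L) (C : Finset L) : Finset L :=
  if pivot M C ∈ C then C.erase (pivot M C) else insert (pivot M C) C

theorem le_pivot (M : L) (C : Finset L) : M ≤ pivot M C := le_sup_right

theorem pivot_toggle (M : L) (C : Finset L) : pivot M (toggle M C) = pivot M C := by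
  classical
  have h : (toggle M C).filter (¬ M ≤ ·) = C.filter (¬ M ≤ ·) := by
    unfold toggle
    ext X
    have := le_pivot M C
    split_ifs <;> simp only [Finset.mem_filter, Finset.mem_erase, Finset.mem_insert] <;>
      constructor
    · exact fun h => ⟨h.1.2, h.2⟩
    · exact fun h => ⟨⟨fun h1 => h.2 (h1 ▸ this), h.1⟩, h.2⟩
    · exact fun h => ⟨h.1.resolve_left fun h1 => h.2 (h1 ▸ this), h.2⟩
    · exact fun h => ⟨Or.inr h.1, h.2⟩
  unfold pivot
  rw [h]

theorem toggle_toggle (M : L) (C : Finset L) : toggle M (toggle M C) = C := by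
  classical
  have h := pivot_toggle M C
  by_cases hp : pivot M C ∈ C
  · have h1 : toggle M C = C.erase (pivot M C) := if_pos hp
    have h2 : pivot M (toggle M C) ∉ toggle M C := by rw [h, h1]; simp
    rw [toggle, if_neg h2, h, h1, Finset.insert_erase hp]
  · have h1 : toggle M C = insert (pivot M C) C := if_neg hp
    have h2 : pivot M (toggle M C) ∈ toggle M C := by rw [h, h1]; simp
    rw [toggle, if_pos h2, h, h1, Finset.erase_insert hp]

theorem neg_one_pow_card_toggle (M : L) (C : Finset L) :
    (-1 : ℤ) ^ (toggle M C).card = -(-1) ^ C.card := by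
  classical
  unfold toggle
  split_ifs with h
  · rw [← Finset.card_erase_add_one h, pow_succ]; ring
  · rw [Finset.card_insert_of_notMem h, pow_succ]; ring

theorem exists_pivot (hC : IsFlag C) (hAC : A ∈ C) (hMA : ¬ M ≤ A) :
    ∃ W ∈ C, ¬ M ≤ W ∧ A ≤ W ∧ pivot M C = W ⊔ M ∧ ∀ X ∈ C, ¬ M ≤ X → X ≤ W := by
  classical
  obtain ⟨W, hW⟩ := (C.filter (¬ M ≤ ·)).exists_maximal ⟨A, Finset.mem_filter.2 ⟨hAC, hMA⟩⟩
  have hW1 := Finset.mem_filter.1 hW.1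
  have hmax : ∀ X ∈ C, ¬ M ≤ X → X ≤ W := by
    intro X hX hMX
    rcases hC.total hX hW1.1 with h | h
    · exact h
    · exact hW.2 (Finset.mem_filter.2 ⟨hX, hMX⟩) h
  refine ⟨W, hW1.1, hW1.2, hmax A hAC hMA, ?_, hmax⟩
  have : (C.filter (¬ M ≤ ·)).sup id = W := by
    refine le_antisymm (Finset.sup_le fun X hX => ?_) (Finset.le_sup (f := id) hW.1)
    have := Finset.mem_filter.1 hX
    exact hmax X this.1 this.2
  rw [pivot, this]

/-- Toggling the pivot preserves the flags below the chords of `U` if `M` lies lowest, with respect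
to the chord, in a gap of `U`: by submodularity a join with `M` stays below the chord. -/
theorem toggle_mem (hU : IsFlag U) (hAB : Consec U A B) (hAM : A < M) (hMB : M < B)
    (hM : D.twist (D.slope A B) M < D.twist (D.slope A B) A)
    (hmin : ∀ X, A ≤ X → X ≤ B → D.twist (D.slope A B) M ≤ D.twist (D.slope A B) X)
    (hC : IsFlag C) (hUC : U ⊆ C) (hb : D.Below U C) :
    IsFlag (toggle M C) ∧ U ⊆ toggle M C ∧ D.Below U (toggle M C) := by
  classical
  set μ := D.slope A B
  have hAeB : D.twist μ A = D.twist μ B := twist_slope hAB.lt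
  obtain ⟨W, hWC, hMW, hAW, hp, hmax⟩ := exists_pivot hC (hUC hAB.left_mem) hAM.not_ge
  have hWB : W < B := by
    rcases hC.lt_or_le hWC (hUC hAB.right_mem) with h | h
    · exact h
    · exact absurd (hMB.le.trans h) hMW
  have hW : D.twist μ W ≤ D.twist μ A := by
    rcases hAW.eq_or_lt with rfl | h
    · exact le_rfl
    · exact ((defect_neg_iff hAB.lt).1 (hb A B hAB W hWC h hWB)).le
  have hpe : D.twist μ (pivot M C) < D.twist μ A := by
    rw [hp]
    rcases hAW.eq_or_lt with rfl | h
    · rwa [sup_eq_right.2 hAM.le]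
    have h1 := twist_submodular (D := D) μ W M
    have h2 := hmin (W ⊓ M) (le_inf hAW hAM.le) (inf_le_left.trans hWB.le)
    have h3 := (defect_neg_iff hAB.lt).1 (hb A B hAB W hWC h hWB)
    linarith
  have hAp : A < pivot M C := hAM.trans_le (le_pivot M C)
  have hpB : pivot M C < B := by
    refine lt_of_le_of_ne (hp ▸ sup_le hWB.le hMB.le) fun h => ?_
    rw [h, ← hAeB] at hpe
    exact hpe.false
  have hpU : pivot M C ∉ U := hAB.notMem hAp hpB
  have hcomp : ∀ X ∈ C, pivot M C ≤ X ∨ X ≤ pivot M C := by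
    intro X hX
    by_cases hMX : M ≤ X
    · left
      rw [hp]
      exact sup_le ((hC.total hWC hX).resolve_right fun h => hMW (hMX.trans h)) hMX
    · exact Or.inr ((hmax X hX hMX).trans (hp ▸ le_sup_left))
  have hpb : ∀ A' B', Consec U A' B' → A' < pivot M C → pivot M C < B' →
      D.defect A' (pivot M C) B' < 0 := by
    intro A' B' h h1 h2
    obtain ⟨rfl, rfl⟩ := hAB.unique hU h hAp hpB h1 h2
    exact (defect_neg_iff hAB.lt).2 hpe
  unfold toggle
  split_ifs with h
  · have hsub : U ⊆ C.erase (pivot M C) := fun X hX =>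
      Finset.mem_erase.2 ⟨fun h1 => hpU (h1 ▸ hX), hUC hX⟩
    refine ⟨⟨?_, hsub hU.bot_mem, hsub hU.top_mem⟩, hsub, fun A' B' h1 W hW =>
      hb A' B' h1 W (Finset.mem_of_mem_erase hW)⟩
    exact hC.chain.mono (by simp)
  · refine ⟨⟨?_, by simp [hC.bot_mem], by simp [hC.top_mem]⟩,
      hUC.trans (Finset.subset_insert _ _), fun A' B' h1 W hW h2 h3 => ?_⟩
    · rw [Finset.coe_insert]
      exact hC.chain.insert fun X hX _ => hcomp X hX
    · rcases Finset.mem_insert.1 hW with rfl | hW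
      · exact hpb A' B' h1 h2 h3
      · exact hb A' B' h1 W hW h2 h3

open Classical in
/-- The alternating sum over the refinements of `U` below the chords of `U` tests whether `U` is
semistable. When it is not, toggling the pivot is a sign reversing involution. -/
theorem sum_flags_below (D : SlopeLattice L) (hU : IsFlag U) :
    ∑ C ∈ (finite_flags_below D hU).toFinset, (-1 : ℤ) ^ (C.card + U.card) =
      if D.Semistable U then 1 else 0 := by
  split_ifs with hss
  · refine (Finset.sum_eq_single U ?_ ?_).trans (Even.add_self U.card).neg_one_pow
    · intro C hC hne
      obtain ⟨hC, hUC, hb⟩ := (Set.Finite.mem_toFinset _).1 hC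
      obtain ⟨W, hWC, hWU⟩ := Finset.exists_of_ssubset (hUC.ssubset_of_ne hne.symm)
      obtain ⟨A, B, h, hA, hB⟩ := hU.exists_gap hWU fun X hX => hC.total (hUC hX) hWC
      exact absurd (hss A B h W hA hB) (hb A B h W hWC hA hB).not_ge
    · intro h
      refine absurd ((Set.Finite.mem_toFinset _).2 ?_) h
      exact ⟨hU, subset_rfl, fun A B h W hW hA hB => absurd hW (h.notMem hA hB)⟩
  · unfold Semistable at hss
    push Not at hss
    obtain ⟨A, B, hAB, X, hAX, hXB, hX⟩ := hss
    -- a lowest point with respect to the chord of a gap that is not semistable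
    obtain ⟨M, hAM, hMB, hmin, -⟩ := exists_min_twist (D := D) hAB.lt.le (D.slope A B)
    have hM := (hmin X hAX.le hXB.le).trans_lt ((defect_neg_iff hAB.lt).1 hX)
    have hAM' : A < M := lt_of_le_of_ne hAM fun h => by simp [h] at hM
    have hMB' : M < B := lt_of_le_of_ne hMB fun h => by
      rw [h, twist_slope hAB.lt] at hM
      exact hM.false
    refine Finset.sum_involution (fun C _ => toggle M C) ?_ ?_ ?_ ?_
    · intro C _
      rw [pow_add, pow_add, neg_one_pow_card_toggle]
      ring
    · intro C _ _ h
      have h1 := neg_one_pow_card_toggle M C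
      rw [h] at h1
      have h2 : (-1 : ℤ) ^ C.card ≠ 0 := pow_ne_zero _ (by norm_num)
      omega
    · intro C hC
      obtain ⟨hC, hUC, hb⟩ := (Set.Finite.mem_toFinset _).1 hC
      exact (Set.Finite.mem_toFinset _).2 (toggle_mem hU hAB hAM' hMB' hM hmin hC hUC hb)
    · intro C _
      exact toggle_toggle M C

end Below

end SlopeLattice

/-! ### Local Iwasawa decompositions -/

section Archimedean

variable {𝕜 : Type*} [RCLike 𝕜]

/-- The Iwasawa decomposition over `ℝ` and `ℂ`, by the Gram–Schmidt process applied to the rows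
from the last one to the first one. -/
theorem exists_unitary_triangular {ι : Type*} [Fintype ι] [LinearOrder ι] (A : Matrix ι ι 𝕜) :
    ∃ u ∈ Matrix.unitaryGroup ι 𝕜, (A * star u).BlockTriangular id := by
  classical
  let _ : LocallyFiniteOrderBot ιᵒᵈ :=
    LocallyFiniteOrderBot.ofIic ιᵒᵈ (fun a => {x | x ≤ a}) (by simp)
  let f : ιᵒᵈ → EuclideanSpace 𝕜 ι := fun i => WithLp.toLp 2 (A (OrderDual.ofDual i))
  have hcard : Module.finrank 𝕜 (EuclideanSpace 𝕜 ι) = Fintype.card ιᵒᵈ := by simp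
  let b := InnerProductSpace.gramSchmidtOrthonormalBasis hcard f
  let u : Matrix ι ι 𝕜 := Matrix.of fun i j => b (OrderDual.toDual i) j
  have hu : u * star u = 1 := by
    ext i j
    have h := orthonormal_iff_ite.1 b.orthonormal (OrderDual.toDual j) (OrderDual.toDual i)
    rw [Matrix.mul_apply, Matrix.one_apply]
    simp only [PiLp.inner_apply, RCLike.inner_apply] at h
    simp only [u, star_apply, of_apply, RCLike.star_def, h, OrderDual.toDual_inj]
    simp [eq_comm]
  refine ⟨u, (Matrix.mem_unitaryGroup_iff).2 hu, fun i j hij => ?_⟩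
  have h := InnerProductSpace.gramSchmidtOrthonormalBasis_inv_triangular hcard f
    (i := OrderDual.toDual i) (j := OrderDual.toDual j) (OrderDual.toDual_lt_toDual.2 hij)
  rw [Matrix.mul_apply]
  simpa [PiLp.inner_apply, f, u, b] using h

theorem sum_norm_sq_row_unitary {m : Type*} [Fintype m] [DecidableEq m] {V : Matrix m m 𝕜}
    (hV : V ∈ Matrix.unitaryGroup m 𝕜) (i : m) : ∑ j, ‖V i j‖ ^ 2 = 1 := by
  have h1 := congrFun (congrFun (Matrix.mem_unitaryGroup_iff.1 hV) i) i
  rw [Matrix.mul_apply, Matrix.one_apply_eq] at h1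
  have h2 : ((∑ j, ‖V i j‖ ^ 2 : ℝ) : 𝕜) = 1 := by
    rw [← h1]
    push_cast
    refine Finset.sum_congr rfl fun j _ => ?_
    rw [star_apply, RCLike.star_def, RCLike.mul_conj]
  exact_mod_cast h2

/-- The minors of a unitary matrix have absolute value at most `1`. -/
theorem norm_minor_unitary_le {ι m : Type*} [Fintype ι] [LinearOrder ι] [Fintype m]
    [DecidableEq m] {U : Matrix m m 𝕜} (hU : U ∈ Matrix.unitaryGroup m 𝕜) (f h : ι → m) :
    ‖(U.submatrix f h).det‖ ≤ 1 := by
  by_cases hh : Function.Injective h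
  swap
  · simp only [Function.Injective, not_forall] at hh
    obtain ⟨a, b, hab, hne⟩ := hh
    rw [Matrix.det_zero_of_column_eq hne fun i => by simp [hab]]
    simp
  set B := U.submatrix f h
  obtain ⟨u, hu, ht⟩ := exists_unitary_triangular B
  have hB : B = (B * star u) * u := by
    rw [Matrix.mul_assoc, Matrix.mem_unitaryGroup_iff'.1 hu, Matrix.mul_one]
  have hdetu : ‖u.det‖ = 1 := by
    have h1 := congrArg (fun M => ‖M.det‖) (Matrix.mem_unitaryGroup_iff.1 hu)
    simp only [det_mul, star_eq_conjTranspose, det_conjTranspose, norm_mul, norm_star,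
      det_one, norm_one] at h1
    nlinarith [norm_nonneg u.det]
  rw [hB, det_mul, norm_mul, hdetu, mul_one, Matrix.det_of_isUpperTriangular ht, norm_prod]
  refine Finset.prod_le_one (fun _ _ => norm_nonneg _) fun i _ => ?_
  have h1 : ∑ j, ‖B i j‖ ^ 2 ≤ 1 := by
    rw [← sum_norm_sq_row_unitary hU (f i)]
    have h2 : ∑ j, ‖B i j‖ ^ 2 = ∑ l ∈ Finset.univ.map ⟨h, hh⟩, ‖U (f i) l‖ ^ 2 := by
      simp [B]
    rw [h2]
    exact Finset.sum_le_univ_sum_of_nonneg fun _ => by positivity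
  have h3 := sum_norm_sq_row_unitary hu i
  have h4 : ‖(B * star u) i i‖ ≤ ∑ j, ‖B i j‖ * ‖u i j‖ := by
    rw [Matrix.mul_apply]
    refine (norm_sum_le _ _).trans (Finset.sum_le_sum fun j _ => ?_)
    rw [norm_mul, star_apply, norm_star]
  have h5 : ∑ j, ‖B i j‖ * ‖u i j‖ ≤ ∑ j, (‖B i j‖ ^ 2 + ‖u i j‖ ^ 2) / 2 :=
    Finset.sum_le_sum fun j _ => by nlinarith [sq_nonneg (‖B i j‖ - ‖u i j‖)]
  rw [← Finset.sum_div, Finset.sum_add_distrib, h3] at h5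
  linarith

end Archimedean

section Nonarchimedean

variable {E : Type*} [Field E] (O : ValuationSubring E) {n : ℕ}

/-- A permutation matrix, as an invertible matrix. -/
def permGL (R : Type*) [CommRing R] {n : ℕ} (σ : Equiv.Perm (Fin n)) : GL (Fin n) R :=
  ⟨σ.permMatrix R, σ⁻¹.permMatrix R, by simp [← Matrix.permMatrix_mul],
    by simp [← Matrix.permMatrix_mul]⟩

theorem coe_permGL (R : Type*) [CommRing R] (σ : Equiv.Perm (Fin n)) :
    (permGL R σ : Matrix (Fin n) (Fin n) R) = σ.permMatrix R := rfl

theorem coe_permGL_inv (R : Type*) [CommRing R] (σ : Equiv.Perm (Fin n)) :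
    ((permGL R σ)⁻¹ : GL (Fin n) R) = permGL R σ⁻¹ := Units.ext rfl

theorem permGL_mul_apply {R : Type*} [CommRing R] (σ : Equiv.Perm (Fin n))
    (M : Matrix (Fin n) (Fin n) R) (i j : Fin n) :
    ((permGL R σ : Matrix (Fin n) (Fin n) R) * M) i j = M (σ i) j := by
  rw [coe_permGL, Equiv.Perm.permMatrix, PEquiv.toMatrix_toPEquiv_mul, submatrix_apply, id]

theorem mul_permGL_apply {R : Type*} [CommRing R] (σ : Equiv.Perm (Fin n))
    (M : Matrix (Fin n) (Fin n) R) (i j : Fin n) :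
    (M * (permGL R σ : Matrix (Fin n) (Fin n) R)) i j = M i (σ⁻¹ j) := by
  rw [coe_permGL, Equiv.Perm.permMatrix, PEquiv.mul_toMatrix_toPEquiv, submatrix_apply, id]
  rfl

theorem permGL_apply {R : Type*} [CommRing R] (σ : Equiv.Perm (Fin n)) (i j : Fin n) :
    (permGL R σ : Matrix (Fin n) (Fin n) R) i j = if σ i = j then 1 else 0 := by
  have := permGL_mul_apply σ (1 : Matrix (Fin n) (Fin n) R) i j
  rwa [Matrix.mul_one, Matrix.one_apply] at this

/-- The subgroup of the matrices that are integral and have an integral inverse. -/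
def integralGL (n : ℕ) : Subgroup (GL (Fin n) E) where
  carrier := {k | ∀ i j, k i j ∈ O ∧ k⁻¹ i j ∈ O}
  one_mem' := by
    intro i j
    simp only [inv_one, Units.val_one, Matrix.one_apply]
    split_ifs <;> simp [O.one_mem, O.zero_mem]
  mul_mem' := by
    intro a b ha hb i j
    simp only [_root_.mul_inv_rev, Units.val_mul, Matrix.mul_apply]
    exact ⟨sum_mem fun l _ => mul_mem (ha i l).1 (hb l j).1,
      sum_mem fun l _ => mul_mem (hb i l).2 (ha l j).2⟩
  inv_mem' := by
    intro a ha i j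
    rw [inv_inv]
    exact (ha i j).symm

variable {O}

theorem permGL_mem_integralGL (σ : Equiv.Perm (Fin n)) : permGL E σ ∈ integralGL O n := by
  intro i j
  rw [coe_permGL_inv, permGL_apply, permGL_apply]
  split_ifs <;> simp [O.one_mem, O.zero_mem]

/-- The matrix that subtracts `t b` times column `a` from column `b`, for all `b < a`. -/
def columnOp (a : Fin n) (t : Fin n → E) : Matrix (Fin n) (Fin n) E :=
  Matrix.of fun x y => (if x = y then 1 else 0) - if x = a ∧ y < a then t y else 0

theorem mul_columnOp (a : Fin n) (t : Fin n → E) (M : Matrix (Fin n) (Fin n) E) (i j : Fin n) :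
    (M * columnOp a t) i j = M i j - if j < a then M i a * t j else 0 := by
  rw [Matrix.mul_apply]
  simp only [columnOp, of_apply, mul_sub, mul_ite, mul_one, mul_zero, Finset.sum_sub_distrib,
    Finset.sum_ite_eq', Finset.mem_univ, if_true, ite_and]

theorem columnOp_mul_neg (a : Fin n) (t : Fin n → E) :
    columnOp a t * columnOp a (-t) = 1 := by
  ext i j
  rw [mul_columnOp]
  simp only [columnOp, of_apply, Matrix.one_apply, Pi.neg_apply]
  by_cases hj : j < a <;> by_cases hi : i = a <;> simp [hi, hj]

/-- The column operation as an invertible matrix. -/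
def columnOpGL (a : Fin n) (t : Fin n → E) : GL (Fin n) E :=
  ⟨columnOp a t, columnOp a (-t), columnOp_mul_neg a t, by
    simpa using columnOp_mul_neg a (-t)⟩

theorem columnOpGL_mem (a : Fin n) {t : Fin n → E} (ht : ∀ b, b < a → t b ∈ O) :
    columnOpGL a t ∈ integralGL O n := by
  have key : ∀ s : Fin n → E, (∀ b, b < a → s b ∈ O) → ∀ i j, columnOp a s i j ∈ O := by
    intro s hs i j
    simp only [columnOp, of_apply]
    refine sub_mem ?_ ?_
    · split_ifs <;> simp [O.one_mem, O.zero_mem]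
    · split_ifs with h
      · exact hs j h.2
      · exact O.zero_mem
  exact fun i j => ⟨key t ht i j, key (-t) (fun b hb => neg_mem (ht b hb)) i j⟩

/-- The Iwasawa decomposition over a valued field: the rows are cleared from the last one to the
first one, each by means of its entry of largest absolute value. -/
theorem exists_integral_triangular (O : ValuationSubring E) (A : Matrix (Fin n) (Fin n) E) :
    ∃ k ∈ integralGL O n, (A * (k : Matrix (Fin n) (Fin n) E)).BlockTriangular id := by
  have key : ∀ m : ℕ, ∃ k ∈ integralGL O n, ∀ a b : Fin n, n ≤ a + m → b < a →
      (A * (k : Matrix (Fin n) (Fin n) E)) a b = 0 := by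
    intro m
    induction m with
    | zero =>
      refine ⟨1, one_mem _, fun a b h _ => ?_⟩
      have := a.2
      omega
    | succ m ih =>
      obtain ⟨k, hk, hz⟩ := ih
      by_cases hm : m < n
      swap
      · exact ⟨k, hk, fun a b _ hab => hz a b (by omega) hab⟩
      obtain ⟨a, ha⟩ : ∃ a : Fin n, (a : ℕ) + (m + 1) = n :=
        ⟨⟨n - (m + 1), by omega⟩, by simp; omega⟩
      set M := A * (k : Matrix (Fin n) (Fin n) E)
      obtain ⟨c, hc, hmax⟩ := Finset.exists_max_image (Finset.Iic a)
        (fun b => O.valuation (M a b)) ⟨a, by simp⟩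
      have hca : c ≤ a := Finset.mem_Iic.1 hc
      have ht : ∀ b, ∃ t, b ≤ a → t ∈ O ∧ M a b = M a c * t := by
        intro b
        by_cases hba : b ≤ a
        swap
        · exact ⟨0, fun h => absurd h hba⟩
        have h1 := hmax b (Finset.mem_Iic.2 hba)
        by_cases h0 : M a c = 0
        · refine ⟨0, fun _ => ⟨O.zero_mem, ?_⟩⟩
          rw [h0, map_zero] at h1
          simpa [h0] using h1
        · refine ⟨M a b / M a c, fun _ => ⟨?_, by field_simp⟩⟩
          rw [← O.valuation_le_one_iff, map_div₀]
          exact div_le_one_of_le₀ h1 zero_le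
      choose t ht using ht
      set σ : Equiv.Perm (Fin n) := Equiv.swap c a
      have hσ : ∀ b, b ≤ a → σ b ≤ a := by
        intro b hb
        simp only [σ, Equiv.swap_apply_def]
        split_ifs <;> first | exact le_rfl | assumption
      have hσa : ∀ b, σ b = a ↔ b = c := by
        intro b
        rw [← Equiv.eq_symm_apply]
        simp [σ]
      refine ⟨k * (permGL E σ * columnOpGL a fun b => t (σ b)),
        mul_mem hk (mul_mem (permGL_mem_integralGL σ) (columnOpGL_mem a fun b hb =>
          (ht _ (hσ b hb.le)).1)), fun a' b ha' hb => ?_⟩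
      have hmul : A * ((k * (permGL E σ * columnOpGL a fun b => t (σ b)) : GL (Fin n) E) :
          Matrix (Fin n) (Fin n) E) =
          (M * (permGL E σ : Matrix (Fin n) (Fin n) E)) * columnOp a fun b => t (σ b) := by
        simp only [Units.val_mul, Matrix.mul_assoc, M]
        rfl
      rw [hmul, mul_columnOp]
      simp only [mul_permGL_apply]
      have hinv : σ⁻¹ = σ := Equiv.swap_inv c a
      rw [hinv]
      rcases lt_or_ge a a' with h | h
      · have hz' : ∀ b, b < a' → M a' b = 0 := fun b hb => hz a' b (by
          have : (a : ℕ) < a' := h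
          omega) hb
        have hσ' : ∀ b, b < a' → σ b < a' := by
          intro b hb
          simp only [σ, Equiv.swap_apply_def]
          split_ifs
          · exact h
          · exact hca.trans_lt h
          · exact hb
        rw [hz' _ (hσ' b hb), hz' _ (hσ' a h)]
        simp
      · have : a' = a := by
          refine le_antisymm h (Fin.le_def.2 ?_)
          omega
        subst this
        have h2 : σ a' = c := Equiv.swap_apply_right c a'
        rw [if_pos hb, h2, ← (ht (σ b) (hσ b hb.le)).2, sub_self]
  obtain ⟨k, hk, h⟩ := key n
  exact ⟨k, hk, fun a b hab => h a b (by omega) hab⟩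

theorem minor_mem_of_mem {ι m m' : Type*} [Fintype ι] [DecidableEq ι] {M : Matrix m m' E}
    (hM : ∀ i j, M i j ∈ O) (f : ι → m) (h : ι → m') : (M.submatrix f h).det ∈ O := by
  rw [Matrix.det_apply]
  exact sum_mem fun σ _ => zsmul_mem (prod_mem fun i _ => hM _ _) _

end Nonarchimedean

/-! ### The adelic absolute value -/

section Adelic

variable {F : Type*} [Field F] [NumberField F] {n : ℕ}

/-- The component of an adele at an infinite place. -/
def infEval (v : InfinitePlace F) : AdeleRing (𝓞 F) F →+* v.Completion where
  toFun x := x.1 v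
  map_one' := rfl
  map_mul' _ _ := rfl
  map_zero' := rfl
  map_add' _ _ := rfl

/-- The component of an adele at a finite place. -/
def finEval (v : HeightOneSpectrum (𝓞 F)) : AdeleRing (𝓞 F) F →+* v.adicCompletion F where
  toFun x := x.2 v
  map_one' := rfl
  map_mul' _ _ := rfl
  map_zero' := rfl
  map_add' _ _ := rfl

theorem adele_ext {x y : AdeleRing (𝓞 F) F} (h1 : ∀ v, infEval v x = infEval v y)
    (h2 : ∀ v, finEval v x = finEval v y) : x = y :=
  Prod.ext (funext h1) (FiniteAdeleRing.ext F h2)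

theorem finite_norm_le_one_iff (v : HeightOneSpectrum (𝓞 F)) (x : v.adicCompletion F) :
    ‖x‖ ≤ 1 ↔ x ∈ v.adicCompletionIntegers F := by
  rw [HeightOneSpectrum.mem_adicCompletionIntegers, FinitePlace.norm_def]
  exact_mod_cast WithZeroMulInt.toNNReal_le_one_iff (HeightOneSpectrum.one_lt_absNorm_nnreal v)

theorem adelicAbs_eq (x : AdeleRing (𝓞 F) F) :
    adelicAbs x = (∏ v : InfinitePlace F, ‖infEval v x‖ ^ v.mult) *
      ∏ᶠ v : HeightOneSpectrum (𝓞 F), ‖finEval v x‖ := rfl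

theorem eventually_norm_le_one (x : AdeleRing (𝓞 F) F) :
    ∀ᶠ v : HeightOneSpectrum (𝓞 F) in Filter.cofinite, ‖finEval v x‖ ≤ 1 := by
  filter_upwards [x.2.2] with v hv
  exact (finite_norm_le_one_iff v _).2 hv

theorem norm_mul_norm_of_isUnit {x y : AdeleRing (𝓞 F) F} (h : x * y = 1)
    (v : HeightOneSpectrum (𝓞 F)) : ‖finEval v x‖ * ‖finEval v y‖ = 1 := by
  rw [← norm_mul, ← map_mul, h, map_one, norm_one]

theorem hasFiniteMulSupport_norm {x : AdeleRing (𝓞 F) F} (hx : IsUnit x) :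
    (fun v : HeightOneSpectrum (𝓞 F) => ‖finEval v x‖).HasFiniteMulSupport := by
  obtain ⟨y, hy⟩ := hx.exists_right_inv
  have : ∀ᶠ v : HeightOneSpectrum (𝓞 F) in Filter.cofinite, ‖finEval v x‖ = 1 := by
    filter_upwards [eventually_norm_le_one x, eventually_norm_le_one y] with v h1 h2
    have h3 := norm_mul_norm_of_isUnit hy v
    nlinarith [norm_nonneg (finEval v x), norm_nonneg (finEval v y)]
  exact this

theorem adelicAbs_nonneg (x : AdeleRing (𝓞 F) F) : 0 ≤ adelicAbs x :=
  mul_nonneg (Finset.prod_nonneg fun _ _ => by positivity)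
    (finprod_nonneg fun _ => norm_nonneg _)

theorem adelicAbs_one : adelicAbs (1 : AdeleRing (𝓞 F) F) = 1 := by
  simp [adelicAbs_eq]

theorem adelicAbs_mul {x y : AdeleRing (𝓞 F) F} (hx : IsUnit x) (hy : IsUnit y) :
    adelicAbs (x * y) = adelicAbs x * adelicAbs y := by
  simp only [adelicAbs_eq, map_mul, norm_mul, mul_pow, Finset.prod_mul_distrib]
  rw [finprod_mul_distrib (hasFiniteMulSupport_norm hx) (hasFiniteMulSupport_norm hy)]
  ring

theorem adelicAbs_pos {x : AdeleRing (𝓞 F) F} (hx : IsUnit x) : 0 < adelicAbs x := by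
  obtain ⟨y, hy⟩ := hx.exists_right_inv
  refine (adelicAbs_nonneg x).lt_of_ne' fun h => ?_
  have h1 := adelicAbs_mul hx (IsUnit.of_mul_eq_one_right x hy)
  rw [hy, adelicAbs_one, h, zero_mul] at h1
  exact one_ne_zero h1

theorem adelicAbs_prod {ι : Type*} (s : Finset ι) {f : ι → AdeleRing (𝓞 F) F}
    (hf : ∀ i ∈ s, IsUnit (f i)) : adelicAbs (∏ i ∈ s, f i) = ∏ i ∈ s, adelicAbs (f i) := by
  classical
  induction s using Finset.induction_on with
  | empty => simp [adelicAbs_one]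
  | insert a s ha ih =>
    have h1 : ∀ i ∈ s, IsUnit (f i) := fun i hi => hf i (Finset.mem_insert_of_mem hi)
    rw [Finset.prod_insert ha, Finset.prod_insert ha, ← ih h1]
    exact adelicAbs_mul (hf a (Finset.mem_insert_self _ _)) (IsUnit.prod_iff.2 h1)

theorem log_adelicAbs_prod {ι : Type*} (s : Finset ι) {f : ι → AdeleRing (𝓞 F) F}
    (hf : ∀ i ∈ s, IsUnit (f i)) :
    Real.log (adelicAbs (∏ i ∈ s, f i)) = ∑ i ∈ s, Real.log (adelicAbs (f i)) := by
  rw [adelicAbs_prod s hf, Real.log_prod]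
  exact fun i hi => (adelicAbs_pos (hf i hi)).ne'

theorem adelicAbs_le_one {x : AdeleRing (𝓞 F) F} (hx : IsUnit x)
    (h1 : ∀ v, ‖infEval v x‖ ≤ 1) (h2 : ∀ v, ‖finEval v x‖ ≤ 1) : adelicAbs x ≤ 1 := by
  rw [adelicAbs_eq]
  refine mul_le_one₀ (Finset.prod_le_one (fun _ _ => by positivity) fun v _ =>
    pow_le_one₀ (norm_nonneg _) (h1 v)) (finprod_nonneg fun _ => norm_nonneg _) ?_
  have := finprod_le_finprod (hasFiniteMulSupport_norm hx) (fun _ => norm_nonneg _)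
    (g := fun _ => 1) (by simp [Function.HasFiniteMulSupport, Function.mulSupport]) h2
  simpa using this

theorem norm_infEval_algebraMap (v : InfinitePlace F) (x : F) :
    ‖infEval v (algebraMap F (AdeleRing (𝓞 F) F) x)‖ = v x :=
  InfinitePlace.Completion.norm_coe v _

theorem norm_finEval_algebraMap (v : HeightOneSpectrum (𝓞 F)) (x : F) :
    ‖finEval v (algebraMap F (AdeleRing (𝓞 F) F) x)‖ =
      FinitePlace.equivHeightOneSpectrum.symm v x := by
  rw [FinitePlace.equivHeightOneSpectrum_symm_apply]
  rfl

/-- The product formula. -/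
theorem adelicAbs_algebraMap {x : F} (hx : x ≠ 0) :
    adelicAbs (algebraMap F (AdeleRing (𝓞 F) F) x) = 1 := by
  rw [adelicAbs_eq, ← NumberField.prod_abs_eq_one hx,
    ← finprod_comp_equiv FinitePlace.equivHeightOneSpectrum.symm]
  simp only [norm_infEval_algebraMap, norm_finEval_algebraMap]

/-! ### The maximal compact subgroup and the Iwasawa decomposition -/

/-- The image of a matrix under the completion of a complex embedding. -/
def complexEval (v : InfinitePlace F) : AdeleRing (𝓞 F) F →+* ℂ :=
  (InfinitePlace.Completion.extensionEmbedding v).comp (infEval v)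

theorem norm_complexEval (v : InfinitePlace F) (x : AdeleRing (𝓞 F) F) :
    ‖complexEval v x‖ = ‖infEval v x‖ :=
  (AddMonoidHomClass.isometry_iff_norm _).1
    (InfinitePlace.Completion.isometry_extensionEmbedding v) _

theorem mem_maxCompact {k : GL (Fin n) (AdeleRing (𝓞 F) F)} :
    k ∈ maxCompact F n ↔
      (∀ v, (k : Matrix (Fin n) (Fin n) (AdeleRing (𝓞 F) F)).map (complexEval v) ∈
        Matrix.unitaryGroup (Fin n) ℂ) ∧
      ∀ v : HeightOneSpectrum (𝓞 F), Matrix.GeneralLinearGroup.map (finEval v) k ∈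
        integralGL (v.adicCompletionIntegers F) n := Iff.rfl

variable (F n) in
/-- The maximal compact subgroup, as a subgroup. -/
def maxCompactSubgroup : Subgroup (GL (Fin n) (AdeleRing (𝓞 F) F)) where
  carrier := maxCompact F n
  one_mem' := by
    refine mem_maxCompact.2 ⟨fun v => ?_, fun v => ?_⟩
    · simp [one_mem]
    · rw [map_one]; exact one_mem _
  mul_mem' := by
    intro a b ha hb
    rw [mem_maxCompact] at *
    refine ⟨fun v => ?_, fun v => ?_⟩
    · rw [Units.val_mul, Matrix.map_mul]; exact mul_mem (ha.1 v) (hb.1 v)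
    · rw [map_mul]; exact mul_mem (ha.2 v) (hb.2 v)
  inv_mem' := by
    intro a ha
    rw [mem_maxCompact] at *
    refine ⟨fun v => ?_, fun v => ?_⟩
    · have h1 := ha.1 v
      have h2 : (a : Matrix (Fin n) (Fin n) (AdeleRing (𝓞 F) F)).map (complexEval v) *
          ((a⁻¹ : GL (Fin n) (AdeleRing (𝓞 F) F)) :
            Matrix (Fin n) (Fin n) (AdeleRing (𝓞 F) F)).map (complexEval v) = 1 := by
        rw [← Matrix.map_mul, ← Units.val_mul, mul_inv_cancel]
        simp
      have h3 : ((a⁻¹ : GL (Fin n) (AdeleRing (𝓞 F) F)) :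
            Matrix (Fin n) (Fin n) (AdeleRing (𝓞 F) F)).map (complexEval v) =
          star ((a : Matrix (Fin n) (Fin n) (AdeleRing (𝓞 F) F)).map (complexEval v)) := by
        rw [← Matrix.one_mul (Matrix.map _ _), ← (Matrix.mem_unitaryGroup_iff').1 h1,
          Matrix.mul_assoc, h2, Matrix.mul_one]
      rw [h3]
      exact Unitary.star_mem h1
    · rw [map_inv]; exact inv_mem (ha.2 v)

theorem mem_maxCompactSubgroup {k : GL (Fin n) (AdeleRing (𝓞 F) F)} :
    k ∈ maxCompactSubgroup F n ↔ k ∈ maxCompact F n := Iff.rfl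

/-- The minors of the elements of the maximal compact subgroup are small at every place. -/
theorem norm_minor_le_one {ι : Type*} [Fintype ι] [LinearOrder ι]
    {k : GL (Fin n) (AdeleRing (𝓞 F) F)} (hk : k ∈ maxCompactSubgroup F n) (f h : ι → Fin n) :
    (∀ v, ‖infEval v (k.1.submatrix f h).det‖ ≤ 1) ∧
      ∀ v, ‖finEval v (k.1.submatrix f h).det‖ ≤ 1 := by
  rw [mem_maxCompactSubgroup, mem_maxCompact] at hk
  constructor
  · intro v
    rw [← norm_complexEval, RingHom.map_det]
    exact norm_minor_unitary_le (hk.1 v) f h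
  · intro v
    rw [finite_norm_le_one_iff, RingHom.map_det]
    exact minor_mem_of_mem (O := v.adicCompletionIntegers F) (fun i j => (hk.2 v i j).1) f h

theorem adelicAbs_minor_le_one {ι : Type*} [Fintype ι] [LinearOrder ι]
    {k : GL (Fin n) (AdeleRing (𝓞 F) F)} (hk : k ∈ maxCompactSubgroup F n) (f h : ι → Fin n)
    (hu : IsUnit ((k : Matrix (Fin n) (Fin n) (AdeleRing (𝓞 F) F)).submatrix f h).det) :
    adelicAbs ((k : Matrix (Fin n) (Fin n) (AdeleRing (𝓞 F) F)).submatrix f h).det ≤ 1 :=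
  adelicAbs_le_one hu (norm_minor_le_one hk f h).1 (norm_minor_le_one hk f h).2

theorem exists_triangular_of_ringEquiv {E 𝕜 : Type*} [Field E] [RCLike 𝕜] (e : E ≃+* 𝕜)
    (φ : E →+* ℂ) (j : 𝕜 →+* ℂ) (hj : ∀ x, j (star x) = star (j x)) (hφ : ∀ x, j (e x) = φ x)
    (A : Matrix (Fin n) (Fin n) E) :
    ∃ k : GL (Fin n) E, (k : Matrix (Fin n) (Fin n) E).map φ ∈ Matrix.unitaryGroup (Fin n) ℂ ∧
      (A * (k : Matrix (Fin n) (Fin n) E)).BlockTriangular id := by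
  obtain ⟨u, hu, ht⟩ := exists_unitary_triangular (A.map e)
  have h1 : star u * u = 1 := Matrix.mem_unitaryGroup_iff'.1 hu
  have h2 : u * star u = 1 := Matrix.mem_unitaryGroup_iff.1 hu
  let f : 𝕜 →+* E := e.symm
  have hone : (1 : Matrix (Fin n) (Fin n) 𝕜).map f = 1 := by simp
  refine ⟨⟨(star u).map f, u.map f, by rw [← Matrix.map_mul, h1, hone],
    by rw [← Matrix.map_mul, h2, hone]⟩, ?_, ?_⟩
  · have h3 : ((star u).map f).map φ = star (u.map j) := by
      ext a b
      simp only [map_apply, star_apply, ← hj, ← hφ, f]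
      simp
    change ((star u).map f).map φ ∈ _
    have h4 : star (u.map j) = (star u).map j := by
      ext a b
      exact (hj (u b a)).symm
    rw [h3, Matrix.mem_unitaryGroup_iff, star_star, h4, ← Matrix.map_mul, h1]
    simp
  · intro a b hab
    have h3 := ht hab
    change (A * (star u).map f) a b = 0
    apply e.injective
    rw [map_zero, ← h3]
    simp only [Matrix.mul_apply, map_sum, map_mul, map_apply, f]
    simp

omit [NumberField F] in
theorem exists_infinite_triangular (v : InfinitePlace F) (A : Matrix (Fin n) (Fin n) v.Completion) :
    ∃ k : GL (Fin n) v.Completion,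
      (k : Matrix (Fin n) (Fin n) v.Completion).map
        (InfinitePlace.Completion.extensionEmbedding v) ∈ Matrix.unitaryGroup (Fin n) ℂ ∧
      (A * (k : Matrix (Fin n) (Fin n) v.Completion)).BlockTriangular id := by
  rcases v.isReal_or_isComplex with hv | hv
  · exact exists_triangular_of_ringEquiv (InfinitePlace.Completion.ringEquivRealOfIsReal hv)
      _ Complex.ofRealHom (fun x => by simp)
      (fun x => InfinitePlace.Completion.extensionEmbeddingOfIsReal_apply hv x) A
  · exact exists_triangular_of_ringEquiv (InfinitePlace.Completion.ringEquivComplexOfIsComplex hv)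
      _ (RingHom.id ℂ) (fun x => rfl) (fun x => rfl) A

/-- A matrix of adeles with prescribed components, integral at all finite places. -/
def adeleMatrix (A : ∀ v : InfinitePlace F, Matrix (Fin n) (Fin n) v.Completion)
    (B : ∀ v : HeightOneSpectrum (𝓞 F), Matrix (Fin n) (Fin n) (v.adicCompletion F))
    (hB : ∀ v i j, B v i j ∈ v.adicCompletionIntegers F) :
    Matrix (Fin n) (Fin n) (AdeleRing (𝓞 F) F) :=
  Matrix.of fun i j =>
    (fun v => A v i j, ⟨fun v => B v i j, Filter.Eventually.of_forall fun v => hB v i j⟩)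

/-- The Iwasawa decomposition over the adeles. -/
theorem exists_iwasawa (g : GL (Fin n) (AdeleRing (𝓞 F) F)) :
    ∃ p : GL (Fin n) (AdeleRing (𝓞 F) F), ∃ k ∈ maxCompactSubgroup F n, g = p * k ∧
      (p : Matrix (Fin n) (Fin n) (AdeleRing (𝓞 F) F)).BlockTriangular id := by
  choose A hA hA' using fun v : InfinitePlace F => exists_infinite_triangular v
    ((g : Matrix (Fin n) (Fin n) (AdeleRing (𝓞 F) F)).map (infEval v))
  choose B hB hB' using fun v : HeightOneSpectrum (𝓞 F) =>
    exists_integral_triangular (v.adicCompletionIntegers F)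
      ((g : Matrix (Fin n) (Fin n) (AdeleRing (𝓞 F) F)).map (finEval v))
  let M := adeleMatrix (fun v => (A v : Matrix (Fin n) (Fin n) v.Completion))
    (fun v => (B v : Matrix (Fin n) (Fin n) (v.adicCompletion F))) fun v i j => (hB v i j).1
  let N := adeleMatrix (fun v => ((A v)⁻¹ : GL (Fin n) v.Completion).1)
    (fun v => ((B v)⁻¹ : GL (Fin n) (v.adicCompletion F)).1) fun v i j => (hB v i j).2
  have hM1 : ∀ v, M.map (infEval v) = A v := fun v => rfl
  have hN1 : ∀ v, N.map (infEval v) = ((A v)⁻¹ : GL (Fin n) v.Completion).1 := fun v => rfl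
  have hM2 : ∀ v, M.map (finEval v) = B v := fun v => rfl
  have hN2 : ∀ v, N.map (finEval v) = ((B v)⁻¹ : GL (Fin n) (v.adicCompletion F)).1 :=
    fun v => rfl
  have ext' : ∀ X Y : Matrix (Fin n) (Fin n) (AdeleRing (𝓞 F) F),
      (∀ v, X.map (infEval v) = Y.map (infEval v)) → (∀ v, X.map (finEval v) = Y.map (finEval v)) →
      X = Y := by
    intro X Y h1 h2
    ext1 i j
    exact adele_ext (fun v => congrFun (congrFun (h1 v) i) j)
      fun v => congrFun (congrFun (h2 v) i) j
  have hMN : M * N = 1 := by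
    refine ext' _ _ (fun v => ?_) fun v => ?_
    · rw [Matrix.map_mul, hM1, hN1, Units.mul_inv]; simp
    · rw [Matrix.map_mul, hM2, hN2, Units.mul_inv]; simp
  have hNM : N * M = 1 := by
    refine ext' _ _ (fun v => ?_) fun v => ?_
    · rw [Matrix.map_mul, hM1, hN1, Units.inv_mul]; simp
    · rw [Matrix.map_mul, hM2, hN2, Units.inv_mul]; simp
  let k : GL (Fin n) (AdeleRing (𝓞 F) F) := ⟨M, N, hMN, hNM⟩
  have hk : k ∈ maxCompactSubgroup F n := ⟨fun v => hA v, fun v => hB v⟩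
  refine ⟨g * k, k⁻¹, inv_mem hk, by simp, fun i j hij => adele_ext (fun v => ?_) fun v => ?_⟩
  · rw [map_zero, ← hA' v hij, ← hM1, ← Matrix.map_mul]
    rfl
  · rw [map_zero, ← hB' v hij, ← hM2, ← Matrix.map_mul]
    rfl

end Adelic

/-! ### Compositions and their boundaries -/

section Comp

variable {n : ℕ} (P : Composition n)

theorem mem_boundaries_iff {i : Fin (n + 1)} :
    i ∈ P.boundaries ↔ ∃ j ≤ P.length, P.sizeUpTo j = i := by
  simp only [Composition.boundaries, Finset.mem_map, Finset.mem_univ, true_and]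
  constructor
  · rintro ⟨j, rfl⟩
    exact ⟨j, Nat.lt_succ_iff.1 j.2, rfl⟩
  · rintro ⟨j, hj, h⟩
    exact ⟨⟨j, Nat.lt_succ_iff.2 hj⟩, Fin.ext h⟩

/-- Two indices lie in different blocks if and only if there is a boundary between them. -/
theorem index_lt_iff {a b : Fin n} :
    P.index a < P.index b ↔ ∃ i ∈ P.boundaries, (a : ℕ) < (i : ℕ) ∧ (i : ℕ) ≤ b := by
  have ha := P.sizeUpTo_index_le a
  have ha' := P.lt_sizeUpTo_index_succ a
  have hb := P.sizeUpTo_index_le b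
  have hb' := P.lt_sizeUpTo_index_succ b
  simp only [Fin.val_succ] at ha' hb'
  constructor
  · intro h
    refine ⟨⟨P.sizeUpTo (P.index b), Nat.lt_succ_iff.2 (P.sizeUpTo_le _)⟩,
      (mem_boundaries_iff P).2 ⟨P.index b, (P.index b).2.le, rfl⟩, ?_, hb⟩
    exact ha'.trans_le (P.monotone_sizeUpTo (Nat.succ_le_of_lt h))
  · rintro ⟨i, hi, h1, h2⟩
    obtain ⟨j, -, hj⟩ := (mem_boundaries_iff P).1 hi
    rw [← hj] at h1 h2
    have h3 : (P.index a : ℕ) < j := by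
      by_contra! h
      exact (h1.trans_le (P.monotone_sizeUpTo h)).not_ge ha
    have h4 : j ≤ (P.index b : ℕ) := by
      by_contra! h
      exact (hb'.trans_le (P.monotone_sizeUpTo h)).not_ge h2
    exact Fin.lt_def.2 (h3.trans_le h4)

theorem index_mono : Monotone P.index := by
  intro a b hab
  by_contra! h
  obtain ⟨i, -, h1, h2⟩ := (index_lt_iff P).1 h
  exact (h1.trans_le h2).not_ge (Fin.le_def.1 hab)

theorem zero_mem_boundaries : (0 : Fin (n + 1)) ∈ P.boundaries :=
  (P.toCompositionAsSet).zero_mem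

theorem last_mem_boundaries : Fin.last n ∈ P.boundaries :=
  (P.toCompositionAsSet).getLast_mem

theorem boundaries_injective : Function.Injective (Composition.boundaries (n := n)) := by
  intro P Q h
  apply (compositionEquiv n).injective
  exact CompositionAsSet.ext h

theorem exists_boundaries_eq (S : Finset (Fin (n + 1))) (h0 : 0 ∈ S) (hn : Fin.last n ∈ S) :
    ∃ P : Composition n, P.boundaries = S :=
  ⟨CompositionAsSet.toComposition ⟨S, h0, hn⟩, CompositionAsSet.toComposition_boundaries _⟩

end Comp

/-! ### The height of the last rows of an adelic matrix -/

/-- The indices of the rows from the `i`-th one on. -/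
abbrev Low (n i : ℕ) : Type := {l : Fin n // i ≤ (l : ℕ)}

theorem card_low {n i : ℕ} (hi : i ≤ n) : Fintype.card (Low n i) = n - i := by
  have h1 : Fintype.card (Low n i) = (Finset.univ.filter fun l : Fin n => i ≤ (l : ℕ)).card :=
    Fintype.card_subtype _
  rcases hi.eq_or_lt with rfl | h
  · rw [h1, Nat.sub_self, Finset.card_eq_zero]
    ext l
    simp
  · have : (Finset.univ.filter fun l : Fin n => i ≤ (l : ℕ)) = Finset.Ici ⟨i, h⟩ := by
      ext l
      simp [Fin.le_def]
    rw [h1, this, Fin.card_Ici]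

section LowBlock

variable {R : Type*} [CommRing R] {n : ℕ}

/-- The lower right block of a matrix, with the rows and columns from the `i`-th one on. -/
def lowBlock (i : ℕ) (M : Matrix (Fin n) (Fin n) R) : Matrix (Low n i) (Low n i) R :=
  M.submatrix Subtype.val Subtype.val

/-- The maximal standard parabolic subgroup that stabilizes the row vectors supported on the
coordinates from the `i`-th one on. -/
def lowParabolic (R : Type*) [CommRing R] (n i : ℕ) : Subgroup (GL (Fin n) R) where
  carrier := {g | (g : Matrix (Fin n) (Fin n) R).BlockTriangular fun l => decide (i ≤ (l : ℕ))}
  one_mem' := by simpa using blockTriangular_one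
  mul_mem' := by
    intro a b ha hb
    simpa using BlockTriangular.mul ha hb
  inv_mem' := by
    intro a ha
    have : Invertible (a : Matrix (Fin n) (Fin n) R) := a.invertible
    have h := blockTriangular_inv_of_blockTriangular
      (M := (a : Matrix (Fin n) (Fin n) R)) (b := fun l => decide (i ≤ (l : ℕ))) ha
    simpa using h

variable {i : ℕ}

theorem mem_lowParabolic {g : GL (Fin n) R} :
    g ∈ lowParabolic R n i ↔ ∀ a b : Fin n, i ≤ (a : ℕ) → (b : ℕ) < i → g a b = 0 := by
  constructor
  · intro h a b ha hb
    refine h ?_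
    have : ¬ i ≤ (b : ℕ) := by omega
    simp [ha, this]
  · intro h a b hab
    have : i ≤ (a : ℕ) ∧ (b : ℕ) < i := by
      simp only [Bool.lt_iff, decide_eq_false_iff_not, not_le, decide_eq_true_eq] at hab
      exact hab.symm
    exact h a b this.1 this.2

theorem mem_lowParabolic_of_triangular {g : GL (Fin n) R}
    (hg : (g : Matrix (Fin n) (Fin n) R).BlockTriangular id) : g ∈ lowParabolic R n i :=
  mem_lowParabolic.2 fun _ _ ha hb => hg (Fin.lt_def.2 (hb.trans_le ha))

/-- The last rows of a product, when the first factor preserves the last coordinates. -/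
theorem lowRows_mul {ι : Type*} {p : GL (Fin n) R} (hp : p ∈ lowParabolic R n i)
    (M : Matrix (Fin n) (Fin n) R) (f : ι → Fin n) :
    ((p : Matrix (Fin n) (Fin n) R) * M).submatrix (Subtype.val : Low n i → Fin n) f =
      lowBlock i (p : Matrix (Fin n) (Fin n) R) * M.submatrix Subtype.val f := by
  ext a b
  rw [submatrix_apply, Matrix.mul_apply]
  refine Eq.trans ?_ (Finset.sum_subtype (Finset.univ.filter fun l : Fin n => i ≤ (l : ℕ))
    (p := fun l : Fin n => i ≤ (l : ℕ)) (by simp) (fun l : Fin n => p.val a.1 l * M l (f b)))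
  symm
  refine Finset.sum_subset (Finset.subset_univ _) fun l _ hl => ?_
  have hl : (l : ℕ) < i := by simpa using hl
  rw [mem_lowParabolic.1 hp a l a.2 hl, zero_mul]

theorem det_lowBlock_mul {p : GL (Fin n) R} (hp : p ∈ lowParabolic R n i) (q : GL (Fin n) R) :
    (lowBlock i ((p * q : GL (Fin n) R) : Matrix (Fin n) (Fin n) R)).det =
      (lowBlock i (p : Matrix (Fin n) (Fin n) R)).det *
        (lowBlock i (q : Matrix (Fin n) (Fin n) R)).det := by
  rw [← det_mul, Units.val_mul, lowBlock, lowRows_mul hp]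
  rfl

theorem isUnit_det_lowBlock {p : GL (Fin n) R} (hp : p ∈ lowParabolic R n i) :
    IsUnit (lowBlock i (p : Matrix (Fin n) (Fin n) R)).det := by
  refine IsUnit.of_mul_eq_one (lowBlock i ((p⁻¹ : GL (Fin n) R) : Matrix (Fin n) (Fin n) R)).det ?_
  rw [← det_lowBlock_mul hp, mul_inv_cancel, Units.val_one, lowBlock,
    submatrix_one _ Subtype.val_injective, det_one]

theorem lowBlock_triangular {M : Matrix (Fin n) (Fin n) R} (hM : M.BlockTriangular id) :
    (lowBlock i M).det = ∏ l : Low n i, M l l := by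
  rw [Matrix.det_of_isUpperTriangular (M := lowBlock i M)]
  · rfl
  · intro a b hab
    exact hM hab

end LowBlock

section Height

variable {F : Type*} [Field F] [NumberField F] {n : ℕ} {i : ℕ}

theorem adelicAbs_lowBlock_le {p q k k' : GL (Fin n) (AdeleRing (𝓞 F) F)}
    (hp : p ∈ lowParabolic _ n i) (hq : q ∈ lowParabolic _ n i) (hk : k ∈ maxCompactSubgroup F n)
    (hk' : k' ∈ maxCompactSubgroup F n) (h : p * k = q * k') :
    adelicAbs (lowBlock i (p : Matrix (Fin n) (Fin n) (AdeleRing (𝓞 F) F))).det ≤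
      adelicAbs (lowBlock i (q : Matrix (Fin n) (Fin n) (AdeleRing (𝓞 F) F))).det := by
  set m := k' * k⁻¹
  have hpm : p = q * m := by rw [← mul_assoc, ← h, mul_inv_cancel_right]
  have hm : m ∈ lowParabolic _ n i := by
    have : m = q⁻¹ * p := by rw [hpm, inv_mul_cancel_left]
    rw [this]
    exact mul_mem (inv_mem hq) hp
  have hmK : m ∈ maxCompactSubgroup F n := mul_mem hk' (inv_mem hk)
  rw [hpm, det_lowBlock_mul hq, adelicAbs_mul (isUnit_det_lowBlock hq) (isUnit_det_lowBlock hm)]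
  exact mul_le_of_le_one_right (adelicAbs_nonneg _)
    (adelicAbs_minor_le_one hmK _ _ (isUnit_det_lowBlock hm))

theorem exists_low_iwasawa (i : ℕ) (g : GL (Fin n) (AdeleRing (𝓞 F) F)) :
    ∃ p ∈ lowParabolic (AdeleRing (𝓞 F) F) n i, ∃ k ∈ maxCompactSubgroup F n, g = p * k := by
  obtain ⟨p, k, hk, h, hp⟩ := exists_iwasawa g
  exact ⟨p, mem_lowParabolic_of_triangular hp, k, hk, h⟩

/-- The logarithmic height of the rows of `g` from the `i`-th one on: the logarithm of the absolute
value of the determinant of the corresponding block of `p`, where `g = p k` with `p` in a maximal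
parabolic subgroup and `k` in the maximal compact subgroup. -/
def rowHeight (i : ℕ) (g : GL (Fin n) (AdeleRing (𝓞 F) F)) : ℝ :=
  Real.log (adelicAbs (lowBlock i ((exists_low_iwasawa i g).choose :
    Matrix (Fin n) (Fin n) (AdeleRing (𝓞 F) F))).det)

theorem rowHeight_eq {p k : GL (Fin n) (AdeleRing (𝓞 F) F)} (hp : p ∈ lowParabolic _ n i)
    (hk : k ∈ maxCompactSubgroup F n) : rowHeight i (p * k) =
      Real.log (adelicAbs (lowBlock i (p : Matrix (Fin n) (Fin n) (AdeleRing (𝓞 F) F))).det) := by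
  obtain ⟨hp', k', hk', h⟩ := (exists_low_iwasawa i (p * k)).choose_spec
  rw [rowHeight]
  congr 1
  exact le_antisymm (adelicAbs_lowBlock_le hp' hp hk' hk h.symm)
    (adelicAbs_lowBlock_le hp hp' hk hk' h)

theorem diag_mem_lowParabolic {q : GL (Fin n) F} (hq : q ∈ lowParabolic F n i) :
    diag q ∈ lowParabolic (AdeleRing (𝓞 F) F) n i := by
  rw [mem_lowParabolic] at *
  intro a b ha hb
  rw [diag, Matrix.GeneralLinearGroup.map_apply, hq a b ha hb, map_zero]

/-- By the product formula, the height of the last rows does not change when they are multiplied by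
an invertible matrix over `F`. -/
theorem rowHeight_diag_mul {q : GL (Fin n) F} (hq : q ∈ lowParabolic F n i)
    (g : GL (Fin n) (AdeleRing (𝓞 F) F)) : rowHeight i (diag q * g) = rowHeight i g := by
  obtain ⟨p, hp, k, hk, rfl⟩ := exists_low_iwasawa i g
  have hq' := diag_mem_lowParabolic hq
  have hdet : (lowBlock i (diag q : Matrix (Fin n) (Fin n) (AdeleRing (𝓞 F) F))).det =
      algebraMap F (AdeleRing (𝓞 F) F) (lowBlock i (q : Matrix (Fin n) (Fin n) F)).det := by
    rw [RingHom.map_det]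
    rfl
  rw [← mul_assoc, rowHeight_eq (mul_mem hq' hp) hk, rowHeight_eq hp hk, det_lowBlock_mul hq',
    adelicAbs_mul (isUnit_det_lowBlock hq') (isUnit_det_lowBlock hp), hdet,
    adelicAbs_algebraMap (isUnit_det_lowBlock hq).ne_zero, one_mul]

theorem diag_mul (a b : GL (Fin n) F) : diag (a * b) = diag a * diag b := map_mul _ a b

theorem rowHeight_triangular {p k : GL (Fin n) (AdeleRing (𝓞 F) F)}
    (hp : (p : Matrix (Fin n) (Fin n) (AdeleRing (𝓞 F) F)).BlockTriangular id)
    (hk : k ∈ maxCompactSubgroup F n) :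
    rowHeight i (p * k) = ∑ l : Low n i, Real.log (adelicAbs (p l l)) := by
  have hp' := mem_lowParabolic_of_triangular (i := i) hp
  have h := isUnit_det_lowBlock hp'
  rw [lowBlock_triangular hp, IsUnit.prod_iff] at h
  rw [rowHeight_eq hp' hk, lowBlock_triangular hp, log_adelicAbs_prod _ h]

/-- After a permutation of the rows, the height of the last rows is at least the one given by the
diagonal entries of the triangular factor of the original matrix. -/
theorem le_rowHeight_perm {p k : GL (Fin n) (AdeleRing (𝓞 F) F)}
    (hp : (p : Matrix (Fin n) (Fin n) (AdeleRing (𝓞 F) F)).BlockTriangular id)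
    (hk : k ∈ maxCompactSubgroup F n) (σ : Equiv.Perm (Fin n)) :
    ∑ l : Low n i, Real.log (adelicAbs (p (σ l) (σ l))) ≤
      rowHeight i (permGL (AdeleRing (𝓞 F) F) σ * (p * k)) := by
  obtain ⟨q, hq, m, hm, h⟩ := exists_low_iwasawa i (permGL (AdeleRing (𝓞 F) F) σ * p)
  rw [← mul_assoc, h, mul_assoc, rowHeight_eq hq (mul_mem hm hk)]
  have hdiag : ∀ l, IsUnit (p l l) := by
    have h1 : IsUnit (p : Matrix (Fin n) (Fin n) (AdeleRing (𝓞 F) F)).det :=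
      (Matrix.isUnit_iff_isUnit_det _).1 p.isUnit
    rw [Matrix.det_of_isUpperTriangular hp, IsUnit.prod_iff] at h1
    exact fun l => h1 l (Finset.mem_univ l)
  have hsub : (p : Matrix (Fin n) (Fin n) (AdeleRing (𝓞 F) F)).submatrix
      (fun l : Low n i => σ l) (fun l : Low n i => σ l) =
      lowBlock i (q : Matrix (Fin n) (Fin n) (AdeleRing (𝓞 F) F)) *
        (m : Matrix (Fin n) (Fin n) (AdeleRing (𝓞 F) F)).submatrix Subtype.val
          (fun l : Low n i => σ l) := by
    refine Eq.trans ?_ (lowRows_mul hq _ _)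
    rw [← Units.val_mul, ← h]
    ext a b
    rw [submatrix_apply, submatrix_apply, Units.val_mul, permGL_mul_apply]
  have hdet : ((p : Matrix (Fin n) (Fin n) (AdeleRing (𝓞 F) F)).submatrix
      (fun l : Low n i => σ l) (fun l : Low n i => σ l)).det = ∏ l : Low n i, p (σ l) (σ l) := by
    -- reorder the rows and columns so that the submatrix is triangular
    have hinj : Function.Injective fun l : Low n i => σ l :=
      σ.injective.comp Subtype.val_injective
    let e : Low n i ≃ Set.range fun l : Low n i => σ l := Equiv.ofInjective _ hinj
    have h1 : (p : Matrix (Fin n) (Fin n) (AdeleRing (𝓞 F) F)).submatrix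
        (fun l : Low n i => σ l) (fun l : Low n i => σ l) =
        ((p : Matrix (Fin n) (Fin n) (AdeleRing (𝓞 F) F)).submatrix
          (Subtype.val : (Set.range fun l : Low n i => σ l) → Fin n) Subtype.val).submatrix e e :=
      rfl
    have h2 := Matrix.det_of_isUpperTriangular (M := p.val.submatrix
      (Subtype.val : (Set.range fun l : Low n i => σ l) → Fin n) Subtype.val) fun a b hab => hp hab
    rw [h1, Matrix.det_submatrix_equiv_self, h2, ← e.prod_comp]
    rfl
  have hu : IsUnit (∏ l : Low n i, p (σ l) (σ l)) :=
    IsUnit.prod_iff.2 fun l _ => hdiag _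
  rw [← log_adelicAbs_prod _ fun l _ => hdiag _, ← hdet]
  rw [← hdet, hsub, det_mul] at hu
  refine Real.log_le_log (adelicAbs_pos (by rwa [hsub, det_mul])) ?_
  have hum := isUnit_of_mul_isUnit_right hu
  rw [hsub, det_mul, adelicAbs_mul (isUnit_det_lowBlock hq) hum]
  exact mul_le_of_le_one_right (adelicAbs_nonneg _) (adelicAbs_minor_le_one hm _ _ hum)

/-! ### The Harish-Chandra map -/

variable (P : Composition n)

theorem parabolic_le_lowParabolic {R : Type*} [CommRing R] {i : Fin (n + 1)}
    (hi : i ∈ P.boundaries) : parabolic R P ≤ lowParabolic R n i := by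
  intro p hp
  exact mem_lowParabolic.2 fun a b ha hb => hp ((index_lt_iff P).2 ⟨i, hi, hb, ha⟩)

theorem exists_isHarishChandra (g : GL (Fin n) (AdeleRing (𝓞 F) F)) :
    ∃ H, IsHarishChandra P g H := by
  obtain ⟨p, k, hk, h, hp⟩ := exists_iwasawa g
  let r : Fin P.length → ℝ := fun b => Real.log (adelicAbs
    ((p : Matrix (Fin n) (Fin n) (AdeleRing (𝓞 F) F)).toSquareBlock P.index b).det)
  refine ⟨fun l => r (P.index l) /
    (Finset.univ.filter fun l' => P.index l' = P.index l).card, ?_, p, ?_, k, hk, h, ?_⟩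
  · intro a b hab
    simp only [hab]
  · intro a b hab
    exact hp ((index_mono P).reflect_lt hab)
  · intro b
    have hne : (Finset.univ.filter fun l => P.index l = b).Nonempty :=
      ⟨P.embedding b ⟨0, P.one_le_blocksFun b⟩, by simp⟩
    have hc : ((Finset.univ.filter fun l => P.index l = b).card : ℝ) ≠ 0 := by
      exact_mod_cast hne.card_pos.ne'
    rw [Finset.sum_congr rfl (g := fun _ =>
      r b / (Finset.univ.filter fun l => P.index l = b).card), Finset.sum_const, nsmul_eq_mul]
    · field_simp
      rfl
    · intro l hl
      simp only [(Finset.mem_filter.1 hl).2]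

theorem isHarishChandra_HC (g : GL (Fin n) (AdeleRing (𝓞 F) F)) :
    IsHarishChandra P g (HC P g) := Classical.epsilon_spec (exists_isHarishChandra P g)

theorem HC_mem_aSpace (g : GL (Fin n) (AdeleRing (𝓞 F) F)) : HC P g ∈ aSpace P :=
  (isHarishChandra_HC P g).1

/-- The partial sums of `H_P(g)` from a boundary on are the heights of the last rows of `g`. -/
theorem sum_HC (g : GL (Fin n) (AdeleRing (𝓞 F) F)) {i : Fin (n + 1)} (hi : i ∈ P.boundaries) :
    ∑ l : Low n i, HC P g l = rowHeight i g := by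
  obtain ⟨-, p, hp, k, hk, h, hH⟩ := isHarishChandra_HC P g
  have hp' := parabolic_le_lowParabolic P hi hp
  set M := p.val with hM
  have hblock : (lowBlock (i : ℕ) M).BlockTriangular fun l : Low n i => P.index l.1 :=
    fun a b hab => hp hab
  have hdet := hblock.det_fintype
  have hterm : ∀ b : Fin P.length,
      Real.log (adelicAbs ((lowBlock (i : ℕ) M).toSquareBlock
        (fun l : Low n i => P.index l.1) b).det) =
      ∑ l : Low n i with P.index l.1 = b, HC P g l := by
    intro b
    by_cases hb : ∃ l : Low n i, P.index l.1 = b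
    · obtain ⟨l0, hl0⟩ := hb
      have hall : ∀ l : Fin n, P.index l = b → (i : ℕ) ≤ l := by
        intro l hl
        by_contra! hlt
        have := (index_lt_iff P).2 ⟨i, hi, hlt, l0.2⟩
        rw [hl, hl0] at this
        exact this.false
      let e : {l : Low n i // P.index l.1 = b} ≃ {l : Fin n // P.index l = b} :=
        { toFun := fun l => ⟨l.1.1, l.2⟩
          invFun := fun l => ⟨⟨l.1, hall l.1 l.2⟩, l.2⟩
          left_inv := fun _ => rfl
          right_inv := fun _ => rfl }
      have h1 : (lowBlock (i : ℕ) M).toSquareBlock (fun l : Low n i => P.index l.1) b =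
          (M.toSquareBlock P.index b).submatrix e e := rfl
      rw [h1, Matrix.det_submatrix_equiv_self, ← hH b]
      rw [← Finset.sum_subtype_eq_sum_filter, ← Finset.sum_subtype_eq_sum_filter]
      simp only [Finset.subtype_univ]
      exact (e.sum_comp fun l : {l : Fin n // P.index l = b} => HC P g l.1).symm
    · push Not at hb
      have : IsEmpty {l : Low n i // P.index l.1 = b} := ⟨fun l => hb l.1 l.2⟩
      rw [Finset.filter_false_of_mem fun l _ => hb l, Finset.sum_empty]
      have h1 : ((lowBlock (i : ℕ) M).toSquareBlock (fun l : Low n i => P.index l.1) b).det = 1 :=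
        Matrix.det_isEmpty
      rw [h1, adelicAbs_one, Real.log_one]
  have hunit := isUnit_det_lowBlock hp'
  rw [← hM, hdet, IsUnit.prod_iff] at hunit
  conv_rhs => rw [h]
  rw [rowHeight_eq hp' hk, ← hM, hdet, log_adelicAbs_prod _ hunit]
  simp only [hterm]
  exact (Finset.sum_fiberwise _ _ _).symm

end Height

/-! ### Spans of the last rows -/

section RowSpan

variable {F : Type*} [Field F] {n : ℕ}

/-- The span of the rows of `δ` from the `i`-th one on, that is, the set of the row vectors whose
coordinates with respect to the rows of `δ` vanish before the `i`-th one. -/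
def rowSpan (δ : GL (Fin n) F) (i : ℕ) : Submodule F (Fin n → F) where
  carrier := {v | ∀ b : Fin n, (b : ℕ) < i → (v ᵥ* (δ⁻¹ : GL (Fin n) F).1) b = 0}
  zero_mem' := by
    intro b _
    simp
  add_mem' := by
    intro v w hv hw b hb
    rw [Matrix.add_vecMul, Pi.add_apply, hv b hb, hw b hb, add_zero]
  smul_mem' := by
    intro c v hv b hb
    rw [Matrix.smul_vecMul, Pi.smul_apply, hv b hb, smul_zero]

theorem vecMul_inv_vecMul (δ : GL (Fin n) F) (v : Fin n → F) :
    (v ᵥ* (δ⁻¹ : GL (Fin n) F).1) ᵥ* δ.1 = v := by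
  rw [Matrix.vecMul_vecMul, Units.inv_mul, Matrix.vecMul_one]

theorem vecMul_vecMul_inv (δ : GL (Fin n) F) (v : Fin n → F) :
    (v ᵥ* δ.1) ᵥ* (δ⁻¹ : GL (Fin n) F).1 = v := by
  rw [Matrix.vecMul_vecMul, Units.mul_inv, Matrix.vecMul_one]

theorem row_mem_rowSpan (δ : GL (Fin n) F) {i : ℕ} {a : Fin n} (ha : i ≤ (a : ℕ)) :
    δ.1 a ∈ rowSpan δ i := by
  intro b hb
  have h : δ.1 a = Pi.single a 1 ᵥ* δ.1 := (Matrix.single_one_vecMul a δ.1).symm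
  rw [h, vecMul_vecMul_inv, Pi.single_apply, if_neg]
  rintro rfl
  omega

theorem rowSpan_le {δ : GL (Fin n) F} {i : ℕ} {W : Submodule F (Fin n → F)}
    (h : ∀ a : Fin n, i ≤ (a : ℕ) → δ.1 a ∈ W) : rowSpan δ i ≤ W := by
  intro v hv
  rw [← vecMul_inv_vecMul δ v, Matrix.vecMul_eq_sum]
  refine sum_mem fun a _ => ?_
  by_cases ha : i ≤ (a : ℕ)
  · exact W.smul_mem _ (h a ha)
  · rw [hv a (not_le.1 ha), zero_smul]
    exact W.zero_mem

/-- The coordinates with respect to the last rows. -/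
def rowSpanEquiv (δ : GL (Fin n) F) (i : ℕ) : rowSpan δ i ≃ₗ[F] (Low n i → F) where
  toFun v l := (v.1 ᵥ* (δ⁻¹ : GL (Fin n) F).1) l.1
  map_add' v w := by
    ext l
    simp [Matrix.add_vecMul]
  map_smul' c v := by
    ext l
    simp [Matrix.smul_vecMul]
  invFun c := ⟨(fun l : Fin n => if h : i ≤ (l : ℕ) then c ⟨l, h⟩ else 0) ᵥ* δ.1, by
    intro b hb
    rw [vecMul_vecMul_inv, dif_neg (not_le.2 hb)]⟩
  left_inv v := by
    apply Subtype.ext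
    conv_rhs => rw [← vecMul_inv_vecMul δ v.1]
    simp only
    congr 1
    ext l
    by_cases h : i ≤ (l : ℕ)
    · simp [h]
    · rw [dif_neg h, v.2 l (not_le.1 h)]
  right_inv c := by
    ext l
    simp only [vecMul_vecMul_inv]
    rw [dif_pos l.2]

theorem finrank_rowSpan (δ : GL (Fin n) F) {i : ℕ} (hi : i ≤ n) :
    Module.finrank F (rowSpan δ i) = n - i := by
  rw [(rowSpanEquiv δ i).finrank_eq, Module.finrank_fintype_fun_eq_card, card_low hi]

theorem rowSpan_eq_of_finrank {δ : GL (Fin n) F} {W : Submodule F (Fin n → F)}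
    (h : ∀ a : Fin n, n - Module.finrank F W ≤ (a : ℕ) → δ.1 a ∈ W) :
    rowSpan δ (n - Module.finrank F W) = W := by
  have hW : Module.finrank F W ≤ n := by simpa using Submodule.finrank_le W
  refine Submodule.eq_of_le_of_finrank_eq (rowSpan_le h) ?_
  rw [finrank_rowSpan δ (Nat.sub_le _ _), Nat.sub_sub_self hW]

theorem rowSpan_zero (δ : GL (Fin n) F) : rowSpan δ 0 = ⊤ :=
  eq_top_iff.2 fun _ _ _ hb => absurd hb (Nat.not_lt_zero _)

theorem rowSpan_self (δ : GL (Fin n) F) : rowSpan δ n = ⊥ := by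
  rw [← Submodule.finrank_eq_zero (R := F), finrank_rowSpan δ le_rfl, Nat.sub_self]

theorem rowSpan_antitone (δ : GL (Fin n) F) : Antitone (rowSpan δ) :=
  fun _ _ hij _ hv b hb => hv b (hb.trans_le hij)

/-- Two matrices have the same span of last rows if and only if they differ by an element of the
maximal parabolic subgroup. -/
theorem mul_inv_mem_lowParabolic {δ δ' : GL (Fin n) F} {i : ℕ}
    (h : rowSpan δ' i ≤ rowSpan δ i) : δ' * δ⁻¹ ∈ lowParabolic F n i := by
  refine mem_lowParabolic.2 fun a b ha hb => ?_
  have := h (row_mem_rowSpan δ' ha) b hb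
  rwa [Units.val_mul, Matrix.mul_apply_eq_vecMul]

theorem rowSpan_mul {q : GL (Fin n) F} {i : ℕ} (hq : q ∈ lowParabolic F n i) (δ : GL (Fin n) F) :
    rowSpan (q * δ) i = rowSpan δ i := by
  have key : ∀ (q δ : GL (Fin n) F), q ∈ lowParabolic F n i →
      rowSpan (q * δ) i ≤ rowSpan δ i := by
    intro q δ hq
    refine rowSpan_le fun a ha b hb => ?_
    rw [← Matrix.mul_apply_eq_vecMul, ← Units.val_mul, mul_inv_cancel_right]
    exact mem_lowParabolic.1 hq a b ha hb
  refine le_antisymm (key q δ hq) ?_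
  have := key q⁻¹ (q * δ) (inv_mem hq)
  rwa [inv_mul_cancel_left] at this

/-- Greedy choice of a basis: if `X m` is never contained in the span of `m` independent vectors
chosen from `X 0, …, X (m - 1)`, then there is a basis with its `m`-th vector in `X m`. -/
theorem exists_basis_of_greedy {V : Type*} [AddCommGroup V] [Module F V]
    (X : ℕ → Submodule F V) (N : ℕ)
    (hX : ∀ m < N, ∀ v : Fin m → V, LinearIndependent F v → (∀ l : Fin m, v l ∈ X l) →
      ¬ X m ≤ Submodule.span F (Set.range v)) :
    ∃ v : Fin N → V, LinearIndependent F v ∧ ∀ l : Fin N, v l ∈ X l := by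
  have key : ∀ m ≤ N, ∃ v : Fin m → V, LinearIndependent F v ∧ ∀ l : Fin m, v l ∈ X l := by
    intro m
    induction m with
    | zero => exact fun _ => ⟨Fin.elim0, linearIndependent_empty_type, fun l => l.elim0⟩
    | succ m ih =>
      intro hm
      obtain ⟨v, hv, hvX⟩ := ih (by omega)
      obtain ⟨x, hx, hxv⟩ := SetLike.not_le_iff_exists.1 (hX m hm v hv hvX)
      refine ⟨Fin.snoc v x, linearIndependent_finSnoc.2 ⟨hv, hxv⟩, fun l => ?_⟩
      induction l using Fin.lastCases with
      | last => simpa using hx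
      | cast l => simpa using hvX l
  exact key N le_rfl

/-- The invertible matrix with the given independent vectors as rows, in reverse order. -/
theorem exists_matrix_of_linearIndependent {v : Fin n → Fin n → F} (hv : LinearIndependent F v) :
    ∃ δ : GL (Fin n) F, ∀ a, δ.1 a = v (Fin.rev a) := by
  have h : LinearIndependent F (Matrix.of fun a => v (Fin.rev a)).row :=
    hv.comp Fin.rev Fin.rev_injective
  rw [Matrix.linearIndependent_rows_iff_isUnit] at h
  exact ⟨h.unit, fun a => rfl⟩

theorem span_range_eq_of_mem {m : ℕ} {v : Fin m → Fin n → F} (hv : LinearIndependent F v)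
    {W : Submodule F (Fin n → F)} (hW : Module.finrank F W ≤ m)
    (h : ∀ l : Fin m, (l : ℕ) < Module.finrank F W → v l ∈ W) :
    W ≤ Submodule.span F (Set.range v) := by
  let w : Fin (Module.finrank F W) → Fin n → F := fun l => v (Fin.castLE hW l)
  have hw : LinearIndependent F w := hv.comp _ (Fin.castLE_injective hW)
  have h1 : Submodule.span F (Set.range w) = W := by
    refine Submodule.eq_of_le_of_finrank_eq ?_ ?_
    · rw [Submodule.span_le]
      rintro _ ⟨l, rfl⟩
      exact h _ l.2
    · rw [finrank_span_eq_card hw, Fintype.card_fin]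
  rw [← h1]
  exact Submodule.span_mono (by rintro _ ⟨l, rfl⟩; exact ⟨_, rfl⟩)

theorem not_le_span {m : ℕ} {v : Fin m → Fin n → F} {W : Submodule F (Fin n → F)}
    (hW : m < Module.finrank F W) : ¬ W ≤ Submodule.span F (Set.range v) := by
  intro h
  have h1 := Submodule.finrank_mono h
  have h2 := finrank_range_le_card (R := F) (b := v)
  rw [Fintype.card_fin] at h2
  have h3 : Module.finrank F (Submodule.span F (Set.range v)) ≤ m := h2
  omega

/-- Every flag of subspaces consists of spans of last rows of one invertible matrix. -/
theorem exists_adapted (C : Finset (Submodule F (Fin n → F))) (hC : IsFlag C) :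
    ∃ δ : GL (Fin n) F, ∀ W ∈ C, rowSpan δ (n - Module.finrank F W) = W := by
  classical
  have hleast : ∀ m : ℕ, ∃ T : Submodule F (Fin n → F), m < n → T ∈ C ∧
      m < Module.finrank F T ∧ ∀ W ∈ C, m < Module.finrank F W → T ≤ W := by
    intro m
    by_cases hm : m < n
    swap
    · exact ⟨⊥, fun h => absurd h hm⟩
    obtain ⟨T, hT⟩ :=
      (C.filter fun W : Submodule F (Fin n → F) => m < Module.finrank F W).exists_minimal
        ⟨⊤, by simp [hC.top_mem, hm]⟩
    have hT1 := Finset.mem_filter.1 hT.1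
    refine ⟨T, fun _ => ⟨hT1.1, hT1.2, fun W hW hmW => ?_⟩⟩
    rcases hC.total hT1.1 hW with h | h
    · exact h
    · exact hT.2 (Finset.mem_filter.2 ⟨hW, hmW⟩) h
  choose T hT using hleast
  obtain ⟨v, hv, hvT⟩ := exists_basis_of_greedy T n fun m hm v _ _ => not_le_span (hT m hm).2.1
  obtain ⟨δ, hδ⟩ := exists_matrix_of_linearIndependent hv
  refine ⟨δ, fun W hW => rowSpan_eq_of_finrank fun a ha => ?_⟩
  rw [hδ]
  have h1 : ((Fin.rev a : Fin n) : ℕ) < Module.finrank F W := by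
    rw [Fin.val_rev]
    have := a.2
    omega
  exact (hT _ (Fin.rev a).2).2.2 W hW h1 (hvT _)

/-- A basis adapted to two subspaces: their intersection, one of them and their sum are spanned by
last rows, and the other one is spanned by the rows of the intersection and the rows of the sum that
do not belong to the first one. -/
theorem exists_adapted_pair (W W' : Submodule F (Fin n → F)) :
    ∃ δ : GL (Fin n) F, rowSpan δ (n - Module.finrank F ↥(W ⊓ W')) = W ⊓ W' ∧
      rowSpan δ (n - Module.finrank F W) = W ∧
      rowSpan δ (n - Module.finrank F ↥(W ⊔ W')) = W ⊔ W' ∧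
      ∀ a : Fin n, n - Module.finrank F ↥(W ⊓ W') ≤ a ∨
        (n - Module.finrank F ↥(W ⊔ W') ≤ a ∧ (a : ℕ) < n - Module.finrank F W) → δ.1 a ∈ W' := by
  classical
  have h1 : Module.finrank F ↥(W ⊓ W') ≤ Module.finrank F W := Submodule.finrank_mono inf_le_left
  have h2 : Module.finrank F W ≤ Module.finrank F ↥(W ⊔ W') := Submodule.finrank_mono le_sup_left
  have h3 : Module.finrank F ↥(W ⊔ W') ≤ n := by simpa using Submodule.finrank_le (W ⊔ W')
  set p := Module.finrank F ↥(W ⊓ W') with hp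
  set r := Module.finrank F W with hr
  set s := Module.finrank F ↥(W ⊔ W') with hs
  let X : ℕ → Submodule F (Fin n → F) := fun m =>
    if m < p then W ⊓ W' else if m < r then W else if m < s then W' else ⊤
  obtain ⟨v, hv, hvX⟩ := exists_basis_of_greedy X n (by
    intro m hm v hv hvX
    simp only [X]
    split_ifs with i1 i2 i3
    · exact not_le_span i1
    · exact not_le_span i2
    · intro hle
      have hWle : W ≤ Submodule.span F (Set.range v) := by
        refine span_range_eq_of_mem hv (not_lt.1 i2) fun l hl => ?_
        have := hvX l
        simp only [X] at this
        split_ifs at this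
        · exact this.1
        · exact this
      exact not_le_span i3 (sup_le hWle hle)
    · exact not_le_span (by simpa using hm))
  obtain ⟨δ, hδ⟩ := exists_matrix_of_linearIndependent hv
  have hrow : ∀ a : Fin n, δ.1 a ∈ X (n - 1 - a) := by
    intro a
    rw [hδ]
    convert hvX (Fin.rev a) using 2
    rw [Fin.val_rev]
    omega
  refine ⟨δ, rowSpan_eq_of_finrank fun a ha => ?_, rowSpan_eq_of_finrank fun a ha => ?_,
    rowSpan_eq_of_finrank fun a ha => ?_, fun a ha => ?_⟩
  all_goals
    have h4 := hrow a
    have h5 := a.2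
    simp only [X] at h4
  · rw [if_pos (by omega)] at h4
    exact h4
  · split_ifs at h4
    · exact h4.1
    · exact h4
    · omega
    · omega
  · split_ifs at h4
    · exact (le_sup_left : W ≤ W ⊔ W') h4.1
    · exact (le_sup_left : W ≤ W ⊔ W') h4
    · exact (le_sup_right : W' ≤ W ⊔ W') h4
    · omega
  · split_ifs at h4
    · exact h4.2
    · omega
    · exact h4
    · omega

end RowSpan

/-! ### The height of a subspace -/

section Height

variable {F : Type*} [Field F] [NumberField F] {n : ℕ}

theorem rowHeight_congr {δ δ' : GL (Fin n) F} {i : ℕ} (h : rowSpan δ i = rowSpan δ' i)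
    (g : GL (Fin n) (AdeleRing (𝓞 F) F)) :
    rowHeight i (diag δ * g) = rowHeight i (diag δ' * g) := by
  have h1 := rowHeight_diag_mul (mul_inv_mem_lowParabolic h.le) (diag δ' * g)
  rwa [← mul_assoc, ← diag_mul, inv_mul_cancel_right] at h1

omit [NumberField F] in
theorem exists_rowSpan_eq (W : Submodule F (Fin n → F)) :
    ∃ δ : GL (Fin n) F, rowSpan δ (n - Module.finrank F W) = W := by
  obtain ⟨δ, h, -⟩ := exists_adapted_pair W W
  rw [inf_idem] at h
  exact ⟨δ, h⟩

/-- The logarithmic height of a subspace `W` of `F ^ n`, in the metrics defined by `g`: the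
logarithm of the covolume of `W`, or minus its Arakelov degree. -/
def height (g : GL (Fin n) (AdeleRing (𝓞 F) F)) (W : Submodule F (Fin n → F)) : ℝ :=
  rowHeight (n - Module.finrank F W) (diag (exists_rowSpan_eq W).choose * g)

theorem height_rowSpan (g : GL (Fin n) (AdeleRing (𝓞 F) F)) (δ : GL (Fin n) F) {i : ℕ}
    (hi : i ≤ n) : height g (rowSpan δ i) = rowHeight i (diag δ * g) := by
  have h := (exists_rowSpan_eq (rowSpan δ i)).choose_spec
  rw [height]
  have hr : n - Module.finrank F (rowSpan δ i) = i := by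
    rw [finrank_rowSpan δ hi]
    omega
  rw [rowHeight_congr (h.trans (by rw [hr])) g, hr]

theorem height_of_rowSpan_eq (g : GL (Fin n) (AdeleRing (𝓞 F) F)) {δ : GL (Fin n) F}
    {W : Submodule F (Fin n → F)} (h : rowSpan δ (n - Module.finrank F W) = W) :
    height g W = rowHeight (n - Module.finrank F W) (diag δ * g) := by
  rw [← height_rowSpan g δ (Nat.sub_le _ _), h]

theorem diag_permGL (σ : Equiv.Perm (Fin n)) :
    diag (permGL F σ) = permGL (AdeleRing (𝓞 F) F) σ := by
  ext i j
  rw [diag, Matrix.GeneralLinearGroup.map_apply, permGL_apply, permGL_apply]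
  split_ifs <;> simp

theorem sum_low_eq (f : Fin n → ℝ) (i : ℕ) :
    ∑ l : Low n i, f l = ∑ l : Fin n, if i ≤ (l : ℕ) then f l else 0 := by
  rw [← Finset.sum_filter]
  exact (Finset.sum_subtype _ (by simp) f).symm

theorem height_submodular (g : GL (Fin n) (AdeleRing (𝓞 F) F)) (W W' : Submodule F (Fin n → F)) :
    height g (W ⊔ W') + height g (W ⊓ W') ≤ height g W + height g W' := by
  obtain ⟨δ, e1, e2, e3, h4⟩ := exists_adapted_pair W W'
  have h1 : Module.finrank F ↥(W ⊓ W') ≤ Module.finrank F W := Submodule.finrank_mono inf_le_left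
  have h2 : Module.finrank F W ≤ Module.finrank F ↥(W ⊔ W') := Submodule.finrank_mono le_sup_left
  have h3 : Module.finrank F ↥(W ⊔ W') ≤ n := by simpa using Submodule.finrank_le (W ⊔ W')
  have hdim := Submodule.finrank_sup_add_finrank_inf_eq W W'
  rw [height_of_rowSpan_eq g e1, height_of_rowSpan_eq g e2, height_of_rowSpan_eq g e3]
  set p := Module.finrank F ↥(W ⊓ W')
  set r := Module.finrank F W
  set s := Module.finrank F ↥(W ⊔ W')
  set r' := Module.finrank F W' with hr'
  -- a permutation that moves the rows that span `W'` to the end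
  let S : Fin n → Prop := fun a => n - p ≤ a ∨ (n - s ≤ a ∧ (a : ℕ) < n - r)
  have hcard : Fintype.card (Low n (n - r')) = Fintype.card {a // S a} := by
    classical
    rw [card_low (Nat.sub_le _ _), Fintype.card_subtype]
    have hcl : ∀ i : ℕ, i ≤ n → (Finset.univ.filter fun a : Fin n => i ≤ (a : ℕ)).card = n - i :=
      fun i hi => by rw [← card_low hi, Fintype.card_subtype]
    have hd1 : Finset.univ.filter S = (Finset.univ.filter fun a : Fin n => n - p ≤ (a : ℕ)) ∪
        ((Finset.univ.filter fun a : Fin n => n - s ≤ (a : ℕ)) \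
          (Finset.univ.filter fun a : Fin n => n - r ≤ (a : ℕ))) := by
      ext a
      simp only [S, Finset.mem_filter, Finset.mem_univ, true_and, Finset.mem_union,
        Finset.mem_sdiff, not_le]
    rw [hd1, Finset.card_union_of_disjoint, Finset.card_sdiff_of_subset, hcl _ (Nat.sub_le _ _),
      hcl _ (Nat.sub_le _ _), hcl _ (Nat.sub_le _ _)]
    · omega
    · intro a ha
      simp only [Finset.mem_filter, Finset.mem_univ, true_and] at *
      omega
    · rw [Finset.disjoint_left]
      intro a ha
      simp only [Finset.mem_filter, Finset.mem_univ, true_and, Finset.mem_sdiff] at *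
      omega
  let e : Low n (n - r') ≃ {a // S a} := Fintype.equivOfCardEq hcard
  let σ : Equiv.Perm (Fin n) := e.extendSubtype
  have hσ : ∀ l : Low n (n - r'), σ l = (e l).1 := fun l => e.extendSubtype_apply_of_mem l.1 l.2
  have hW' : rowSpan (permGL F σ * δ) (n - r') = W' := by
    refine rowSpan_eq_of_finrank fun a ha => ?_
    have : (permGL F σ * δ).1 a = δ.1 (σ a) := by
      ext j
      rw [Units.val_mul, permGL_mul_apply]
    rw [this, hσ ⟨a, ha⟩]
    exact h4 _ (e ⟨a, ha⟩).2
  obtain ⟨q, k, hk, hg, hq⟩ := exists_iwasawa (diag δ * g)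
  have h5 := le_rowHeight_perm (i := n - r') hq hk σ
  rw [height_of_rowSpan_eq g hW', diag_mul, diag_permGL, mul_assoc, hg]
  simp only [rowHeight_triangular hq hk]
  set d : Fin n → ℝ := fun l => Real.log (adelicAbs (q l l))
  have h6 : ∑ l : Low n (n - r'), d (σ l) = ∑ a : Fin n, if S a then d a else 0 := by
    rw [← Finset.sum_filter, Finset.sum_subtype (Finset.univ.filter S) (p := S) (by simp) d,
      ← e.sum_comp]
    exact Finset.sum_congr rfl fun l _ => by rw [hσ]
  have h7 : ∑ l : Low n (n - s), d l + ∑ l : Low n (n - p), d l =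
      ∑ l : Low n (n - r), d l + ∑ l : Low n (n - r'), d (σ l) := by
    rw [h6, sum_low_eq, sum_low_eq, sum_low_eq, ← Finset.sum_add_distrib,
      ← Finset.sum_add_distrib]
    refine Finset.sum_congr rfl fun a _ => ?_
    simp only [S]
    split_ifs <;> first | omega | simp
  linarith

end Height

/-! ### Finiteness of the subspaces of bounded height -/

section Minors

variable {F : Type*} [Field F] {n i : ℕ}

theorem exists_minor_ne_zero (δ : GL (Fin n) F) (i : ℕ) :
    ∃ f : Low n i → Fin n, (δ.1.submatrix Subtype.val f).det ≠ 0 := by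
  by_contra! h
  -- the last rows of `δ` have a right inverse, whose product with them expands in the minors
  have h1 : δ.1.submatrix (Subtype.val : Low n i → Fin n) id *
      (δ⁻¹ : GL (Fin n) F).1.submatrix id (Subtype.val : Low n i → Fin n) = 1 := by
    rw [← Matrix.submatrix_mul _ _ _ id _ Function.bijective_id, Units.mul_inv]
    exact Matrix.submatrix_one _ Subtype.val_injective
  have h2 : (δ.1.submatrix (Subtype.val : Low n i → Fin n) id *
      (δ⁻¹ : GL (Fin n) F).1.submatrix id (Subtype.val : Low n i → Fin n))ᵀ =
      Matrix.of fun t => ∑ l, (δ⁻¹ : GL (Fin n) F).1 l t.1 • fun s : Low n i => δ.1 s.1 l := by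
    ext t s
    simp [Matrix.mul_apply, mul_comm]
  have h3 := congrArg Matrix.det h1
  rw [← det_transpose, h2, det_one] at h3
  refine one_ne_zero (h3.symm.trans ?_)
  refine (MultilinearMap.map_sum (detRowAlternating (n := Low n i) (R := F)).toMultilinearMap
    fun t l => (δ⁻¹ : GL (Fin n) F).1 l t.1 • fun s : Low n i => δ.1 s.1 l).trans ?_
  refine Finset.sum_eq_zero fun f _ => ?_
  rw [MultilinearMap.map_smul_univ]
  have h4 := h f
  rw [← det_transpose] at h4
  rw [show (detRowAlternating (n := Low n i) (R := F)).toMultilinearMap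
    (fun t => fun s : Low n i => δ.1 s.1 (f t)) = 0 from h4, smul_zero]

/-- The span of the last rows is the row space of a matrix whose entries are ratios of minors. -/
theorem rowSpan_eq_range (δ : GL (Fin n) F) (i : ℕ) {f : Low n i → Fin n}
    (hf : (δ.1.submatrix Subtype.val f).det ≠ 0) :
    rowSpan δ i = LinearMap.range (Matrix.of fun (t : Low n i) (j : Fin n) =>
      (δ.1.submatrix Subtype.val (Function.update f t j)).det /
        (δ.1.submatrix Subtype.val f).det).vecMulLinear := by
  set M := δ.1.submatrix (Subtype.val : Low n i → Fin n) f with hM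
  set R := δ.1.submatrix (Subtype.val : Low n i → Fin n) id with hR
  have hX : (Matrix.of fun (t : Low n i) (j : Fin n) =>
      (δ.1.submatrix Subtype.val (Function.update f t j)).det / M.det) = M⁻¹ * R := by
    ext t j
    have h1 : (δ.1.submatrix Subtype.val (Function.update f t j)) =
        M.updateCol t fun s => R s j := by
      ext a b
      rw [submatrix_apply, Matrix.updateCol_apply, Function.update_apply]
      split_ifs <;> rfl
    rw [of_apply, h1, ← cramer_apply, cramer_eq_adjugate_mulVec, Matrix.inv_def,
      Ring.inverse_eq_inv', Matrix.smul_mul, Matrix.smul_apply, smul_eq_mul, div_eq_inv_mul]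
    rfl
  have hMu : IsUnit M.det := isUnit_iff_ne_zero.2 hf
  rw [hX]
  apply le_antisymm
  · refine rowSpan_le fun a ha => ⟨M ⟨a, ha⟩, ?_⟩
    rw [Matrix.vecMulLinear_apply, ← Matrix.mul_apply_eq_vecMul, ← Matrix.mul_assoc,
      Matrix.mul_nonsing_inv _ hMu, Matrix.one_mul]
    rfl
  · rintro _ ⟨c, rfl⟩
    rw [Matrix.vecMulLinear_apply, ← Matrix.vecMul_vecMul, Matrix.vecMul_eq_sum]
    exact sum_mem fun a _ => Submodule.smul_mem _ _ (row_mem_rowSpan δ a.2)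

end Minors

section Northcott

variable {F : Type*} [Field F] [NumberField F] {n : ℕ}

/-- The height of a ratio of two elements that are bounded at all places by the same idele, up to
local factors that are almost all trivial. -/
theorem mulHeight₁_div_le {a b : F} (hb : b ≠ 0) {u : AdeleRing (𝓞 F) F} (hu : IsUnit u)
    {A : InfinitePlace F → ℝ} {B : HeightOneSpectrum (𝓞 F) → ℝ} (hB : B.HasFiniteMulSupport)
    (ha1 : ∀ v, v a ≤ ‖infEval v u‖ * A v) (hb1 : ∀ v, v b ≤ ‖infEval v u‖ * A v)
    (ha2 : ∀ v, FinitePlace.equivHeightOneSpectrum.symm v a ≤ ‖finEval v u‖ * B v)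
    (hb2 : ∀ v, FinitePlace.equivHeightOneSpectrum.symm v b ≤ ‖finEval v u‖ * B v) :
    Height.mulHeight₁ (a / b) ≤ adelicAbs u * ((∏ v, A v ^ v.mult) * ∏ᶠ v, B v) := by
  have hne : ![a, b] ≠ 0 := fun h => hb (congrFun h 1)
  have hsupp : ∀ v : FinitePlace F, (⨆ j, v (![a, b] j)) = max (v a) (v b) := by
    intro v
    refine le_antisymm (ciSup_le fun j => ?_) (max_le ?_ ?_)
    · fin_cases j <;> simp
    · exact Finite.le_ciSup_of_le 0 le_rfl
    · exact Finite.le_ciSup_of_le 1 le_rfl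
  have hfin : (fun v : HeightOneSpectrum (𝓞 F) =>
      ⨆ j, FinitePlace.equivHeightOneSpectrum.symm v (![a, b] j)).HasFiniteMulSupport := by
    simp only [hsupp]
    have h2 := (FinitePlace.hasFiniteMulSupport hb)
    have key : ∀ x : F, x ≠ 0 → ∀ᶠ v : HeightOneSpectrum (𝓞 F) in Filter.cofinite,
        FinitePlace.equivHeightOneSpectrum.symm v x = 1 := fun x hx =>
      FinitePlace.equivHeightOneSpectrum.symm.injective.tendsto_cofinite
        (FinitePlace.hasFiniteMulSupport hx)
    have : ∀ᶠ v : HeightOneSpectrum (𝓞 F) in Filter.cofinite,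
        max (FinitePlace.equivHeightOneSpectrum.symm v a)
          (FinitePlace.equivHeightOneSpectrum.symm v b) = 1 := by
      by_cases ha : a = 0
      · filter_upwards [key b hb] with v h
        simp [h, ha]
      · filter_upwards [key b hb, key a ha] with v h h'
        simp [h, h']
    exact this
  rw [Height.mulHeight₁_div_eq_mulHeight, NumberField.mulHeight_eq hne,
    ← finprod_comp_equiv FinitePlace.equivHeightOneSpectrum.symm, adelicAbs_eq, mul_mul_mul_comm,
    ← Finset.prod_mul_distrib, ← finprod_mul_distrib (hasFiniteMulSupport_norm hu) hB]
  refine mul_le_mul (Finset.prod_le_prod (fun v _ => ?_) fun v _ => ?_)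
    (finprod_le_finprod hfin (fun v => ?_) ((hasFiniteMulSupport_norm hu).mul hB) fun v => ?_)
    (finprod_nonneg fun v => ?_) (Finset.prod_nonneg fun v _ => ?_)
  · exact pow_nonneg (Real.iSup_nonneg fun j => apply_nonneg v _) _
  · rw [← mul_pow]
    refine pow_le_pow_left₀ (Real.iSup_nonneg fun j => apply_nonneg v _) (ciSup_le fun j => ?_) _
    fin_cases j
    · exact ha1 v
    · exact hb1 v
  · exact Real.iSup_nonneg fun j => apply_nonneg _ _
  · refine ciSup_le fun j => ?_
    fin_cases j
    · exact ha2 v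
    · exact hb2 v
  · exact Real.iSup_nonneg fun j => apply_nonneg _ _
  · rw [← mul_pow]
    exact pow_nonneg ((apply_nonneg v _).trans (ha1 v)) _

theorem norm_entry_le_one {k : GL (Fin n) (AdeleRing (𝓞 F) F)} (hk : k ∈ maxCompactSubgroup F n)
    (a b : Fin n) : (∀ v, ‖infEval v (k.1 a b)‖ ≤ 1) ∧ ∀ v, ‖finEval v (k.1 a b)‖ ≤ 1 := by
  have h := norm_minor_le_one hk (fun _ : Fin 1 => a) fun _ : Fin 1 => b
  simpa only [det_fin_one, submatrix_apply] using h

/-- Multiplication by the maximal compact subgroup on the left does not affect the uniform bounds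
for the minors of a matrix. -/
theorem exists_minor_bound {ι : Type*} [Fintype ι] [LinearOrder ι]
    (h : Matrix (Fin n) (Fin n) (AdeleRing (𝓞 F) F)) :
    ∃ (A : InfinitePlace F → ℝ) (B : HeightOneSpectrum (𝓞 F) → ℝ), B.HasFiniteMulSupport ∧
      ∀ k ∈ maxCompactSubgroup F n, ∀ r c : ι → Fin n,
        (∀ v, ‖infEval v ((k.1 * h).submatrix r c).det‖ ≤ A v) ∧
        ∀ v, ‖finEval v ((k.1 * h).submatrix r c).det‖ ≤ B v := by
  refine ⟨fun v => (Fintype.card ι).factorial • (∑ x : Fin n × Fin n, ‖infEval v (h x.1 x.2)‖) ^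
    Fintype.card ι, fun v => (∏ x : Fin n × Fin n, max 1 ‖finEval v (h x.1 x.2)‖) ^
    Fintype.card ι, ?_, fun k hk r c => ⟨fun v => ?_, fun v => ?_⟩⟩
  · have : ∀ᶠ v : HeightOneSpectrum (𝓞 F) in Filter.cofinite,
        (∏ x : Fin n × Fin n, max 1 ‖finEval v (h x.1 x.2)‖) ^ Fintype.card ι = 1 := by
      have h1 : ∀ᶠ v : HeightOneSpectrum (𝓞 F) in Filter.cofinite,
          ∀ x : Fin n × Fin n, ‖finEval v (h x.1 x.2)‖ ≤ 1 :=
        Filter.eventually_all.2 fun x => eventually_norm_le_one _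
      filter_upwards [h1] with v hv
      rw [Finset.prod_eq_one fun x _ => max_eq_left (hv x), one_pow]
    exact this
  · rw [RingHom.map_det]
    refine Matrix.det_le (abv := NormedField.toAbsoluteValue v.Completion) fun a b => ?_
    change ‖infEval v ((k.1 * h) (r a) (c b))‖ ≤ _
    rw [Matrix.mul_apply, map_sum]
    refine (norm_sum_le _ _).trans ?_
    rw [Fintype.sum_prod_type]
    refine Finset.sum_le_sum fun l _ => ?_
    rw [map_mul, norm_mul]
    refine (mul_le_of_le_one_left (norm_nonneg _) ((norm_entry_le_one hk _ _).1 v)).trans ?_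
    exact Finset.single_le_sum (f := fun j => ‖infEval v (h l j)‖)
      (fun j _ => norm_nonneg _) (Finset.mem_univ _)
  · have hone : ∀ x : Fin n × Fin n, 1 ≤ max 1 ‖finEval v (h x.1 x.2)‖ := fun x => le_max_left _ _
    have hY : 0 ≤ ∏ x : Fin n × Fin n, max 1 ‖finEval v (h x.1 x.2)‖ :=
      Finset.prod_nonneg fun x _ => zero_le_one.trans (hone x)
    have hle : ∀ l j, ‖finEval v (h l j)‖ ≤
        ∏ x : Fin n × Fin n, max 1 ‖finEval v (h x.1 x.2)‖ := by
      intro l j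
      refine (le_max_right 1 _).trans ?_
      rw [← Finset.mul_prod_erase _ _ (Finset.mem_univ (l, j))]
      refine le_mul_of_one_le_right (zero_le_one.trans (hone (l, j))) ?_
      exact Finset.one_le_prod fun x _ => hone x
    rw [RingHom.map_det, Matrix.det_apply]
    refine IsUltrametricDist.norm_sum_le_of_forall_le_of_nonneg (pow_nonneg hY _) fun σ _ => ?_
    have hs : ‖Equiv.Perm.sign σ • ∏ a, ((finEval v).mapMatrix ((k.1 * h).submatrix r c)) (σ a) a‖ =
        ‖∏ a, ((finEval v).mapMatrix ((k.1 * h).submatrix r c)) (σ a) a‖ := by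
      rcases Int.units_eq_one_or (Equiv.Perm.sign σ) with h1 | h1 <;> rw [h1] <;> simp
    rw [hs, norm_prod]
    refine (Finset.prod_le_prod (fun _ _ => norm_nonneg _) (fun a _ => ?_)).trans
      (Finset.prod_const _).le
    change ‖finEval v ((k.1 * h) (r (σ a)) (c a))‖ ≤ _
    rw [Matrix.mul_apply, map_sum]
    refine IsUltrametricDist.norm_sum_le_of_forall_le_of_nonneg hY fun l _ => ?_
    rw [map_mul, norm_mul]
    exact (mul_le_of_le_one_left (norm_nonneg _) ((norm_entry_le_one hk _ _).2 v)).trans (hle _ _)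

/-- Northcott's theorem for subspaces: only finitely many subspaces have bounded height. -/
theorem finite_height_le (g : GL (Fin n) (AdeleRing (𝓞 F) F)) (b : ℝ) :
    {W : Submodule F (Fin n → F) | height g W ≤ b}.Finite := by
  choose A B hB hAB using fun i : ℕ => exists_minor_bound (F := F) (ι := Low n i)
    (g⁻¹ : GL (Fin n) (AdeleRing (𝓞 F) F)).1
  let c : ℕ → ℝ := fun i => (∏ v, A i v ^ v.mult) * ∏ᶠ v, B i v
  have hc : ∀ i, 0 ≤ c i := by
    intro i
    have h := hAB i 1 (one_mem _)
    by_cases hi : Nonempty (Low n i → Fin n)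
    · obtain ⟨f⟩ := hi
      exact mul_nonneg (Finset.prod_nonneg fun v _ =>
        pow_nonneg ((norm_nonneg _).trans ((h f f).1 v)) _)
        (finprod_nonneg fun v => (norm_nonneg _).trans ((h f f).2 v))
    · exact absurd ⟨Subtype.val⟩ hi
  refine Set.Finite.subset (s := ⋃ i ∈ Set.Iic n, (fun X : Low n i → Fin n → F =>
    LinearMap.range (Matrix.of X).vecMulLinear) ''
      {X | ∀ t j, X t j ∈ {x : F | Height.mulHeight₁ x ≤ Real.exp b * c i}}) ?_ ?_
  · refine (Set.finite_Iic n).biUnion fun i _ => Set.Finite.image _ ?_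
    exact Set.Finite.pi' fun t => Set.Finite.pi' fun j => finite_setOfPred_mulHeight₁_le F _
  · intro W hW
    obtain ⟨δ, hδ⟩ := exists_rowSpan_eq W
    have hW' : height g W ≤ b := hW
    rw [height_of_rowSpan_eq g hδ] at hW'
    set i := n - Module.finrank F W
    refine Set.mem_biUnion (x := i) (Nat.sub_le _ _) ?_
    obtain ⟨f, hf⟩ := exists_minor_ne_zero δ i
    refine ⟨fun t j => _, fun t j => ?_, ((rowSpan_eq_range δ i hf).symm.trans hδ)⟩
    obtain ⟨p, hp, k, hk, hg⟩ := exists_low_iwasawa i (diag δ * g)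
    set u := (lowBlock i p.val).det with hu
    have huu : IsUnit u := isUnit_det_lowBlock hp
    rw [hg, rowHeight_eq hp hk, ← hu, Real.log_le_iff_le_exp (adelicAbs_pos huu)] at hW'
    have hminor : ∀ f : Low n i → Fin n, algebraMap F (AdeleRing (𝓞 F) F)
        (δ.1.submatrix Subtype.val f).det =
        u * ((k.1 * (g⁻¹ : GL (Fin n) (AdeleRing (𝓞 F) F)).1).submatrix Subtype.val f).det := by
      intro f
      have h1 : (diag δ).1 = p.1 * (k.1 * (g⁻¹ : GL (Fin n) (AdeleRing (𝓞 F) F)).1) := by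
        rw [← Units.val_mul, ← Units.val_mul, ← mul_assoc, ← hg, mul_inv_cancel_right]
      have h2 : (algebraMap F (AdeleRing (𝓞 F) F)).mapMatrix (δ.1.submatrix Subtype.val f) =
          (diag δ).1.submatrix Subtype.val f := rfl
      rw [RingHom.map_det, h2, h1, lowRows_mul hp]
      exact det_mul _ _
    have b1 : ∀ (f : Low n i → Fin n) (v : InfinitePlace F),
        v (δ.1.submatrix Subtype.val f).det ≤ ‖infEval v u‖ * A i v := by
      intro f v
      rw [← norm_infEval_algebraMap, hminor, map_mul, norm_mul]
      exact mul_le_mul_of_nonneg_left ((hAB i k hk _ _).1 v) (norm_nonneg _)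
    have b2 : ∀ (f : Low n i → Fin n) (v : HeightOneSpectrum (𝓞 F)),
        FinitePlace.equivHeightOneSpectrum.symm v (δ.1.submatrix Subtype.val f).det ≤
          ‖finEval v u‖ * B i v := by
      intro f v
      rw [← norm_finEval_algebraMap, hminor, map_mul, norm_mul]
      exact mul_le_mul_of_nonneg_left ((hAB i k hk _ _).2 v) (norm_nonneg _)
    exact (mulHeight₁_div_le hf huu (hB i) (b1 _) (b1 _) (b2 _) (b2 _)).trans
      (mul_le_mul_of_nonneg_right hW' (hc i))

/-- The lattice of subspaces of `F ^ n`, with the dimension and the height defined by `g`. -/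
def slopeLattice (g : GL (Fin n) (AdeleRing (𝓞 F) F)) :
    SlopeLattice (Submodule F (Fin n → F)) where
  rk W := Module.finrank F W
  ht := height g
  rk_strictMono _ _ h := Nat.cast_lt.2 (Submodule.finrank_lt_finrank_of_lt h)
  rk_modular W W' := by exact_mod_cast Submodule.finrank_sup_add_finrank_inf_eq W W'
  ht_submodular := height_submodular g
  finite_le := finite_height_le g

end Northcott

/-! ### Tail sums, roots and weights -/

section Tail

variable {n : ℕ}

/-- The sum of the coordinates from the `m`-th one on. -/
def tail (H : Fin n → ℝ) (m : ℕ) : ℝ := ∑ l : Low n m, H l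

theorem tail_eq (H : Fin n → ℝ) (m : ℕ) :
    tail H m = ∑ l : Fin n, if m ≤ (l : ℕ) then H l else 0 := sum_low_eq H m

theorem tail_eq_zero (H : Fin n → ℝ) {m : ℕ} (hm : n ≤ m) : tail H m = 0 := by
  rw [tail_eq]
  exact Finset.sum_eq_zero fun l _ => if_neg (by omega)

theorem tail_sub_tail (H : Fin n → ℝ) {i j : ℕ} (hij : i ≤ j) :
    tail H i - tail H j = ∑ l : Fin n, if i ≤ (l : ℕ) ∧ (l : ℕ) < j then H l else 0 := by
  rw [tail_eq, tail_eq, ← Finset.sum_sub_distrib]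
  refine Finset.sum_congr rfl fun l _ => ?_
  split_ifs <;> first | omega | simp

theorem tail_sub_tail_succ (H : Fin n → ℝ) (x : Fin n) : tail H x - tail H (x + 1) = H x := by
  rw [tail_sub_tail H (Nat.le_succ _), Finset.sum_eq_single x]
  · simp
  · intro l _ hl
    refine if_neg fun h => hl (Fin.ext ?_)
    omega
  · simp

theorem tail_sub (H H' : Fin n → ℝ) (m : ℕ) : tail (H - H') m = tail H m - tail H' m := by
  simp [tail, Finset.sum_sub_distrib]

theorem tail_neg (H : Fin n → ℝ) (m : ℕ) : tail (-H) m = -tail H m := by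
  simp [tail]

/-- The indices from `i` to `j - 1` form a block of `P`. -/
structure IsBlock (P : Composition n) (i j : Fin (n + 1)) : Prop where
  left_mem : i ∈ P.boundaries
  right_mem : j ∈ P.boundaries
  lt : i < j
  le_or_le : ∀ k ∈ P.boundaries, k ≤ i ∨ j ≤ k

variable {P Q : Composition n} {i j : Fin (n + 1)}

theorem IsBlock.lt_nat (h : IsBlock P i j) : (i : ℕ) < j := h.lt

theorem IsBlock.sub_pos (h : IsBlock P i j) : (0 : ℝ) < (j : ℕ) - (i : ℕ) :=
  _root_.sub_pos.2 (Nat.cast_lt.2 h.lt)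

theorem IsBlock.le_or_le_nat (h : IsBlock P i j) {k : Fin (n + 1)} (hk : k ∈ P.boundaries) :
    (k : ℕ) ≤ i ∨ (j : ℕ) ≤ k := h.le_or_le k hk

theorem IsBlock.index_eq_iff (h : IsBlock P i j) {x y : Fin n} (hix : (i : ℕ) ≤ x)
    (hxj : (x : ℕ) < j) : P.index y = P.index x ↔ (i : ℕ) ≤ y ∧ (y : ℕ) < j := by
  constructor
  · intro hxy
    constructor
    · by_contra! h1
      exact ((index_lt_iff P).2 ⟨i, h.left_mem, h1, hix⟩).ne hxy
    · by_contra! h1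
      exact ((index_lt_iff P).2 ⟨j, h.right_mem, hxj, h1⟩).ne' hxy
  · rintro ⟨h1, h2⟩
    refine le_antisymm (not_lt.1 fun h3 => ?_) (not_lt.1 fun h3 => ?_) <;>
    · obtain ⟨k, hk, h4, h5⟩ := (index_lt_iff P).1 h3
      have := h.le_or_le_nat hk
      omega

theorem isBlock_of_index (P : Composition n) (x : Fin n) :
    IsBlock P ⟨P.sizeUpTo (P.index x), Nat.lt_succ_iff.2 (P.sizeUpTo_le _)⟩
      ⟨P.sizeUpTo (P.index x + 1), Nat.lt_succ_iff.2 (P.sizeUpTo_le _)⟩ := by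
  have h1 := P.sizeUpTo_index_le x
  have h2 := P.lt_sizeUpTo_index_succ x
  simp only [Fin.val_succ] at h2
  refine ⟨(mem_boundaries_iff P).2 ⟨_, (P.index x).2.le, rfl⟩,
    (mem_boundaries_iff P).2 ⟨_, (P.index x).2, rfl⟩, Fin.lt_def.2 (h1.trans_lt h2), fun k hk => ?_⟩
  obtain ⟨m, -, hm⟩ := (mem_boundaries_iff P).1 hk
  rcases Nat.lt_or_ge (P.index x) m with h | h
  · exact Or.inr (Fin.le_def.2 (hm ▸ P.monotone_sizeUpTo h))
  · exact Or.inl (Fin.le_def.2 (hm ▸ P.monotone_sizeUpTo h))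

theorem exists_isBlock (P : Composition n) (x : Fin n) :
    ∃ i j, IsBlock P i j ∧ (i : ℕ) ≤ x ∧ (x : ℕ) < j :=
  ⟨_, _, isBlock_of_index P x, P.sizeUpTo_index_le x, P.lt_sizeUpTo_index_succ x⟩

theorem exists_isBlock_left (hi : i ∈ P.boundaries) (hn : (i : ℕ) < n) : ∃ j, IsBlock P i j := by
  obtain ⟨i', j, h, h1, h2⟩ := exists_isBlock P ⟨i, hn⟩
  have h3 := h.le_or_le_nat hi
  simp only at h1 h2
  have : i' = i := Fin.ext (by omega)
  exact ⟨j, this ▸ h⟩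

theorem exists_isBlock_right (hj : j ∈ P.boundaries) (h0 : 0 < (j : ℕ)) : ∃ i, IsBlock P i j := by
  obtain ⟨i, j', h, h1, h2⟩ := exists_isBlock P ⟨j - 1, by omega⟩
  have h3 := h.le_or_le_nat hj
  simp only at h1 h2
  have : j' = j := Fin.ext (by omega)
  exact ⟨i, this ▸ h⟩

theorem exists_isBlock_of_notMem {m : Fin (n + 1)} (hm : m ∉ Q.boundaries) :
    ∃ i j, IsBlock Q i j ∧ i < m ∧ m < j := by
  have hn : (m : ℕ) < n := by
    refine lt_of_le_of_ne (Nat.lt_succ_iff.1 m.2) fun h => hm ?_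
    exact (Fin.ext h : m = Fin.last n) ▸ last_mem_boundaries Q
  obtain ⟨i, j, h, h1, h2⟩ := exists_isBlock Q ⟨m, hn⟩
  refine ⟨i, j, h, lt_of_le_of_ne h1 ?_, h2⟩
  rintro rfl
  exact hm h.left_mem

/-- The vector of `a_P` whose tail sums agree with `w` on the boundaries of `P`, provided that `w`
vanishes at the end. -/
def interp (P : Composition n) (w : ℕ → ℝ) (x : Fin n) : ℝ :=
  (w (P.sizeUpTo (P.index x)) - w (P.sizeUpTo (P.index x + 1))) /
    ((P.sizeUpTo (P.index x + 1) : ℝ) - P.sizeUpTo (P.index x))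

theorem interp_mem (P : Composition n) (w : ℕ → ℝ) : interp P w ∈ aSpace P := by
  intro x y hxy
  simp only [interp, hxy]

theorem interp_eq_of_isBlock (h : IsBlock P i j) (w : ℕ → ℝ) {x : Fin n} (hix : (i : ℕ) ≤ x)
    (hxj : (x : ℕ) < j) : interp P w x = (w i - w j) / ((j : ℕ) - (i : ℕ)) := by
  have h1 := P.sizeUpTo_index_le x
  have h2 := P.lt_sizeUpTo_index_succ x
  have h3 := isBlock_of_index P x
  have h4 := h.le_or_le_nat h3.left_mem
  have h5 := h.le_or_le_nat h3.right_mem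
  have h6 := h3.le_or_le_nat h.left_mem
  have h7 := h3.le_or_le_nat h.right_mem
  simp only [Fin.val_succ] at h1 h2 h4 h5 h6 h7
  have e1 : P.sizeUpTo (P.index x) = i := by omega
  have e2 : P.sizeUpTo (P.index x + 1) = j := by omega
  rw [interp, e1, e2]

theorem interp_congr {w w' : ℕ → ℝ} (h : ∀ k ∈ P.boundaries, w k = w' k) :
    interp P w = interp P w' := by
  ext x
  obtain ⟨i, j, hB, h1, h2⟩ := exists_isBlock P x
  rw [interp_eq_of_isBlock hB w h1 h2, interp_eq_of_isBlock hB w' h1 h2, h i hB.left_mem,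
    h j hB.right_mem]

/-- The tail sums of a vector of `a_P` are linear along the blocks of `P`. -/
theorem tail_sub_tail_of_isBlock {H : Fin n → ℝ} (hH : H ∈ aSpace P) (h : IsBlock P i j) {x : Fin n}
    (hix : (i : ℕ) ≤ x) (hxj : (x : ℕ) < j) {m : ℕ} (him : (i : ℕ) ≤ m) (hmj : m ≤ (j : ℕ)) :
    tail H i - tail H m = ((m : ℝ) - (i : ℕ)) * H x := by
  rw [tail_sub_tail H him, ← Finset.sum_filter]
  have h1 : ∀ l ∈ Finset.univ.filter fun l : Fin n => (i : ℕ) ≤ (l : ℕ) ∧ (l : ℕ) < m,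
      H l = H x := by
    intro l hl
    have hl := (Finset.mem_filter.1 hl).2
    exact hH l x ((h.index_eq_iff hix hxj).2 ⟨hl.1, hl.2.trans_le hmj⟩)
  rw [Finset.sum_congr rfl h1, Finset.sum_const, nsmul_eq_mul]
  have hj := Nat.lt_succ_iff.1 j.2
  have h2 : (Finset.univ.filter fun l : Fin n => (i : ℕ) ≤ (l : ℕ) ∧ (l : ℕ) < m).card = m - i := by
    rw [← Nat.card_Ico, ← Finset.card_map Fin.valEmbedding]
    congr 1
    ext k
    simp only [Finset.mem_map, Finset.mem_filter, Finset.mem_univ, true_and, Fin.valEmbedding_apply,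
      Finset.mem_Ico]
    constructor
    · rintro ⟨l, h3, rfl⟩
      exact h3
    · intro h3
      exact ⟨⟨k, by omega⟩, h3, rfl⟩
  rw [h2, Nat.cast_sub him]

theorem eq_interp_tail {H : Fin n → ℝ} (hH : H ∈ aSpace P) : H = interp P (tail H) := by
  ext x
  obtain ⟨i, j, hB, h1, h2⟩ := exists_isBlock P x
  rw [interp_eq_of_isBlock hB _ h1 h2, tail_sub_tail_of_isBlock hH hB h1 h2 hB.lt_nat.le le_rfl,
    mul_div_cancel_left₀ _ hB.sub_pos.ne']

theorem tail_interp (P : Composition n) {w : ℕ → ℝ} (hw : w n = 0) (hi : i ∈ P.boundaries) :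
    tail (interp P w) i = w i := by
  induction hm : n - (i : ℕ) using Nat.strong_induction_on generalizing i with
  | _ m ih =>
    have hin := Nat.lt_succ_iff.1 i.2
    rcases hin.eq_or_lt with h | h
    · rw [tail_eq_zero _ h.ge, h, hw]
    · obtain ⟨j, hB⟩ := exists_isBlock_left hi h
      have hij := hB.lt_nat
      have h1 := ih (n - j) (by omega) hB.right_mem rfl
      have h2 := tail_sub_tail_of_isBlock (interp_mem P w) hB (x := ⟨i, h⟩) le_rfl hij hij.le le_rfl
      rw [interp_eq_of_isBlock hB w (x := ⟨i, h⟩) le_rfl hij,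
        mul_div_cancel₀ _ hB.sub_pos.ne'] at h2
      linarith

/-- The tail sums of a vector of `a_P` are bounded below by their values at the boundaries. -/
theorem le_tail {H : Fin n → ℝ} (hH : H ∈ aSpace P) {c : ℝ}
    (hc : ∀ k ∈ P.boundaries, c ≤ tail H k) {m : ℕ} (hm : m ≤ n) : c ≤ tail H m := by
  rcases hm.eq_or_lt with rfl | h
  · exact hc _ (last_mem_boundaries P)
  obtain ⟨i, j, hB, h1, h2⟩ := exists_isBlock P ⟨m, h⟩
  have e1 := tail_sub_tail_of_isBlock hH hB h1 h2 h1 h2.le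
  have e2 := tail_sub_tail_of_isBlock hH hB h1 h2 hB.lt_nat.le le_rfl
  have c1 := hc i hB.left_mem
  have c2 := hc j hB.right_mem
  have l1 : ((i : ℕ) : ℝ) ≤ (m : ℝ) := Nat.cast_le.2 h1
  have l2 : (m : ℝ) ≤ ((j : ℕ) : ℝ) := Nat.cast_le.2 h2.le
  rcases le_total 0 (H ⟨m, h⟩) with h3 | h3
  · nlinarith
  · nlinarith

/-- The difference of a vector and its projection to `a_Q`. -/
def traceless (Q : Composition n) (H : Fin n → ℝ) : Fin n → ℝ := H - interp Q (tail H)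

theorem tail_traceless (hi : i ∈ Q.boundaries) (H : Fin n → ℝ) : tail (traceless Q H) i = 0 := by
  rw [traceless, tail_sub, tail_interp Q (tail_eq_zero H le_rfl) hi, sub_self]

theorem aSpace_mono (hPQ : Q.boundaries ⊆ P.boundaries) : aSpace Q ≤ aSpace P := by
  intro H hH x y hxy
  refine hH x y (le_antisymm (not_lt.1 fun h => ?_) (not_lt.1 fun h => ?_)) <;>
  · obtain ⟨k, hk, h1, h2⟩ := (index_lt_iff Q).1 h
    have := (index_lt_iff P).2 ⟨k, hPQ hk, h1, h2⟩
    simp [hxy] at this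

theorem traceless_mem (hPQ : Q.boundaries ⊆ P.boundaries) {H : Fin n → ℝ} (hH : H ∈ aSpace P) :
    traceless Q H ∈ aSpace P := sub_mem hH (aSpace_mono hPQ (interp_mem Q _))

/-- The tail sums of the traceless part compare the tail sums of `H` with their chords. -/
theorem mul_tail_traceless (h : IsBlock Q i j) (H : Fin n → ℝ) {m : ℕ} (him : (i : ℕ) ≤ m)
    (hmj : m ≤ (j : ℕ)) : (((j : ℕ) : ℝ) - (i : ℕ)) * tail (traceless Q H) m =
      (tail H m - tail H j) * (m - (i : ℕ)) - (tail H i - tail H m) * ((j : ℕ) - m) := by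
  have hij := h.lt_nat
  have hn : (i : ℕ) < n := hij.trans_le (Nat.lt_succ_iff.1 j.2)
  have h1 := tail_sub_tail_of_isBlock (interp_mem Q (tail H)) h (x := ⟨i, hn⟩) le_rfl hij him hmj
  rw [interp_eq_of_isBlock h _ (x := ⟨i, hn⟩) le_rfl hij,
    tail_interp Q (tail_eq_zero H le_rfl) h.left_mem] at h1
  have h2 := h.sub_pos.ne'
  rw [traceless, tail_sub]
  have h3 : tail (interp Q (tail H)) m = tail H i -
      (m - (i : ℕ)) * ((tail H i - tail H j) / ((j : ℕ) - (i : ℕ))) := by linarith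
  rw [h3]
  field_simp
  ring

theorem fundWeight_dot_of_mem {V : Fin n → ℝ} (hV : V ∈ aSpace Q) (x : Fin n) :
    fundWeight Q x ⬝ᵥ V = 0 := by
  have h1 : ∀ l, fundWeight Q x l * V l =
      ((if Q.index l = Q.index x ∧ l ≤ x then 1 else 0) -
        (if Q.index l = Q.index x then 1 else 0) *
        ((Finset.card {m : Fin n | Q.index m = Q.index x ∧ m ≤ x} : ℝ) /
          (Finset.card {m : Fin n | Q.index m = Q.index x} : ℝ))) * V x := by
    intro l
    rw [fundWeight]
    by_cases h : Q.index l = Q.index x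
    · simp [h, hV l x h]
    · simp [h]
  have h2 : (Finset.card {m : Fin n | Q.index m = Q.index x} : ℝ) ≠ 0 := by
    exact_mod_cast (Finset.card_pos.2 ⟨x, by simp⟩).ne'
  rw [dotProduct, Finset.sum_congr rfl fun l _ => h1 l, ← Finset.sum_mul, Finset.sum_sub_distrib,
    ← Finset.sum_mul, Finset.sum_boole, Finset.sum_boole, mul_div_cancel₀ _ h2, sub_self, zero_mul]

/-- The fundamental weights of `M_Q` are, up to sign, the tail sums of the traceless part. -/
theorem fundWeight_dot (Q : Composition n) (H : Fin n → ℝ) (x : Fin n) :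
    fundWeight Q x ⬝ᵥ H = -tail (traceless Q H) (x + 1) := by
  have h0 : H = traceless Q H + interp Q (tail H) := by simp [traceless]
  conv_lhs => rw [h0, dotProduct_add, fundWeight_dot_of_mem (interp_mem Q _), add_zero]
  obtain ⟨i, j, hB, h1, h2⟩ := exists_isBlock Q x
  have e1 := tail_sub_tail (traceless Q H) (i := i) (j := x + 1) (by omega)
  have e2 := tail_sub_tail (traceless Q H) hB.lt_nat.le
  rw [tail_traceless hB.left_mem, zero_sub] at e1
  rw [tail_traceless hB.left_mem, tail_traceless hB.right_mem, sub_zero] at e2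
  have h3 : ∀ l, fundWeight Q x l * traceless Q H l =
      (if (i : ℕ) ≤ (l : ℕ) ∧ (l : ℕ) < x + 1 then traceless Q H l else 0) -
      ((Finset.card {m : Fin n | Q.index m = Q.index x ∧ m ≤ x} : ℝ) /
          (Finset.card {m : Fin n | Q.index m = Q.index x} : ℝ)) *
        (if (i : ℕ) ≤ (l : ℕ) ∧ (l : ℕ) < j then traceless Q H l else 0) := by
    intro l
    rw [fundWeight]
    by_cases h : (i : ℕ) ≤ (l : ℕ) ∧ (l : ℕ) < j
    · rw [if_pos ((hB.index_eq_iff h1 h2).2 h), if_pos h]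
      by_cases h' : l ≤ x
      · rw [if_pos h', if_pos ⟨h.1, Nat.lt_succ_of_le h'⟩]
        ring
      · rw [if_neg h', if_neg fun h4 => h' (Nat.lt_succ_iff.1 h4.2)]
        ring
    · rw [if_neg fun h4 => h ((hB.index_eq_iff h1 h2).1 h4), if_neg h,
        if_neg fun h4 => h ⟨h4.1, by omega⟩]
      ring
  rw [dotProduct, Finset.sum_congr rfl fun l _ => h3 l, Finset.sum_sub_distrib, ← Finset.mul_sum,
    ← e1, ← e2, mul_zero, sub_zero]

/-- On `a_P` the form `ρ_P^Q` is the sum of the fundamental weights of `M_Q`. -/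
theorem rho_dot (Q : Composition n) {H : Fin n → ℝ} (hH : H ∈ aSpace P) :
    rho P Q ⬝ᵥ H = -∑ x : Fin n, tail (traceless Q H) (x + 1) := by
  set K := traceless Q H with hK
  -- the pairs inside a block of `P` contribute `0`, and `H` may be replaced by its traceless part
  have h1 : rho P Q ⬝ᵥ H = (1 / 2 : ℝ) * ∑ x : Fin n, ∑ y : Fin n,
      if (x : ℕ) < y ∧ Q.index x = Q.index y then K x - K y else 0 := by
    rw [rho, smul_dotProduct, smul_eq_mul, sum_dotProduct, Finset.sum_filter,
      ← Fintype.sum_prod_type' (f := fun x y : Fin n =>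
        if (x : ℕ) < y ∧ Q.index x = Q.index y then K x - K y else 0)]
    congr 1
    refine Finset.sum_congr rfl fun x _ => ?_
    have hr : root x.1 x.2 ⬝ᵥ H = H x.1 - H x.2 := by
      simp [root, sub_dotProduct]
    rw [hr]
    by_cases hQ : Q.index x.1 = Q.index x.2
    · have hi := interp_mem Q (tail H) x.1 x.2 hQ
      have hKH : K x.1 - K x.2 = H x.1 - H x.2 := by
        simp only [hK, traceless, Pi.sub_apply, hi]
        ring
      by_cases h2 : P.index x.1 < P.index x.2
      · have h3 : (x.1 : ℕ) < x.2 := (index_mono P).reflect_lt h2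
        rw [if_pos ⟨h2, hQ⟩, if_pos ⟨h3, hQ⟩, hKH]
      · rw [if_neg fun h => h2 h.1]
        split_ifs with h4
        · have h5 : P.index x.1 = P.index x.2 :=
            le_antisymm (index_mono P (Fin.le_def.2 h4.1.le)) (not_lt.1 h2)
          rw [hKH, hH _ _ h5, sub_self]
        · rfl
    · rw [if_neg fun h => hQ h.2, if_neg fun h => hQ h.2]
  have h2 : ∀ y : Fin n, (∑ x : Fin n,
      if (x : ℕ) < y ∧ Q.index x = Q.index y then K x else 0) = -tail K y := by
    intro y
    obtain ⟨i, j, hB, h1, h2⟩ := exists_isBlock Q y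
    have e1 := tail_sub_tail K h1
    rw [tail_traceless hB.left_mem, zero_sub] at e1
    rw [e1]
    refine Finset.sum_congr rfl fun x _ => ?_
    refine if_congr ?_ rfl rfl
    rw [hB.index_eq_iff h1 h2]
    omega
  have h3 : ∀ x : Fin n, (∑ y : Fin n,
      if (x : ℕ) < y ∧ Q.index x = Q.index y then K y else 0) = tail K (x + 1) := by
    intro x
    obtain ⟨i, j, hB, h1, h2⟩ := exists_isBlock Q x
    have e1 := tail_sub_tail K (i := x + 1) (j := j) h2
    rw [tail_traceless hB.right_mem, sub_zero] at e1
    rw [e1]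
    refine Finset.sum_congr rfl fun y _ => ?_
    refine if_congr ?_ rfl rfl
    rw [eq_comm (a := Q.index x), hB.index_eq_iff h1 h2]
    omega
  have h4 : ∑ x : Fin n, (tail K x - tail K (x + 1)) = 0 := by
    have h5 : tail K 0 = 0 := tail_traceless (zero_mem_boundaries Q) H
    rw [Finset.sum_congr rfl fun x _ => tail_sub_tail_succ K x, ← h5, tail_eq]
    simp
  rw [Finset.sum_sub_distrib] at h4
  have h6 : (∑ x : Fin n, ∑ y : Fin n,
      if (x : ℕ) < y ∧ Q.index x = Q.index y then K x - K y else 0) =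
      ∑ y : Fin n, -tail K y - ∑ x : Fin n, tail K (x + 1) := by
    rw [← Finset.sum_congr rfl fun y _ => h2 y, ← Finset.sum_congr rfl fun x _ => h3 x,
      Finset.sum_comm (f := fun y x : Fin n =>
        if (x : ℕ) < y ∧ Q.index x = Q.index y then K x else 0), ← Finset.sum_sub_distrib]
    refine Finset.sum_congr rfl fun x _ => ?_
    rw [← Finset.sum_sub_distrib]
    refine Finset.sum_congr rfl fun y _ => ?_
    split_ifs <;> simp
  rw [h1, h6, Finset.sum_neg_distrib]
  linarith

/-- The cuts between `P` and `Q` are the boundaries of `P` that are not boundaries of `Q`. -/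
theorem isCut_iff {a b : Fin n} : IsCut P Q a b ↔
    (a : ℕ) + 1 = b ∧ b.castSucc ∈ P.boundaries ∧ b.castSucc ∉ Q.boundaries := by
  have key : ∀ R : Composition n, (a : ℕ) + 1 = b →
      (R.index a ≠ R.index b ↔ b.castSucc ∈ R.boundaries) := by
    intro R hab
    have hle : R.index a ≤ R.index b := index_mono R (Fin.le_def.2 (by omega))
    rw [← hle.lt_iff_ne, index_lt_iff]
    constructor
    · rintro ⟨k, hk, h1, h2⟩
      have : k = b.castSucc := Fin.ext (by simp; omega)
      exact this ▸ hk
    · intro h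
      exact ⟨_, h, by simp; omega, by simp⟩
  rw [IsCut]
  refine and_congr_right fun hab => ?_
  rw [key P hab, ← key Q hab, not_not]

theorem exists_cut {m : Fin (n + 1)} (hm : m ∈ P.boundaries) (hmQ : m ∉ Q.boundaries) :
    ∃ a b, IsCut P Q a b ∧ (b : ℕ) = m := by
  have h0 : (m : ℕ) ≠ 0 := fun h => hmQ ((Fin.ext h : m = 0) ▸ zero_mem_boundaries Q)
  have hn : (m : ℕ) ≠ n := fun h => hmQ ((Fin.ext h : m = Fin.last n) ▸ last_mem_boundaries Q)
  have hlt : (m : ℕ) < n := by omega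
  refine ⟨⟨m - 1, by omega⟩, ⟨m, hlt⟩, isCut_iff.2 ⟨?_, hm, hmQ⟩, rfl⟩
  simp only
  omega

/-- The cone of `τ_P^Q` in terms of tail sums. -/
theorem tau_cond_iff {H : Fin n → ℝ} (hH : H ∈ aSpace P) :
    (∀ α ∈ simpleRoots P Q, 0 < α ⬝ᵥ H) ↔ ∀ i m j, IsBlock P i m → IsBlock P m j →
      m ∉ Q.boundaries → (tail H m - tail H j) * ((m : ℕ) - (i : ℕ)) -
        (tail H i - tail H m) * ((j : ℕ) - (m : ℕ)) < 0 := by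
  have hr : ∀ a b : Fin n, root a b ⬝ᵥ H = H a - H b := by
    intro a b
    simp [root, sub_dotProduct]
  have key : ∀ i m j a b, IsBlock P i m → IsBlock P m j → IsCut P Q a b → (b : ℕ) = m →
      (0 < root a b ⬝ᵥ H ↔ (tail H m - tail H j) * ((m : ℕ) - (i : ℕ)) -
        (tail H i - tail H m) * ((j : ℕ) - (m : ℕ)) < 0) := by
    intro i m j a b h1 h2 hc hb
    have hab := hc.1
    have := h1.lt_nat
    have := h2.lt_nat
    rw [hr, tail_sub_tail_of_isBlock hH h1 (x := a) (by omega) (by omega) h1.lt_nat.le le_rfl,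
      tail_sub_tail_of_isBlock hH h2 (x := b) (by omega) (by omega) h2.lt_nat.le le_rfl]
    have p1 := h1.sub_pos
    have p2 := h2.sub_pos
    have : (((j : ℕ) : ℝ) - (m : ℕ)) * H b * ((m : ℕ) - (i : ℕ)) -
        (((m : ℕ) : ℝ) - (i : ℕ)) * H a * ((j : ℕ) - (m : ℕ)) =
        -((((j : ℕ) : ℝ) - (m : ℕ)) * ((m : ℕ) - (i : ℕ)) * (H a - H b)) := by ring
    rw [this, neg_lt_zero, mul_pos_iff_of_pos_left (mul_pos p2 p1)]
  constructor
  · intro h i m j h1 h2 hm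
    obtain ⟨a, b, hc, hb⟩ := exists_cut h2.left_mem hm
    exact (key i m j a b h1 h2 hc hb).1 (h _ ⟨a, b, hc, rfl⟩)
  · rintro h _ ⟨a, b, hc, rfl⟩
    obtain ⟨h1, h2, h3⟩ := isCut_iff.1 hc
    obtain ⟨i, hi⟩ := exists_isBlock_right h2 (by simp; omega)
    obtain ⟨j, hj⟩ := exists_isBlock_left h2 (by simp)
    exact (key i _ j a b hi hj hc rfl).2 (h _ _ _ hi hj h3)

/-- The cone of `τ̂_P^Q` in terms of tail sums. -/
theorem tauHat_cond_iff (H : Fin n → ℝ) :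
    (∀ w ∈ simpleWeights P Q, 0 < w ⬝ᵥ H) ↔
      ∀ m ∈ P.boundaries, m ∉ Q.boundaries → tail (traceless Q H) m < 0 := by
  constructor
  · intro h m hm hmQ
    obtain ⟨a, b, hc, hb⟩ := exists_cut hm hmQ
    have := h _ ⟨a, b, hc, rfl⟩
    rwa [fundWeight_dot, hc.1, hb, Left.neg_pos_iff] at this
  · rintro h _ ⟨a, b, hc, rfl⟩
    obtain ⟨h1, h2, h3⟩ := isCut_iff.1 hc
    rw [fundWeight_dot, h1, Left.neg_pos_iff]
    exact h _ h2 h3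

/-- The dimension of `a_P` is the number of blocks of `P`. -/
theorem finrank_aSpace (P : Composition n) :
    Module.finrank ℝ (aSpace P) + 1 = P.boundaries.card := by
  rw [P.card_boundaries_eq_succ_length]
  have hemb : ∀ b : Fin P.length, ∃ x, P.index x = b :=
    fun b => ⟨P.embedding b ⟨0, P.one_le_blocksFun b⟩, P.index_embedding _ _⟩
  choose r hr using hemb
  let e : aSpace P ≃ₗ[ℝ] (Fin P.length → ℝ) :=
    { toFun := fun H b => H.1 (r b)
      map_add' := fun _ _ => rfl
      map_smul' := fun _ _ => rfl
      invFun := fun c => ⟨fun x => c (P.index x), fun x y h => by simp only [h]⟩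
      left_inv := fun H => Subtype.ext (funext fun x => H.2 _ _ (hr _))
      right_inv := fun c => funext fun b => by simp only [hr] }
  rw [e.finrank_eq, Module.finrank_fintype_fun_eq_card, Fintype.card_fin]

theorem eps_eq (P Q : Composition n) :
    eps P Q = (-1) ^ (P.boundaries.card + Q.boundaries.card) := by
  rw [← finrank_aSpace P, ← finrank_aSpace Q, eps, Int.negOnePow_sub, Int.negOnePow_def,
    Int.negOnePow_def]
  rw [show Module.finrank ℝ (aSpace P) + 1 + (Module.finrank ℝ (aSpace Q) + 1) =
    Module.finrank ℝ (aSpace P) + Module.finrank ℝ (aSpace Q) + 2 by ring, pow_add, pow_add]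
  simp

end Tail

/-! ### Parabolic subgroups and flags -/

section Flag

variable {F : Type*} [Field F] {n : ℕ} {P Q : Composition n} {δ δ' : GL (Fin n) F}

theorem mem_parabolic_iff {R : Type*} [CommRing R] {p : GL (Fin n) R} :
    p ∈ parabolic R P ↔ ∀ i ∈ P.boundaries, p ∈ lowParabolic R n i := by
  constructor
  · exact fun hp i hi => parabolic_le_lowParabolic P hi hp
  · intro h a b hab
    obtain ⟨i, hi, h1, h2⟩ := (index_lt_iff P).1 hab
    exact mem_lowParabolic.1 (h i hi) a b h2 h1

theorem parabolic_le_iff : parabolic F P ≤ parabolic F Q ↔ Q.boundaries ⊆ P.boundaries := by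
  constructor
  · intro h k hk
    by_contra hkP
    -- an elementary matrix of `P` that mixes two blocks of `Q`
    obtain ⟨a, b, hc, hb⟩ := exists_cut hk hkP
    have hab : b ≠ a := fun h => by have := hc.1; omega
    have hdet : (transvection b a (1 : F)).det ≠ 0 := by
      rw [det_transvection_of_ne _ _ hab]
      exact one_ne_zero
    have ht : ∀ x y, transvection b a (1 : F) x y =
        (if x = y then 1 else 0) + if b = x ∧ a = y then 1 else 0 := by
      intro x y
      rw [transvection, Matrix.add_apply, Matrix.one_apply, Matrix.single_apply]
    have hP : Matrix.GeneralLinearGroup.mkOfDetNeZero _ hdet ∈ parabolic F P := by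
      intro x y hxy
      change transvection b a (1 : F) x y = 0
      rw [ht, if_neg, if_neg, add_zero]
      · rintro ⟨rfl, rfl⟩
        exact hxy.ne hc.2.2
      · rintro rfl
        exact hxy.false
    have hlt : Q.index a < Q.index b :=
      lt_of_le_of_ne (index_mono Q (Fin.le_def.2 (by have := hc.1; omega))) hc.2.1
    have h0 : transvection b a (1 : F) b a = 0 := h hP hlt
    rw [ht, if_neg hab, if_pos ⟨rfl, rfl⟩, zero_add] at h0
    exact one_ne_zero h0
  · intro h p hp
    rw [mem_parabolic_iff] at *
    exact fun i hi => hp i (h hi)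

theorem mul_inv_mem_parabolic (h : ∀ i ∈ P.boundaries, rowSpan δ' i = rowSpan δ i) :
    δ' * δ⁻¹ ∈ parabolic F P :=
  mem_parabolic_iff.2 fun i hi => mul_inv_mem_lowParabolic (h i hi).le

theorem rowSpan_mul_of_mem {q : GL (Fin n) F} (hq : q ∈ parabolic F P) (δ : GL (Fin n) F)
    {i : Fin (n + 1)} (hi : i ∈ P.boundaries) : rowSpan (q * δ) i = rowSpan δ i :=
  rowSpan_mul (mem_parabolic_iff.1 hq i hi) δ

theorem finrank_rowSpan_fin (δ : GL (Fin n) F) (i : Fin (n + 1)) :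
    Module.finrank F (rowSpan δ i) = n - i := finrank_rowSpan δ (Nat.lt_succ_iff.1 i.2)

theorem rowSpan_le_iff (δ : GL (Fin n) F) {i j : Fin (n + 1)} :
    rowSpan δ j ≤ rowSpan δ i ↔ i ≤ j := by
  refine ⟨fun h => ?_, fun h => rowSpan_antitone δ (Fin.le_def.1 h)⟩
  have h1 := Submodule.finrank_mono h
  rw [finrank_rowSpan_fin, finrank_rowSpan_fin] at h1
  exact Fin.le_def.2 (by omega)

theorem rowSpan_lt_iff (δ : GL (Fin n) F) {i j : Fin (n + 1)} :
    rowSpan δ j < rowSpan δ i ↔ i < j := by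
  rw [lt_iff_le_not_ge, rowSpan_le_iff, rowSpan_le_iff, lt_iff_le_not_ge]

theorem eq_of_rowSpan_eq {i j : Fin (n + 1)} (h : rowSpan δ i = rowSpan δ' j) : i = j := by
  have h1 := finrank_rowSpan_fin δ i
  rw [h, finrank_rowSpan_fin] at h1
  exact Fin.ext (by omega)

open Classical in
/-- The flag stabilized by the conjugate of the parabolic subgroup `P` by `δ⁻¹`: the spans of the
rows of `δ` from each boundary of `P` on. -/
def flag (P : Composition n) (δ : GL (Fin n) F) : Finset (Submodule F (Fin n → F)) :=
  P.boundaries.image fun i : Fin (n + 1) => rowSpan δ i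

theorem mem_flag {W : Submodule F (Fin n → F)} :
    W ∈ flag P δ ↔ ∃ i ∈ P.boundaries, rowSpan δ i = W := by
  simp [flag]

theorem rowSpan_mem_flag_iff {i : Fin (n + 1)} : rowSpan δ i ∈ flag P δ ↔ i ∈ P.boundaries := by
  rw [mem_flag]
  constructor
  · rintro ⟨j, hj, h⟩
    exact eq_of_rowSpan_eq h ▸ hj
  · exact fun h => ⟨i, h, rfl⟩

theorem isFlag_flag (P : Composition n) (δ : GL (Fin n) F) : IsFlag (flag P δ) := by
  refine ⟨?_, mem_flag.2 ⟨_, last_mem_boundaries P, rowSpan_self δ⟩,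
    mem_flag.2 ⟨_, zero_mem_boundaries P, rowSpan_zero δ⟩⟩
  intro W hW W' hW' _
  obtain ⟨i, -, rfl⟩ := mem_flag.1 hW
  obtain ⟨j, -, rfl⟩ := mem_flag.1 hW'
  simp only [rowSpan_le_iff]
  exact le_total j i

theorem card_flag (P : Composition n) (δ : GL (Fin n) F) :
    (flag P δ).card = P.boundaries.card :=
  Finset.card_image_of_injective _ fun _ _ h => eq_of_rowSpan_eq h

theorem consec_flag_iff {A B : Submodule F (Fin n → F)} : Consec (flag P δ) A B ↔
    ∃ i j, IsBlock P i j ∧ A = rowSpan δ j ∧ B = rowSpan δ i := by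
  constructor
  · rintro ⟨hA, hB, h1, h2⟩
    obtain ⟨j, hj, rfl⟩ := mem_flag.1 hA
    obtain ⟨i, hi, rfl⟩ := mem_flag.1 hB
    refine ⟨i, j, ⟨hi, hj, (rowSpan_lt_iff δ).1 h1, fun k hk => ?_⟩, rfl, rfl⟩
    by_contra! h3
    exact h2 _ (rowSpan_mem_flag_iff.2 hk) ⟨(rowSpan_lt_iff δ).2 h3.2, (rowSpan_lt_iff δ).2 h3.1⟩
  · rintro ⟨i, j, h, rfl, rfl⟩
    refine ⟨rowSpan_mem_flag_iff.2 h.right_mem, rowSpan_mem_flag_iff.2 h.left_mem,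
      (rowSpan_lt_iff δ).2 h.lt, fun X hX hx => ?_⟩
    obtain ⟨k, hk, rfl⟩ := mem_flag.1 hX
    rw [rowSpan_lt_iff, rowSpan_lt_iff] at hx
    rcases h.le_or_le k hk with h1 | h1
    · exact (hx.2.trans_le h1).false
    · exact (hx.1.trans_le h1).false

theorem flag_mul {q : GL (Fin n) F} (hq : q ∈ parabolic F P) (δ : GL (Fin n) F) :
    flag P (q * δ) = flag P δ := by
  unfold flag
  exact Finset.image_congr fun i hi => rowSpan_mul_of_mem hq δ hi

theorem flag_subset_flag (hPQ : Q.boundaries ⊆ P.boundaries) (δ : GL (Fin n) F) :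
    flag Q δ ⊆ flag P δ := by
  unfold flag
  exact Finset.image_subset_image hPQ

theorem flag_subset_flag_iff : flag Q δ' ⊆ flag P δ ↔
    Q.boundaries ⊆ P.boundaries ∧ ∀ i ∈ Q.boundaries, rowSpan δ i = rowSpan δ' i := by
  constructor
  · intro h
    have key : ∀ i ∈ Q.boundaries, i ∈ P.boundaries ∧ rowSpan δ i = rowSpan δ' i := by
      intro i hi
      obtain ⟨j, hj, h1⟩ := mem_flag.1 (h (rowSpan_mem_flag_iff.2 hi))
      obtain rfl := eq_of_rowSpan_eq h1
      exact ⟨hj, h1⟩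
    exact ⟨fun i hi => (key i hi).1, fun i hi => (key i hi).2⟩
  · rintro ⟨h1, h2⟩ W hW
    obtain ⟨i, hi, rfl⟩ := mem_flag.1 hW
    exact mem_flag.2 ⟨i, h1 hi, h2 i hi⟩

theorem eq_of_flag_eq (h : flag P δ = flag Q δ') : P = Q :=
  boundaries_injective (subset_antisymm (flag_subset_flag_iff.1 h.le).1
    (flag_subset_flag_iff.1 h.ge).1)

theorem exists_flag_eq {C : Finset (Submodule F (Fin n → F))} (hC : IsFlag C) :
    ∃ (P : Composition n) (δ : GL (Fin n) F), flag P δ = C := by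
  classical
  obtain ⟨δ, hδ⟩ := exists_adapted C hC
  let c : Submodule F (Fin n → F) → Fin (n + 1) := fun W =>
    ⟨n - Module.finrank F W, Nat.lt_succ_iff.2 (Nat.sub_le _ _)⟩
  obtain ⟨P, hP⟩ := exists_boundaries_eq (C.image c)
    (Finset.mem_image.2 ⟨⊤, hC.top_mem, Fin.ext (by simp [c])⟩)
    (Finset.mem_image.2 ⟨⊥, hC.bot_mem, Fin.ext (by simp [c])⟩)
  refine ⟨P, δ, ?_⟩
  ext W
  rw [mem_flag, hP]
  constructor
  · rintro ⟨i, hi, rfl⟩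
    obtain ⟨W, hW, rfl⟩ := Finset.mem_image.1 hi
    rwa [show rowSpan δ (c W) = W from hδ W hW]
  · exact fun hW => ⟨c W, Finset.mem_image_of_mem c hW, hδ W hW⟩

/-- Every flag that refines the flag of `P` and `δ` comes from a parabolic subgroup contained in `P`
and an element of `P(F) δ`. -/
theorem exists_flag_refining {C : Finset (Submodule F (Fin n → F))} (hC : IsFlag C)
    (h : flag Q δ ⊆ C) : ∃ (P : Composition n) (q : GL (Fin n) F), Q.boundaries ⊆ P.boundaries ∧
      q ∈ parabolic F Q ∧ flag P (q * δ) = C := by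
  obtain ⟨P, δ', rfl⟩ := exists_flag_eq hC
  obtain ⟨h1, h2⟩ := flag_subset_flag_iff.1 h
  exact ⟨P, δ' * δ⁻¹, h1, mul_inv_mem_parabolic h2, by rw [inv_mul_cancel_right]⟩

/-- Summation over the elements of `P(F) \ Q(F)`, for all `P ⊂ Q`, amounts to summation over the
flags that refine the flag of `Q`. -/
theorem sum_leftQuot (Q : Composition n) (s : ∀ P : Composition n, LeftQuot F P Q → parabolic F Q)
    (hs : ∀ P x, Quotient.mk _ (s P x) = x) (ψ : ∀ P : Composition n, LeftQuot F P Q → ℤ)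
    (φ : Finset (Submodule F (Fin n → F)) → ℤ)
    (hψ : ∀ P, Q.boundaries ⊆ P.boundaries → ∀ x, ψ P x = φ (flag P (s P x).1))
    (S : Finset (Finset (Submodule F (Fin n → F)))) (hS : ∀ C ∈ S, IsFlag C ∧ flag Q 1 ⊆ C)
    (hφ : ∀ C, IsFlag C → flag Q 1 ⊆ C → φ C ≠ 0 → C ∈ S) :
    (∀ P ∈ below F Q, {x | ψ P x ≠ 0}.Finite) ∧
      ∑ P ∈ below F Q, ∑ᶠ x, ψ P x = ∑ C ∈ S, φ C := by
  classical
  have hmem : ∀ P, P ∈ below F Q ↔ Q.boundaries ⊆ P.boundaries := by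
    intro P
    simp [below, parabolic_le_iff]
  have hinj : ∀ P, Function.Injective fun x : LeftQuot F P Q => flag P (s P x).1 := by
    intro P x y hxy
    have h1 := mul_inv_mem_parabolic (flag_subset_flag_iff.1 hxy.le).2
    rw [← hs P x, ← hs P y]
    refine Quotient.sound (QuotientGroup.rightRel_apply.2 ?_)
    exact h1
  have hU : ∀ P, Q.boundaries ⊆ P.boundaries → ∀ x, flag Q 1 ⊆ flag P (s P x).1 := by
    intro P hP x
    have h1 := flag_mul (s P x).2 1
    rw [mul_one] at h1
    rw [← h1]
    exact flag_subset_flag hP _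
  have hsurj : ∀ C, IsFlag C → flag Q 1 ⊆ C →
      ∃ P, Q.boundaries ⊆ P.boundaries ∧ ∃ x, flag P (s P x).1 = C := by
    intro C hC hUC
    obtain ⟨P, q, hP, hq, h1⟩ := exists_flag_refining hC hUC
    rw [mul_one] at h1
    refine ⟨P, hP, Quotient.mk _ ⟨q, hq⟩, ?_⟩
    have h2 := QuotientGroup.rightRel_apply.1 (Quotient.exact (hs P (Quotient.mk _ ⟨q, hq⟩)))
    have h3 : q * ((s P (Quotient.mk _ ⟨q, hq⟩)).1)⁻¹ ∈ parabolic F P := h2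
    rw [← h1, ← flag_mul h3, inv_mul_cancel_right]
  have hT : ∀ P, {x | flag P (s P x).1 ∈ S}.Finite :=
    fun P => S.finite_toSet.preimage (hinj P).injOn
  have hsupp : ∀ P ∈ below F Q, Function.support (ψ P) ⊆ {x | flag P (s P x).1 ∈ S} := by
    intro P hP x hx
    rw [hmem] at hP
    refine hφ _ (isFlag_flag _ _) (hU P hP x) ?_
    rw [← hψ P hP]
    exact hx
  refine ⟨fun P hP => (hT P).subset (hsupp P hP), ?_⟩
  choose! t ht using hsurj
  have htype : ∀ P, Q.boundaries ⊆ P.boundaries → ∀ x, t (flag P (s P x).1) = P := by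
    intro P hP x
    obtain ⟨-, y, hy⟩ := ht _ (isFlag_flag _ _) (hU P hP x)
    exact eq_of_flag_eq hy
  rw [← Finset.sum_fiberwise_of_maps_to (s := S) (t := below F Q) (g := t)
    fun C hC => (hmem _).2 (ht C (hS C hC).1 (hS C hC).2).1]
  refine Finset.sum_congr rfl fun P hP => ?_
  have hP' := (hmem P).1 hP
  rw [finsum_eq_sum_of_support_subset (s := (hT P).toFinset) _ (by simpa using hsupp P hP)]
  refine Finset.sum_nbij (fun x => flag P (s P x).1) ?_ (hinj P).injOn ?_ ?_
  · intro x hx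
    exact Finset.mem_filter.2 ⟨(Set.Finite.mem_toFinset (hT P)).1 hx, htype P hP' x⟩
  · intro C hC
    obtain ⟨h1, h2⟩ := Finset.mem_filter.1 hC
    obtain ⟨-, x, hx⟩ := ht C (hS C h1).1 (hS C h1).2
    subst h2
    refine ⟨x, (Set.Finite.mem_toFinset (hT _)).2 ?_, hx⟩
    change flag (t C) (s (t C) x).1 ∈ S
    rwa [hx]
  · exact fun x _ => hψ P hP' x

end Flag

/-! ### The truncation functions in terms of flags -/

section Translate

variable {F : Type*} [Field F] [NumberField F] {n : ℕ} {P Q : Composition n}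
  (g : GL (Fin n) (AdeleRing (𝓞 F) F)) (δ : GL (Fin n) F)

theorem tail_HC {i : Fin (n + 1)} (hi : i ∈ P.boundaries) :
    tail (HC P (diag δ * g)) i = height g (rowSpan δ i) := by
  rw [height_rowSpan g δ (Nat.lt_succ_iff.1 i.2)]
  exact sum_HC P _ hi

theorem defect_rowSpan {i m j : Fin (n + 1)} (hi : i ∈ P.boundaries) (hm : m ∈ P.boundaries)
    (hj : j ∈ P.boundaries) :
    (slopeLattice g).defect (rowSpan δ j) (rowSpan δ m) (rowSpan δ i) =
      (tail (HC P (diag δ * g)) m - tail (HC P (diag δ * g)) j) * ((m : ℕ) - (i : ℕ)) -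
        (tail (HC P (diag δ * g)) i - tail (HC P (diag δ * g)) m) * ((j : ℕ) - (m : ℕ)) := by
  have hrk : ∀ i : Fin (n + 1), (slopeLattice g).rk (rowSpan δ i) = n - (i : ℕ) := by
    intro i
    change (Module.finrank F (rowSpan δ i) : ℝ) = _
    rw [finrank_rowSpan_fin, Nat.cast_sub (Nat.lt_succ_iff.1 i.2)]
  rw [SlopeLattice.defect, hrk, hrk, hrk, tail_HC g δ hi, tail_HC g δ hm, tail_HC g δ hj]
  change (height g _ - height g _) * _ - (height g _ - height g _) * _ = _
  ring

/-- The traceless tail sums have the sign of the defects with respect to the flag of `Q`. -/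
theorem mul_tail_traceless_HC (hPQ : Q.boundaries ⊆ P.boundaries) {i m j : Fin (n + 1)}
    (h : IsBlock Q i j) (him : i ≤ m) (hmj : m ≤ j) (hm : m ∈ P.boundaries) :
    (((j : ℕ) : ℝ) - (i : ℕ)) * tail (traceless Q (HC P (diag δ * g))) m =
      (slopeLattice g).defect (rowSpan δ j) (rowSpan δ m) (rowSpan δ i) := by
  rw [mul_tail_traceless h _ him hmj, defect_rowSpan g δ (hPQ h.left_mem) hm (hPQ h.right_mem)]

theorem tau_eq [Decidable ((slopeLattice g).StrictlyConvex (flag Q δ) (flag P δ))] :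
    tau P Q (HC P (diag δ * g)) =
      if (slopeLattice g).StrictlyConvex (flag Q δ) (flag P δ) then 1 else 0 := by
  classical
  rw [tau]
  refine if_congr ?_ rfl rfl
  rw [tau_cond_iff (HC_mem_aSpace P _)]
  constructor
  · intro h A W B h1 h2 hW
    obtain ⟨m, j, hB, rfl, rfl⟩ := consec_flag_iff.1 h1
    obtain ⟨i, m', hB', h3, rfl⟩ := consec_flag_iff.1 h2
    obtain rfl := eq_of_rowSpan_eq h3
    rw [defect_rowSpan g δ hB'.left_mem hB.left_mem hB.right_mem]
    exact h i m j hB' hB fun hm => hW (rowSpan_mem_flag_iff.2 hm)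
  · intro h i m j h1 h2 hm
    rw [← defect_rowSpan g δ h1.left_mem h1.right_mem h2.right_mem]
    exact h _ _ _ (consec_flag_iff.2 ⟨m, j, h2, rfl, rfl⟩) (consec_flag_iff.2 ⟨i, m, h1, rfl, rfl⟩)
      fun hW => hm (rowSpan_mem_flag_iff.1 hW)

theorem tauHat_eq (hPQ : Q.boundaries ⊆ P.boundaries)
    [Decidable ((slopeLattice g).Below (flag Q δ) (flag P δ))] :
    tauHat P Q (HC P (diag δ * g)) =
      if (slopeLattice g).Below (flag Q δ) (flag P δ) then 1 else 0 := by
  classical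
  rw [tauHat]
  refine if_congr ?_ rfl rfl
  rw [tauHat_cond_iff]
  constructor
  · intro h A B hAB W hW hAW hWB
    obtain ⟨i, j, hB, rfl, rfl⟩ := consec_flag_iff.1 hAB
    obtain ⟨m, hm, rfl⟩ := mem_flag.1 hW
    rw [rowSpan_lt_iff] at hAW hWB
    rw [← mul_tail_traceless_HC g δ hPQ hB hWB.le hAW.le hm]
    refine mul_neg_of_pos_of_neg hB.sub_pos (h m hm fun hmQ => ?_)
    rcases hB.le_or_le m hmQ with h1 | h1
    · exact (hWB.trans_le h1).false
    · exact (hAW.trans_le h1).false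
  · intro h m hm hmQ
    obtain ⟨i, j, hB, h1, h2⟩ := exists_isBlock_of_notMem hmQ
    have h3 := h _ _ (consec_flag_iff.2 ⟨i, j, hB, rfl, rfl⟩) _ (rowSpan_mem_flag_iff.2 hm)
      ((rowSpan_lt_iff δ).2 h2) ((rowSpan_lt_iff δ).2 h1)
    rw [← mul_tail_traceless_HC g δ hPQ hB h1.le h2.le hm] at h3
    exact neg_of_mul_neg_right h3 hB.sub_pos.le

theorem mem_degSet {r : ℝ} : r ∈ degSet Q (diag δ * g) ↔
    ∃ P : Composition n, Q.boundaries ⊆ P.boundaries ∧ ∃ q ∈ parabolic F Q,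
      r = -∑ x : Fin n, tail (traceless Q (HC P (diag (q * δ) * g))) (x + 1) := by
  simp only [degSet, Set.mem_ofPred_eq, parabolic_le_iff, ← mul_assoc, ← diag_mul,
    rho_dot Q (HC_mem_aSpace _ _)]

theorem exists_le_height : ∃ M : ℝ, 0 ≤ M ∧ ∀ W : Submodule F (Fin n → F), -M ≤ height g W := by
  obtain ⟨M, hM⟩ := ((finite_height_le g 0).image (height g)).bddBelow
  refine ⟨|M|, abs_nonneg M, fun W => ?_⟩
  by_cases hW : height g W ≤ 0
  · exact (neg_abs_le M).trans (hM ⟨W, hW, rfl⟩)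
  · exact (neg_nonpos.2 (abs_nonneg M)).trans (not_le.1 hW).le

/-- The degree of instability takes only finitely many nonnegative values: for these, the heights of
the subspaces in the flag are bounded above, and there are finitely many such subspaces. -/
theorem finite_nonneg_degSet (Q : Composition n) : {r ∈ degSet Q g | 0 ≤ r}.Finite := by
  obtain ⟨M, hM0, hM⟩ := exists_le_height g
  let c : Fin n → ℝ := interp Q fun k => height g (rowSpan 1 k)
  let b : ℝ := max (∑ x : Fin n, tail c (x + 1) + n * M) (height g (rowSpan 1 0))
  let V : Set ℝ := insert 0 (height g '' {W | height g W ≤ b})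
  have hV : V.Finite := ((finite_height_le g b).image _).insert 0
  let w' : (Fin (n + 1) → ℝ) → ℕ → ℝ := fun w k => if h : k < n + 1 then w ⟨k, h⟩ else 0
  refine Set.Finite.subset (((Set.finite_univ (α := Composition n)).prod
    (Set.Finite.pi' (ι := Fin (n + 1)) fun _ => hV)).image
      fun p => rho p.1 Q ⬝ᵥ interp p.1 (w' p.2)) ?_
  classical
  rintro r ⟨hr, hr0⟩
  have hg : diag (1 : GL (Fin n) F) * g = g := by rw [diag, map_one, one_mul]
  rw [← hg, mem_degSet] at hr
  obtain ⟨P, hPQ, q, hq, hr⟩ := hr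
  rw [mul_one] at hr
  set H := HC P (diag q * g) with hH
  have hHP : H ∈ aSpace P := HC_mem_aSpace P _
  have htail : ∀ i ∈ P.boundaries, tail H i = height g (rowSpan q i) := fun i hi => tail_HC g q hi
  -- the chords only depend on the flag of `Q`, which `q` preserves
  have hc : interp Q (tail H) = c := by
    refine interp_congr fun k hk => ?_
    rw [htail k (hPQ hk)]
    have := rowSpan_mul_of_mem hq 1 hk
    rw [mul_one] at this
    rw [this]
  have hlow : ∀ m ≤ n, -M ≤ tail H m := fun m hm =>
    le_tail hHP (fun k hk => (hM _).trans (htail k hk).ge) hm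
  have hb : ∀ i ∈ P.boundaries, height g (rowSpan q i) ≤ b := by
    intro i hi
    rcases Fin.eq_zero_or_eq_succ i with rfl | ⟨x, rfl⟩
    · refine le_of_eq_of_le ?_ (le_max_right _ _)
      simp only [Fin.val_zero, rowSpan_zero]
    · refine le_trans ?_ (le_max_left _ _)
      rw [← htail _ hi]
      simp only [traceless, tail_sub, hc, Finset.sum_sub_distrib] at hr
      have h1 : tail H (x + 1) + M ≤ ∑ y : Fin n, (tail H (y + 1) + M) :=
        Finset.single_le_sum (f := fun y : Fin n => tail H (y + 1) + M)
          (fun y _ => by have := hlow (y + 1) y.2; linarith) (Finset.mem_univ x)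
      rw [Finset.sum_add_distrib, Finset.sum_const, Finset.card_univ, Fintype.card_fin,
        nsmul_eq_mul] at h1
      rw [Fin.val_succ]
      linarith
  let w : Fin (n + 1) → ℝ := fun i => if i ∈ P.boundaries then tail H i else 0
  refine ⟨(P, w), ⟨Set.mem_univ _, fun i => ?_⟩, ?_⟩
  · by_cases hi : i ∈ P.boundaries
    · simp only [w, if_pos hi]
      exact Or.inr ⟨_, hb i hi, (htail i hi).symm⟩
    · simp only [w, if_neg hi]
      exact Or.inl rfl
  · have h1 : interp P (w' w) = H := by
      conv_rhs => rw [eq_interp_tail hHP]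
      refine interp_congr fun k hk => ?_
      simp only [w', w, dif_pos k.2]
      rw [if_pos hk]
    simp only [h1]
    rw [hr, rho_dot Q hHP]

theorem isGreatest_degI (Q : Composition n) : IsGreatest (degSet Q g) (degI Q g) := by
  have h0 : (0 : ℝ) ∈ degSet Q g := by
    refine ⟨Q, le_rfl, 1, one_mem _, ?_⟩
    rw [rho_dot Q (HC_mem_aSpace _ _), Finset.sum_eq_zero, neg_zero]
    intro x _
    have h1 : traceless Q (HC Q (diag 1 * g)) = 0 :=
      sub_eq_zero.2 (eq_interp_tail (HC_mem_aSpace _ _))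
    rw [h1]
    simp [tail]
  obtain ⟨a, ha, hmax⟩ := Set.exists_max_image _ id (finite_nonneg_degSet g Q) ⟨0, h0, le_rfl⟩
  have hgr : IsGreatest (degSet Q g) a := by
    refine ⟨ha.1, fun r hr => ?_⟩
    rcases le_total 0 r with h | h
    · exact hmax r ⟨hr, h⟩
    · exact h.trans ha.2
  rw [degI, hgr.csSup_eq]
  exact hgr

/-- The truncation function is the characteristic function of the semistability of the flag. -/
theorem degI_nonpos_iff : degI Q (diag δ * g) ≤ 0 ↔ (slopeLattice g).Semistable (flag Q δ) := by
  classical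
  have hgr := isGreatest_degI (diag δ * g) Q
  constructor
  · intro hle A B hAB W hAW hWB
    by_contra! hneg
    -- the one-step refinement of the flag by `W` has positive degree
    obtain ⟨P, q, hPQ, hq, hflag⟩ := exists_flag_refining
      (isFlag_insert (isFlag_flag Q δ) hAB hAW hWB) (Finset.subset_insert W _)
    obtain ⟨i, j, hB, rfl, rfl⟩ := consec_flag_iff.1 hAB
    have hWmem : W ∈ flag P (q * δ) := hflag ▸ Finset.mem_insert_self _ _
    obtain ⟨m, hm, rfl⟩ := mem_flag.1 hWmem
    rw [← rowSpan_mul_of_mem hq δ hB.left_mem, ← rowSpan_mul_of_mem hq δ hB.right_mem] at hneg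
    rw [← rowSpan_mul_of_mem hq δ hB.right_mem, rowSpan_lt_iff] at hAW
    rw [← rowSpan_mul_of_mem hq δ hB.left_mem, rowSpan_lt_iff] at hWB
    rw [← mul_tail_traceless_HC g _ hPQ hB hWB.le hAW.le hm] at hneg
    set K := traceless Q (HC P (diag (q * δ) * g)) with hK
    have hKm : tail K m < 0 := neg_of_mul_neg_right hneg hB.sub_pos.le
    have hKP : K ∈ aSpace P := traceless_mem hPQ (HC_mem_aSpace P _)
    -- `W` is the only vertex of the refinement outside the flag, so `-K` is nonnegative at all knots
    have hall : ∀ k ∈ P.boundaries, 0 ≤ tail (-K) k := by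
      intro k hk
      rw [tail_neg, neg_nonneg]
      by_cases hkQ : k ∈ Q.boundaries
      · exact (tail_traceless hkQ _).le
      · have h1 : rowSpan (q * δ) k ∈ flag P (q * δ) := rowSpan_mem_flag_iff.2 hk
        rw [hflag, Finset.mem_insert] at h1
        rcases h1 with h1 | h1
        · rw [eq_of_rowSpan_eq h1]
          exact hKm.le
        · rw [← flag_mul hq δ] at h1
          exact absurd (rowSpan_mem_flag_iff.1 h1) hkQ
    have hpos : ∀ m ≤ n, 0 ≤ tail (-K) m := fun m hm => le_tail (neg_mem hKP) hall hm
    have hr := hgr.2 ((mem_degSet g δ).2 ⟨P, hPQ, q, hq, rfl⟩)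
    rw [← hK, ← Finset.sum_neg_distrib] at hr
    simp only [← tail_neg] at hr
    obtain ⟨x, hx⟩ : ∃ x : Fin n, (x : ℕ) + 1 = m := by
      have h1 := Fin.lt_def.1 hWB
      exact ⟨⟨m - 1, by omega⟩, by simp only; omega⟩
    have h2 := Finset.single_le_sum (f := fun x : Fin n => tail (-K) (x + 1))
      (fun y _ => hpos _ y.2) (Finset.mem_univ x)
    simp only [hx] at h2
    rw [tail_neg] at h2
    linarith
  · intro hss
    obtain ⟨P, hPQ, q, hq, hr⟩ := (mem_degSet g δ).1 hgr.1
    rw [hr, neg_nonpos]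
    refine Finset.sum_nonneg fun x _ => ?_
    refine le_tail (traceless_mem hPQ (HC_mem_aSpace P _)) (fun m hm => ?_) x.2
    by_cases hmQ : m ∈ Q.boundaries
    · exact (tail_traceless hmQ _).ge
    · obtain ⟨i, j, hB, h1, h2⟩ := exists_isBlock_of_notMem hmQ
      have h3 := hss _ _ (consec_flag_iff.2 ⟨i, j, hB, rfl, rfl⟩) (rowSpan (q * δ) m)
        (by rw [← rowSpan_mul_of_mem hq δ hB.right_mem, rowSpan_lt_iff]; exact h2)
        (by rw [← rowSpan_mul_of_mem hq δ hB.left_mem, rowSpan_lt_iff]; exact h1)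
      rw [← rowSpan_mul_of_mem hq δ hB.right_mem, ← rowSpan_mul_of_mem hq δ hB.left_mem,
        ← mul_tail_traceless_HC g _ hPQ hB h1.le h2.le hm] at h3
      exact nonneg_of_mul_nonneg_right h3 hB.sub_pos

theorem truncF_eq [Decidable ((slopeLattice g).Semistable (flag Q δ))] :
    truncF Q (diag δ * g) = if (slopeLattice g).Semistable (flag Q δ) then 1 else 0 :=
  if_congr (degI_nonpos_iff g δ) rfl rfl

end Translate

end Arthur

end

theorem proposition2p5p1 (F : Type*) [Field F] [NumberField F] (n : ℕ) (hn : 1 ≤ n)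
    (Q : Composition n) (g : GL (Fin n) (AdeleRing (𝓞 F) F))
    -- an arbitrary system of representatives of `P(F) \ Q(F)`, for each `P`
    (s : ∀ P : Composition n, Arthur.LeftQuot F P Q → Arthur.parabolic F Q)
    (hs : ∀ P x, Quotient.mk _ (s P x) = x) :
    -- the maximum that defines the degree of instability is finite and attained
    (∀ (P : Composition n) (h : GL (Fin n) (AdeleRing (𝓞 F) F)),
      IsGreatest (Arthur.degSet P h) (Arthur.degI P h)) ∧
    -- first identity
    (∀ P ∈ Arthur.below F Q, {x : Arthur.LeftQuot F P Q |
      Arthur.truncF P (Arthur.diag (s P x : GL (Fin n) F) * g) *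
        Arthur.tau P Q (Arthur.HC P (Arthur.diag (s P x : GL (Fin n) F) * g)) ≠ 0}.Finite) ∧
    (1 = ∑ P ∈ Arthur.below F Q, ∑ᶠ x : Arthur.LeftQuot F P Q,
      Arthur.truncF P (Arthur.diag (s P x : GL (Fin n) F) * g) *
        Arthur.tau P Q (Arthur.HC P (Arthur.diag (s P x : GL (Fin n) F) * g))) ∧
    -- second identity
    (∀ P ∈ Arthur.below F Q, {x : Arthur.LeftQuot F P Q |
      Arthur.tauHat P Q (Arthur.HC P (Arthur.diag (s P x : GL (Fin n) F) * g)) ≠ 0}.Finite) ∧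
    (Arthur.truncF Q g = ∑ P ∈ Arthur.below F Q, Arthur.eps P Q *
      ∑ᶠ x : Arthur.LeftQuot F P Q,
        Arthur.tauHat P Q (Arthur.HC P (Arthur.diag (s P x : GL (Fin n) F) * g))) := by
  classical
  set D := Arthur.slopeLattice g
  set U := Arthur.flag Q (1 : GL (Fin n) F)
  have hU : Arthur.IsFlag U := Arthur.isFlag_flag Q 1
  -- the flag of `Q` is the same for all representatives
  have hsU : ∀ P x, Arthur.flag Q (s P x).1 = U := by
    intro P x
    have h := Arthur.flag_mul (s P x).2 1
    rwa [mul_one] at h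
  obtain ⟨C₀, hC₀, huniq⟩ := Arthur.SlopeLattice.existsUnique_hnFlag D hU
  have h1 := Arthur.sum_leftQuot Q s hs
    (fun P x => Arthur.truncF P (Arthur.diag (s P x).1 * g) *
      Arthur.tau P Q (Arthur.HC P (Arthur.diag (s P x).1 * g)))
    (fun C => (if D.Semistable C then 1 else 0) * if D.StrictlyConvex U C then 1 else 0)
    (fun P _ x => by rw [Arthur.truncF_eq, Arthur.tau_eq, hsU]) {C₀}
    (fun C hC => by
      rw [Finset.mem_singleton.1 hC]
      exact ⟨hC₀.1, hC₀.2.1⟩)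
    (fun C hC hUC hne => by
      refine Finset.mem_singleton.2 (huniq C ⟨hC, hUC, ?_, ?_⟩) <;> by_contra h <;> simp [h] at hne)
  have h2 := Arthur.sum_leftQuot Q s hs
    (fun P x => Arthur.tauHat P Q (Arthur.HC P (Arthur.diag (s P x).1 * g)))
    (fun C => if D.Below U C then 1 else 0)
    (fun P hP x => by rw [Arthur.tauHat_eq g _ hP, hsU])
    (Arthur.SlopeLattice.finite_flags_below D hU).toFinset
    (fun C hC => by
      have := (Set.Finite.mem_toFinset _).1 hC
      exact ⟨this.1, this.2.1⟩)
    (fun C hC hUC hne => by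
      refine (Set.Finite.mem_toFinset _).2 ⟨hC, hUC, ?_⟩
      by_contra h
      simp [h] at hne)
  have h3 := Arthur.sum_leftQuot Q s hs
    (fun P x => Arthur.eps P Q * Arthur.tauHat P Q (Arthur.HC P (Arthur.diag (s P x).1 * g)))
    (fun C => (-1) ^ (C.card + U.card) * if D.Below U C then 1 else 0)
    (fun P hP x => by
      rw [Arthur.tauHat_eq g _ hP, hsU, Arthur.eps_eq, Arthur.card_flag, Arthur.card_flag])
    (Arthur.SlopeLattice.finite_flags_below D hU).toFinset
    (fun C hC => by
      have := (Set.Finite.mem_toFinset _).1 hC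
      exact ⟨this.1, this.2.1⟩)
    (fun C hC hUC hne => by
      refine (Set.Finite.mem_toFinset _).2 ⟨hC, hUC, ?_⟩
      by_contra h
      simp [h] at hne)
  refine ⟨fun P h => Arthur.isGreatest_degI h P, h1.1, ?_, h2.1, ?_⟩
  · rw [h1.2, Finset.sum_singleton, if_pos hC₀.2.2.1, if_pos hC₀.2.2.2, one_mul]
  · have hg : g = Arthur.diag (1 : GL (Fin n) F) * g := by rw [Arthur.diag, map_one, one_mul]
    conv_lhs => rw [hg]
    rw [Arthur.truncF_eq, ← Arthur.SlopeLattice.sum_flags_below D hU]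
    refine Eq.trans ?_ (h3.2.symm.trans (Finset.sum_congr rfl fun P hP => ?_))
    · refine Finset.sum_congr rfl fun C hC => ?_
      have := (Set.Finite.mem_toFinset _).1 hC
      rw [if_pos this.2.2, mul_one]
    · exact (mul_finsum _ _).symm
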